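/- **Setting.** Let $x>0$ and $a=e^{-x}\in(0,1)$. The Paley--Wiener space $PW_x$ is the space of entire functions of exponential type at most $x$ (for each $\epsilon>0$, $|f(z)|\le C_\epsilon e^{(x+\epsilon)|z|}$) that are square integrable on $\mathbb R$, with the scalar product $(f,g)=\frac1{2\pi}\int_{\mathbb R}\overline{f(t)}\,g(t)\,dt$. Let $\kappa_1,\dots,\kappa_n$ be distinct real numbers, $z_j=-i\kappa_j$, $\sigma=(z_1,\dots,z_n)$, and let $$PW_x(\sigma)=\Big\{\frac{f(z)}{\prod_{j}(z-z_j)}\;:\;f\in PW_x,\ f(z_1)=\dots=f(z_n)=0\Big\},$$ a space of entire functions, with the scalar product for which $\frac{f}{\prod_j(z-z_j)}\mapsto f$ is an isometry into $PW_x$. **Theorem.** **(1)** The functions in $PW_x$ that vanish on $\sigma$ form a closed subspace, $PW_x(\sigma)$ is identified with it, and $PW_x(\sigma)$ is a Hilbert space with evaluators: for every $z\in\mathbb C$ there is $\mathcal K_z\in PW_x(\sigma)$ with $(\mathcal K_z,F)=F(z)$ for all $F\in PW_x(\sigma)$. There is a unique entire function $\mathcal E_\sigma=\mathcal E_{\sigma,x}$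 such that $\mathcal E_\sigma(it)$ is real for real $t$, $\mathcal E_\sigma(0)>0$, $\lim_{t\to+\infty}\mathcal E_\sigma(-it)/\mathcal E_\sigma(it)=0$, and for all $z,w$ with $\overline z\ne w$ $$(\mathcal K_w,\mathcal K_z)=\frac{\overline{\mathcal E_\sigma(z)}\,\mathcal E_\sigma(w)-\mathcal E_\sigma(\overline z)\,\overline{\mathcal E_\sigma(\overline w)}}{i(\overline z-w)} .$$ **(2)** Put $\mathcal F_\sigma(w)=\overline{\mathcal E_\sigma(\overline w)}$. Then $\mathcal F_\sigma(w)=\mathcal E_\sigma(-w)$, and there is a real function $\mu_\sigma$ of $a\in(0,1)$ such that, for all $w\in\mathbb C$ and all $a\in(0,1)$, $$-a\frac{d}{da}\mathcal E_\sigma(w)=-iw\,\mathcal E_\sigma(w)+\mu_\sigma(a)\,\mathcal F_\sigma(w).$$ **(3)** Let $W$ denote the Wronskian determinant with respect to $x=\log\frac1a$. If $\kappa_i+\kappa_j\ne0$ for all $i,j$ (including $i=j$), then the two Wronskians below do not vanish and $$\mu_\sigma(a)=a\frac{d}{da}\log\left|\frac{W(\cosh(\kappa_1x),\dots,\cosh(\kappa_nx))}{W(\sinh(\kappa_1x),\dots,\sinh(\kappa_nx))}\right|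 .$$ **(4)** Without this restriction, let $G=\big(\int_{-x}^xe^{(\kappa_i+\kappa_j)y}dy\big)_{1\le i,j\le n}$ and $g_n(a)=\det G$. Then $g_n(a)>0$, $$\mu_\sigma(a)=\frac{2(-1)^n}{g_n(a)}\begin{vmatrix}G&u\\ v^{T}&0\end{vmatrix},\qquad u=(e^{-x\kappa_i})_{1\le i\le n},\quad v=(e^{x\kappa_j})_{1\le j\le n},$$ and $$\mu_\sigma(a)^2=-\Big(a\frac{d}{da}\Big)^2\log g_n(a).$$ **(5)** Let $n\ge1$, $\nu\in\mathbb R$, $\kappa_j=\frac{\nu+1}2+j-1$ for $1\le j\le n$, and write $\mu_{\nu,n}$ for $\mu_\sigma$. Then, for $a\in(0,1)$, $$\mu_{\nu,n}(a)=2n\,\frac{\int_{[a,1/a]^{n-1}}\prod_{i<j}(t_j-t_i)^2\prod_it_i^\nu(t_i-a)(\frac1a-t_i)\,dt_1\cdots dt_{n-1}}{\int_{[a,1/a]^{n}}\prod_{i<j}(t_j-t_i)^2\prod_it_i^\nu\,dt_1\cdots dt_{n}}$$ (the numerator is $1$ when $n=1$); the denominator is positive and $\mu_{\nu,n}(a)\neq0$.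 The function $q=a\,\mu_{\nu+1,n}(a)/\mu_{\nu,n}(a)$ of $b=a^2\in(0,1)$ never takes the values $0$, $1$, $b$, and it satisfies the Painlevé VI equation $$\begin{aligned}\frac{d^2q}{db^2}={}&\frac12\Big\{\frac1q+\frac1{q-1}+\frac1{q-b}\Big\}\Big(\frac{dq}{db}\Big)^2-\Big\{\frac1b+\frac1{b-1}+\frac1{q-b}\Big\}\frac{dq}{db}\\&+\frac{q(q-1)(q-b)}{b^2(b-1)^2}\Big\{\alpha+\frac{\beta b}{q^2}+\frac{\gamma(b-1)}{(q-1)^2}+\frac{\delta b(b-1)}{(q-b)^2}\Big\}\end{aligned}$$ with $(\alpha,\beta,\gamma,\delta)=\Big(\frac{(\nu+n)^2}2,-\frac{(\nu+n+1)^2}2,\frac{n^2}2,\frac{1-n^2}2\Big)$. -/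

import Mathlib

open MeasureTheory Filter Topology ComplexConjugate

/-! ## Paley-Wiener spaces -/

/-- `f` is of exponential type at most `x`: for every `ε > 0` there is `C` with
`|f z| ≤ C exp ((x + ε) |z|)` for all complex `z`. -/
def ExpTypeLE (x : ℝ) (f : ℂ → ℂ) : Prop :=
  ∀ ε : ℝ, 0 < ε → ∃ C : ℝ, ∀ z : ℂ, ‖f z‖ ≤ C * Real.exp ((x + ε) * ‖z‖)

/-- The entire functions of exponential type at most `x` which are square integrable on the
real line, as a vector space of functions. -/
def paleyWienerSubmodule (x : ℝ) : Submodule ℂ (ℂ → ℂ) where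
  carrier := {f | Differentiable ℂ f ∧ ExpTypeLE x f ∧ MemLp (fun t : ℝ => f (t : ℂ)) 2 volume}
  zero_mem' := by
    refine ⟨differentiable_const 0, fun ε _ => ⟨0, fun z => by simp⟩, ?_⟩
    exact MemLp.zero (p := 2)
  add_mem' := by
    rintro f g ⟨hf, hf', hf''⟩ ⟨hg, hg', hg''⟩
    refine ⟨hf.add hg, fun ε hε => ?_, hf''.add hg''⟩
    obtain ⟨C, hC⟩ := hf' ε hε
    obtain ⟨C', hC'⟩ := hg' ε hε
    refine ⟨C + C', fun z => ?_⟩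
    calc ‖f z + g z‖ ≤ ‖f z‖ + ‖g z‖ := norm_add_le _ _
      _ ≤ _ := by rw [add_mul]; exact add_le_add (hC z) (hC' z)
  smul_mem' := by
    rintro c f ⟨hf, hf', hf''⟩
    refine ⟨hf.const_smul c, fun ε hε => ?_, hf''.const_smul c⟩
    obtain ⟨C, hC⟩ := hf' ε hε
    refine ⟨‖c‖ * C, fun z => ?_⟩
    rw [Pi.smul_apply, norm_smul, mul_assoc]
    exact mul_le_mul_of_nonneg_left (hC z) (norm_nonneg c)

/-- The Paley-Wiener space `PW_x`. -/
def PaleyWiener (x : ℝ) : Type := paleyWienerSubmodule x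

namespace PaleyWiener

variable {x : ℝ}

noncomputable instance : AddCommGroup (PaleyWiener x) :=
  inferInstanceAs (AddCommGroup (paleyWienerSubmodule x))

noncomputable instance : Module ℂ (PaleyWiener x) :=
  inferInstanceAs (Module ℂ (paleyWienerSubmodule x))

instance : CoeFun (PaleyWiener x) (fun _ => ℂ → ℂ) := ⟨fun f => f.1⟩

theorem add_apply (f g : PaleyWiener x) (w : ℂ) : (f + g) w = f w + g w := rfl

theorem smul_apply (c : ℂ) (f : PaleyWiener x) (w : ℂ) : (c • f) w = c * f w := rfl

theorem memLp (f : PaleyWiener x) : MemLp (fun t : ℝ => f (t : ℂ)) 2 volume := f.2.2.2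

theorem integrable_mul (f g : PaleyWiener x) :
    Integrable (fun t : ℝ => conj (f (t : ℂ)) * g (t : ℂ)) volume :=
  f.memLp.star.integrable_mul g.memLp

/-- The scalar product `(f, g) = (1 / 2π) ∫ conj (f t) * g t dt`, conjugate linear in the first
variable. -/
noncomputable def scalarProd (f g : PaleyWiener x) : ℂ :=
  (2 * Real.pi : ℂ)⁻¹ * ∫ t : ℝ, conj (f (t : ℂ)) * g (t : ℂ)

theorem scalarProd_self (f : PaleyWiener x) :
    scalarProd f f = (((2 * Real.pi)⁻¹ * ∫ t : ℝ, ‖f (t : ℂ)‖ ^ 2 : ℝ) : ℂ) := by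
  rw [scalarProd]
  push_cast
  congr 1
  rw [← integral_complex_ofReal]
  congr 1
  ext t
  rw [← Complex.normSq_eq_conj_mul_self, Complex.normSq_eq_norm_sq]

/-- An entire function that vanishes on the real line is zero. -/
theorem eq_zero_of_real {f : ℂ → ℂ} (hf : Differentiable ℂ f) (h : ∀ t : ℝ, f t = 0) : f = 0 := by
  have han : AnalyticOnNhd ℂ f Set.univ := fun z _ => hf.analyticAt z
  have hfreq : ∃ᶠ z in 𝓝[≠] (0 : ℂ), f z = 0 := by
    have ht : Tendsto (fun t : ℝ => (t : ℂ)) (𝓝[≠] (0 : ℝ)) (𝓝[≠] (0 : ℂ)) := by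
      refine tendsto_nhdsWithin_iff.2 ⟨?_, ?_⟩
      · exact (Complex.continuous_ofReal.tendsto' 0 0 (by simp)).mono_left nhdsWithin_le_nhds
      · filter_upwards [self_mem_nhdsWithin] with t ht
        simpa using ht
    exact ht.frequently (Eventually.frequently (Eventually.of_forall h))
  funext z
  exact han.eqOn_zero_of_preconnected_of_frequently_eq_zero isPreconnected_univ
    (Set.mem_univ 0) hfreq (Set.mem_univ z)

@[reducible]
noncomputable def core : InnerProductSpace.Core ℂ (PaleyWiener x) where
  inner := scalarProd
  conj_inner_symm f g := by
    rw [scalarProd, scalarProd, map_mul, ← integral_conj]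
    congr 1
    · rw [map_inv₀, map_mul, Complex.conj_ofReal, map_ofNat]
    · congr 1
      ext t
      simp [mul_comm]
  re_inner_nonneg f := by
    rw [scalarProd_self]
    change 0 ≤ (2 * Real.pi)⁻¹ * ∫ t : ℝ, ‖f (t : ℂ)‖ ^ 2
    exact mul_nonneg (by positivity) (integral_nonneg fun t => by positivity)
  definite f h := by
    rw [scalarProd_self] at h
    have h1 : ∫ t : ℝ, ‖f (t : ℂ)‖ ^ 2 = 0 := by
      have h2 := Complex.ofReal_eq_zero.1 h
      exact (mul_eq_zero.1 h2).resolve_left (by positivity)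
    have hint : Integrable (fun t : ℝ => ‖f (t : ℂ)‖ ^ 2) volume :=
      (memLp_two_iff_integrable_sq_norm f.memLp.1).1 f.memLp
    have h3 := (integral_eq_zero_iff_of_nonneg (fun t => by positivity) hint).1 h1
    have hcont : Continuous (fun t : ℝ => ‖f (t : ℂ)‖ ^ 2) :=
      ((f.2.1.continuous.comp Complex.continuous_ofReal).norm).pow 2
    have h4 := (hcont.ae_eq_iff_eq (μ := volume) continuous_zero).1 h3
    have h5 : ∀ t : ℝ, f (t : ℂ) = 0 := fun t => by simpa using congrFun h4 t
    exact Subtype.ext (eq_zero_of_real f.2.1 h5)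
  add_left f g k := by
    simp only [scalarProd, add_apply, map_add, add_mul]
    rw [integral_add (integrable_mul f k) (integrable_mul g k), mul_add]
  smul_left f g r := by
    simp only [scalarProd, smul_apply, map_mul, mul_assoc]
    rw [integral_const_mul, mul_left_comm]

noncomputable instance : NormedAddCommGroup (PaleyWiener x) :=
  @InnerProductSpace.Core.toNormedAddCommGroup ℂ (PaleyWiener x) _ _ _ core

noncomputable instance : InnerProductSpace ℂ (PaleyWiener x) := InnerProductSpace.ofCore core.toCore

theorem inner_def (f g : PaleyWiener x) :
    inner ℂ f g = (2 * Real.pi : ℂ)⁻¹ * ∫ t : ℝ, conj (f (t : ℂ)) * g (t : ℂ) := rfl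

end PaleyWiener

/-! ## Paley-Wiener spaces modified by trivial zeros -/

/-- The entire functions of the form `f z / ∏ j, (z - z_j)`, where `f` is in `PW_x` and vanishes
at all the points `z_j`. -/
def paleyWienerModSubmodule (x : ℝ) {n : ℕ} (z : Fin n → ℂ) : Submodule ℂ (ℂ → ℂ) where
  carrier := {F | Differentiable ℂ F ∧ ∃ f ∈ paleyWienerSubmodule x, (∀ j, f (z j) = 0) ∧
    ∀ w, (∀ j, w ≠ z j) → F w = f w / ∏ j, (w - z j)}
  zero_mem' := ⟨differentiable_const 0, 0, Submodule.zero_mem _, fun _ => rfl, fun _ _ => by simp⟩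
  add_mem' := by
    rintro F G ⟨hF, f, hf, hf', hf''⟩ ⟨hG, g, hg, hg', hg''⟩
    refine ⟨hF.add hG, f + g, Submodule.add_mem _ hf hg, fun j => by simp [hf', hg'], ?_⟩
    intro w hw
    rw [Pi.add_apply, Pi.add_apply, hf'' w hw, hg'' w hw, add_div]
  smul_mem' := by
    rintro c F ⟨hF, f, hf, hf', hf''⟩
    refine ⟨hF.const_smul c, c • f, Submodule.smul_mem _ c hf, fun j => by simp [hf'], ?_⟩
    intro w hw
    rw [Pi.smul_apply, Pi.smul_apply, hf'' w hw, smul_eq_mul, smul_eq_mul, mul_div_assoc]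

/-- The modified Paley-Wiener space `PW_x(σ)`, `σ = (z_1, …, z_n)`. -/
def PaleyWienerMod (x : ℝ) {n : ℕ} (z : Fin n → ℂ) : Type := paleyWienerModSubmodule x z

namespace PaleyWienerMod

variable {x : ℝ} {n : ℕ} {z : Fin n → ℂ}

noncomputable instance : AddCommGroup (PaleyWienerMod x z) :=
  inferInstanceAs (AddCommGroup (paleyWienerModSubmodule x z))

noncomputable instance : Module ℂ (PaleyWienerMod x z) :=
  inferInstanceAs (Module ℂ (paleyWienerModSubmodule x z))

instance : CoeFun (PaleyWienerMod x z) (fun _ => ℂ → ℂ) := ⟨fun F => F.1⟩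

theorem mul_mem (F : PaleyWienerMod x z) :
    (fun w => (∏ j, (w - z j)) * F w) ∈ paleyWienerSubmodule x := by
  obtain ⟨_, f, hf, hf', hf''⟩ := F.2
  convert hf using 1
  funext w
  by_cases hw : ∀ j, w ≠ z j
  · rw [hf'' w hw, mul_div_cancel₀]
    exact Finset.prod_ne_zero_iff.2 fun j _ => sub_ne_zero.2 (hw j)
  · push Not at hw
    obtain ⟨j, rfl⟩ := hw
    rw [hf' j, Finset.prod_eq_zero (Finset.mem_univ j) (sub_self _), zero_mul]

/-- The linear map `F ↦ f`, `f w = (∏ j, (w - z_j)) * F w`, from `PW_x(σ)` to `PW_x`. -/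
noncomputable def incomplete : PaleyWienerMod x z →ₗ[ℂ] PaleyWiener x where
  toFun F := ⟨fun w => (∏ j, (w - z j)) * F w, F.mul_mem⟩
  map_add' F G := Subtype.ext (funext fun w => mul_add _ (F w) (G w))
  map_smul' c F := Subtype.ext (funext fun w => mul_left_comm _ c (F w))

theorem incomplete_apply (F : PaleyWienerMod x z) (w : ℂ) :
    incomplete F w = (∏ j, (w - z j)) * F w := rfl

theorem incomplete_injective : Function.Injective (incomplete (x := x) (z := z)) := by
  rw [injective_iff_map_eq_zero]
  intro F hF
  have h0 : ∀ w, (∏ j, (w - z j)) * F w = 0 := fun w => congrFun (congrArg Subtype.val hF) w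
  have hfin : (Set.range z).Finite := Set.finite_range z
  have hd : Dense (Set.range z)ᶜ := hfin.countable.dense_compl ℝ
  refine Subtype.ext (Continuous.ext_on hd F.2.1.continuous continuous_zero ?_)
  intro w hw
  refine (mul_eq_zero.1 (h0 w)).resolve_left (Finset.prod_ne_zero_iff.2 fun j _ => ?_)
  exact sub_ne_zero.2 fun h => hw ⟨j, h.symm⟩

/-- The scalar product of `PW_x(σ)`, for which `incomplete` is isometric. -/
noncomputable def scalarProd (F G : PaleyWienerMod x z) : ℂ :=
  inner ℂ (incomplete F) (incomplete G)

@[reducible]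
noncomputable def core : InnerProductSpace.Core ℂ (PaleyWienerMod x z) where
  inner := scalarProd
  conj_inner_symm F G := inner_conj_symm (incomplete F) (incomplete G)
  re_inner_nonneg F := inner_self_nonneg (x := incomplete F)
  definite F h := incomplete_injective
    ((inner_self_eq_zero.1 (h : inner ℂ (incomplete F) (incomplete F) = 0)).trans
      (map_zero _).symm)
  add_left F G K := by
    rw [scalarProd, map_add]
    exact inner_add_left _ _ _
  smul_left F G r := by
    rw [scalarProd, map_smul]
    exact inner_smul_left _ _ _

noncomputable instance : NormedAddCommGroup (PaleyWienerMod x z) :=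
  @InnerProductSpace.Core.toNormedAddCommGroup ℂ (PaleyWienerMod x z) _ _ _ core

noncomputable instance : InnerProductSpace ℂ (PaleyWienerMod x z) :=
  InnerProductSpace.ofCore core.toCore

theorem inner_def (F G : PaleyWienerMod x z) :
    inner ℂ F G = inner ℂ (incomplete F) (incomplete G) := rfl

end PaleyWienerMod

/-- The points `z_j = -i κ_j`. -/
noncomputable def trivialZeros {n : ℕ} (κ : Fin n → ℝ) (j : Fin n) : ℂ := -Complex.I * κ j

/-- `E` is an entire function which is real on the imaginary axis and positive at the origin,
for which `E (-it) / E (it) → 0` as `t → +∞`, and which gives the scalar products of the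
evaluators `K z` of the space `PW_x(σ)`, `σ = (-i κ_1, …, -i κ_n)`. -/
structure IsKernelGenerator (x : ℝ) {n : ℕ} (κ : Fin n → ℝ) (E : ℂ → ℂ) : Prop where
  entire : Differentiable ℂ E
  real_on_imag : ∀ t : ℝ, (E (Complex.I * t)).im = 0
  pos_zero : 0 < (E 0).re
  tendsto_zero : Tendsto (fun t : ℝ => E (-(Complex.I * t)) / E (Complex.I * t)) atTop (𝓝 0)
  kernel : ∃ K : ℂ → PaleyWienerMod x (trivialZeros κ),
    (∀ (z : ℂ) (F : PaleyWienerMod x (trivialZeros κ)), inner ℂ (K z) F = F z) ∧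
    ∀ z w : ℂ, conj z ≠ w → inner ℂ (K w) (K z) =
      (conj (E z) * E w - E (conj z) * conj (E (conj w))) / (Complex.I * (conj z - w))

/-! ## Determinants -/

/-- The Wronskian determinant `W(f_1, …, f_n)` at `x`. -/
noncomputable def wronskianDet {n : ℕ} (f : Fin n → ℝ → ℝ) (x : ℝ) : ℝ :=
  (Matrix.of fun i j : Fin n => iteratedDeriv (i : ℕ) (f j) x).det

/-- The matrix with entries `∫_{-x}^x exp ((κ_i + κ_j) y) dy`. -/
noncomputable def expGram {n : ℕ} (κ : Fin n → ℝ) (x : ℝ) : Matrix (Fin n) (Fin n) ℝ :=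
  Matrix.of fun i j => ∫ y in (-x)..x, Real.exp ((κ i + κ j) * y)

/-- The matrix `expGram κ x` bordered by the last column `exp (-x κ_i)`, the last row
`exp (x κ_j)`, and a zero in the corner. -/
noncomputable def borderedGram {n : ℕ} (κ : Fin n → ℝ) (x : ℝ) :
    Matrix (Fin n ⊕ Unit) (Fin n ⊕ Unit) ℝ :=
  Matrix.fromBlocks (expGram κ x) (Matrix.of fun i _ => Real.exp (-x * κ i))
    (Matrix.of fun _ j => Real.exp (x * κ j)) 0

/-- The function `g_n(a) = det (∫_{-x}^x exp ((κ_i + κ_j) y) dy)`, where `x = log (1 / a)`. -/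
noncomputable def gramFun {n : ℕ} (κ : Fin n → ℝ) (a : ℝ) : ℝ := (expGram κ (-Real.log a)).det

/-- The operator `a d/da`. -/
noncomputable def eulerDeriv (f : ℝ → ℝ) (a : ℝ) : ℝ := a * deriv f a

/-- The arithmetic progression `κ_j = (ν + 1) / 2 + j - 1`, `1 ≤ j ≤ n` (the index of
`Fin n` being `j - 1`). -/
noncomputable def arithProg (ν : ℝ) (n : ℕ) (j : Fin n) : ℝ := (ν + 1) / 2 + (j : ℝ)

/-! ## Multiple integrals -/

/-- The product of `(t_j - t_i) ^ 2` over `i < j`. -/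
noncomputable def vandermondeSq {m : ℕ} (t : Fin m → ℝ) : ℝ :=
  ∏ i : Fin m, ∏ j ∈ Finset.Ioi i, (t j - t i) ^ 2

/-- The integral of `∏_{i<j} (t_j - t_i) ^ 2 * ∏ i, w (t_i)` over the cube `[a, 1/a] ^ m`;
it is `1` when `m = 0`. -/
noncomputable def cubeIntegral (m : ℕ) (a : ℝ) (w : ℝ → ℝ) : ℝ :=
  ∫ t in Set.Icc (fun _ : Fin m => a) (fun _ : Fin m => 1 / a), vandermondeSq t * ∏ i, w (t i)

/-! ## The sixth Painlevé equation -/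

/-- On the set `s` the function `q` is a twice differentiable solution of the sixth Painlevé
equation with parameters `α, β, γ, δ`, and no denominator of the equation vanishes. -/
def SolvesPainleveVI (α β γ δ : ℝ) (q : ℝ → ℝ) (s : Set ℝ) : Prop :=
  ∀ b ∈ s, b ≠ 0 ∧ b ≠ 1 ∧ q b ≠ 0 ∧ q b ≠ 1 ∧ q b ≠ b ∧
    DifferentiableAt ℝ q b ∧ DifferentiableAt ℝ (deriv q) b ∧
    deriv (deriv q) b =
      1 / 2 * (1 / q b + 1 / (q b - 1) + 1 / (q b - b)) * deriv q b ^ 2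
      - (1 / b + 1 / (b - 1) + 1 / (q b - b)) * deriv q b
      + q b * (q b - 1) * (q b - b) / (b ^ 2 * (b - 1) ^ 2)
        * (α + β * b / q b ^ 2 + γ * (b - 1) / (q b - 1) ^ 2
          + δ * b * (b - 1) / (q b - b) ^ 2)

/-! Write x = log(1/a). The evaluator of `PW_x` at z is w ↦ ∫_{-x}^x exp(iy(conj z - w)) dy: for f
in `PW_x` the function f(ζ) exp(ixζ) lies in a Hardy class of the upper half-plane, and Cauchy's
formula there gives the reproducing property (`integral_conj_pwKernel_mul`). Evaluator bounds give
completeness, and a maximum principle together with Riesz gives the evaluators of `PW_x(σ)`.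

The Gram matrix of the evaluators at the z_j is G = `expGram`. With u = (exp(-xκ_j)), v =
(exp(xκ_j)), K = diag(κ_j), two low-rank formulas drive everything: G' = uuᵀ + vvᵀ
(`hasDerivAt_expGram`) and KG + GK = vvᵀ - uuᵀ (`add_mul_expGram`). For c = G⁻¹u, d = G⁻¹v, s =
vᵀG⁻¹u they imply c' = Kc - 2sd, d' = -Kd - 2sc and (log det G)'' = -4s². The coefficient μ is
-2(-1)ⁿs, which is the bordered determinant of part (4), and the last formula is μ² = -(a d/da)² log
g_n.

Let A and B be exp(-ixw) and exp(ixw) corrected by combinations of the evaluators at the z_j with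
coefficients c and d. Projecting the evaluators of `PW_x` onto the functions vanishing on σ and
multiplying by i(conj z - w) leaves conj A(z) A(w) - conj B(z) B(w) (`mul_projKernel`). An identity
between bordered determinants ties B(w) to A(-w) (`prod_mul_projMinus_neg`), so E = iⁿA/∏(w - z_j)
satisfies the kernel formula with F(w) = E(-w). Its differential system is A' = -iwA - 2sB divided
by the product. Positivity of K_z(z) keeps E(it) away from zero for t ≥ 0, and its sign is read off
as t → ∞. For uniqueness, the kernel determines the even and odd parts of E(it) up to reciprocal
factors, and the limit condition fixes the factor (`eq_of_skew_product_eq`).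

At w = 0 the system says that μ is minus the Euler derivative of log E(0). The numerator of A gives
a linear recurrence between the rows of the Wronskian of the hyperbolic cosines, and its constant
term yields W(sinh) = ∏κ_j · E(0) · W(cosh) (`wronskianDet_sinh_eq_mul`).

When the κ_j are in arithmetic progression, G is a Hankel matrix of moments of T^ν on [a, 1/a].
Andréief's identity turns its determinants into multiple integrals, and sign-definite weights make
the needed quantities nonzero. Put c₀ and d₀ for the first entries of c and d, and ρ₋, ρ₊ for the
normalized values of the orthogonal polynomial of degree n at the two ends of the interval. These
four functions obey linear equations with coefficient s. The relations with the progression for ν +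
1 express s and its shifted analogue rationally through them. Hence M = c₀ρ₊/(d₀ρ₋) and L = (c₀ρ₋ +
d₀ρ₊)/(c₀ρ₋ - d₀ρ₊) satisfy a closed first-order system in b = a², with q = b(M - 1)/(bM - 1), and
eliminating L gives Painlevé VI (`solvesPainleveVI_of_system`). -/

/-! ## Integrals depending holomorphically on a parameter -/

theorem hasDerivAt_intervalIntegral_of_continuous {g g' : ℂ → ℝ → ℂ} (a b : ℝ)
    (hg : ∀ z s, HasDerivAt (fun z => g z s) (g' z s) z)
    (hc : Continuous (Function.uncurry g)) (hc' : Continuous (Function.uncurry g')) (z : ℂ) :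
    HasDerivAt (fun z => ∫ s in a..b, g z s) (∫ s in a..b, g' z s) z := by
  have hK : IsCompact (Metric.closedBall z 1 ×ˢ Set.uIcc a b) :=
    (isCompact_closedBall z 1).prod isCompact_uIcc
  obtain ⟨C, hC⟩ := hK.exists_bound_of_continuousOn hc'.continuousOn
  have hs : ∀ w, Continuous (g w) := fun w => hc.comp (by fun_prop : Continuous fun s => (w, s))
  have hs' : ∀ w, Continuous (g' w) := fun w => hc'.comp (by fun_prop : Continuous fun s => (w, s))
  refine (intervalIntegral.hasDerivAt_integral_of_dominated_loc_of_deriv_le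
    (bound := fun _ => C) (Metric.closedBall_mem_nhds z one_pos)
    (Eventually.of_forall fun w => (hs w).aestronglyMeasurable)
    ((hs z).intervalIntegrable a b) (hs' z).aestronglyMeasurable ?_
    intervalIntegrable_const ?_).2
  · exact Eventually.of_forall fun t ht w hw => hC (w, t) ⟨hw, Set.uIoc_subset_uIcc ht⟩
  · exact Eventually.of_forall fun t _ w _ => hg w t

theorem hasDerivAt_intervalIntegral_shift {f : ℂ → ℂ} (hf : Differentiable ℂ f) {h : ℝ → ℂ}
    (hh : Continuous h) (a b : ℝ) (z : ℂ) :
    HasDerivAt (fun z => ∫ s in a..b, f (z + s) * h s)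
      (∫ s in a..b, deriv f (z + s) * h s) z := by
  refine hasDerivAt_intervalIntegral_of_continuous (g := fun z s => f (z + s) * h s)
    (g' := fun z s => deriv f (z + s) * h s) a b (fun z s => ?_) ?_ ?_ z
  · exact ((hf _).hasDerivAt.comp_add_const z (s : ℂ)).mul_const _
  · have := hf.continuous
    simp only [Function.uncurry_def]
    fun_prop
  · have : Continuous (deriv f) := (hf.contDiff (n := 1)).continuous_deriv le_rfl
    simp only [Function.uncurry_def]
    fun_prop

/-! ## The Cauchy-Schwarz inequality for integrals -/

theorem norm_integral_mul_le_sqrt {α : Type*} [MeasurableSpace α] {μ : Measure α} {f g : α → ℂ}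
    (hf : MemLp f 2 μ) (hg : MemLp g 2 μ) :
    ‖∫ t, f t * g t ∂μ‖ ≤ √(∫ t, ‖f t‖ ^ 2 ∂μ) * √(∫ t, ‖g t‖ ^ 2 ∂μ) := by
  have h := integral_mul_norm_le_Lp_mul_Lq (f := f) (g := g) (μ := μ) Real.HolderConjugate.two_two
    (by simpa using hf) (by simpa using hg)
  simp only [Real.rpow_two, ← Real.sqrt_eq_rpow] at h
  refine (norm_integral_le_integral_norm _).trans ?_
  simpa only [norm_mul] using h

theorem memLp_two_restrict_of_continuous {h : ℝ → ℂ} (hh : Continuous h) (a b : ℝ) :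
    MemLp h 2 (volume.restrict (Set.Ioc a b)) :=
  (memLp_two_iff_integrable_sq_norm hh.aestronglyMeasurable).2
    ((by fun_prop : Continuous fun t => ‖h t‖ ^ 2).integrableOn_Icc.mono_set
      Set.Ioc_subset_Icc_self)

/-! ## The Phragmén-Lindelöf principle for functions of exponential type -/

theorem ExpTypeLE.comp_neg {x : ℝ} {f : ℂ → ℂ} (h : ExpTypeLE x f) :
    ExpTypeLE x fun z => f (-z) := fun ε hε => by
  obtain ⟨C, hC⟩ := h ε hε
  exact ⟨C, fun z => by simpa using hC (-z)⟩

/-- Phragmén-Lindelöf for each x + ε, followed by ε → 0. A function of exponential type has order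
one, which a half-plane allows once growth along the central ray has been removed. -/
theorem ExpTypeLE.norm_le_of_im_nonneg {x M : ℝ} {f : ℂ → ℂ} (h : ExpTypeLE x f)
    (hf : Differentiable ℂ f) (hM : ∀ t : ℝ, ‖f t‖ ≤ M) {z : ℂ} (hz : 0 ≤ z.im) :
    ‖f z‖ ≤ M * Real.exp (x * z.im) := by
  have key : ∀ ε : ℝ, 0 < ε → ‖f z‖ ≤ M * Real.exp ((x + ε) * z.im) := by
    intro ε hε
    obtain ⟨C, hC⟩ := h ε hε
    have hC0 : 0 ≤ C := by simpa using (norm_nonneg _).trans (hC 0)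
    -- Rotation by i carries the right half-plane to the upper one; the exponential factor makes the
    -- function bounded on the positive ray and has modulus one on the boundary.
    set g : ℂ → ℂ := fun ζ => f (Complex.I * ζ) * Complex.exp (-((x + ε : ℝ) : ℂ) * ζ) with hg
    have hgn : ∀ ζ, ‖g ζ‖ = ‖f (Complex.I * ζ)‖ * Real.exp (-(x + ε) * ζ.re) := by
      intro ζ
      rw [hg, norm_mul, Complex.norm_exp]
      congr 2
      simp
    have hgd : Differentiable ℂ g := by
      intro ζ
      have := hf (Complex.I * ζ)
      fun_prop
    have hb := PhragmenLindelof.right_half_plane_of_bounded_on_real (C := M) (f := g)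
      (z := -Complex.I * z) hgd.diffContOnCl ?_ ?_ ?_ (by simpa using hz)
    · rw [hgn] at hb
      have e1 : Complex.I * (-Complex.I * z) = z := by
        rw [← mul_assoc, mul_neg, Complex.I_mul_I, neg_neg, one_mul]
      have e2 : (-Complex.I * z).re = z.im := by simp
      rw [e1, e2] at hb
      rw [neg_mul, Real.exp_neg, ← div_eq_mul_inv, div_le_iff₀ (Real.exp_pos _)] at hb
      exact hb
    · refine ⟨1, by norm_num, 2 * |x + ε|, Asymptotics.IsBigO.of_bound C ?_⟩
      refine Eventually.of_forall fun ζ => ?_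
      rw [hgn, Real.norm_eq_abs, Real.abs_exp, Real.rpow_one]
      have h1 := hC (Complex.I * ζ)
      rw [norm_mul, Complex.norm_I, one_mul] at h1
      have h2 : -(x + ε) * ζ.re ≤ |x + ε| * ‖ζ‖ := by
        refine (le_abs_self _).trans ?_
        rw [abs_mul, abs_neg]
        gcongr
        exact Complex.abs_re_le_norm ζ
      have h3 : (x + ε) * ‖ζ‖ ≤ |x + ε| * ‖ζ‖ := by gcongr; exact le_abs_self _
      calc _ ≤ C * Real.exp ((x + ε) * ‖ζ‖) * Real.exp (-(x + ε) * ζ.re) := by gcongr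
        _ = C * Real.exp ((x + ε) * ‖ζ‖ + -(x + ε) * ζ.re) := by rw [mul_assoc, Real.exp_add]
        _ ≤ _ := by gcongr; linarith
    · refine ⟨C, ?_⟩
      rw [eventually_map]
      filter_upwards [eventually_ge_atTop 0] with t ht
      rw [hgn]
      have h1 := hC (Complex.I * t)
      rw [norm_mul, Complex.norm_I, one_mul, Complex.norm_of_nonneg ht] at h1
      calc _ ≤ C * Real.exp ((x + ε) * t) * Real.exp (-(x + ε) * t) := by
            rw [Complex.ofReal_re]; gcongr
        _ = C := by rw [mul_assoc, ← Real.exp_add, neg_mul, add_neg_cancel, Real.exp_zero, mul_one]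
    · intro t
      rw [hgn]
      have : Complex.I * (t * Complex.I) = ((-t : ℝ) : ℂ) := by
        rw [mul_left_comm, Complex.I_mul_I]; push_cast; ring
      rw [this]
      simpa using hM (-t)
  have hlim : Tendsto (fun ε : ℝ => M * Real.exp ((x + ε) * z.im)) (𝓝[>] 0)
      (𝓝 (M * Real.exp (x * z.im))) := by
    refine Tendsto.mono_left ?_ nhdsWithin_le_nhds
    exact Continuous.tendsto' (by fun_prop) _ _ (by simp)
  exact ge_of_tendsto hlim (by filter_upwards [self_mem_nhdsWithin] with ε hε using key ε hε)

theorem ExpTypeLE.norm_le {x M : ℝ} {f : ℂ → ℂ} (h : ExpTypeLE x f)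
    (hf : Differentiable ℂ f) (hM : ∀ t : ℝ, ‖f t‖ ≤ M) (z : ℂ) :
    ‖f z‖ ≤ M * Real.exp (x * |z.im|) := by
  rcases le_total 0 z.im with hz | hz
  · rw [abs_of_nonneg hz]
    exact h.norm_le_of_im_nonneg hf hM hz
  · have := h.comp_neg.norm_le_of_im_nonneg (f := fun z => f (-z)) (M := M) (z := -z)
      (hf.comp differentiable_neg) (fun t => by simpa using hM (-t)) (by simpa using hz)
    rw [abs_of_nonpos hz]
    simpa using this

/-! ## Bounds for functions of the Paley-Wiener space -/

section bounds

variable {x : ℝ} {f : ℂ → ℂ}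

/-- Averages of f against h are again entire of exponential type x, and Cauchy-Schwarz with
translation invariance bounds them on the real line. Phragmén-Lindelöf thus applies to averages
before f itself is known to be bounded on ℝ. -/
theorem norm_integral_shift_le (hx : 0 ≤ x) (hf : f ∈ paleyWienerSubmodule x) {h : ℝ → ℂ}
    (hh : Continuous h) {a b : ℝ} (hab : a ≤ b) (z : ℂ) :
    ‖∫ s in a..b, f (z + s) * h s‖ ≤
      √(∫ t : ℝ, ‖f t‖ ^ 2) * √(∫ s in a..b, ‖h s‖ ^ 2) * Real.exp (x * |z.im|) := by
  obtain ⟨hfd, hft, hfm⟩ := hf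
  refine ExpTypeLE.norm_le (f := fun z => ∫ s in a..b, f (z + s) * h s) ?_
    (fun z => (hasDerivAt_intervalIntegral_shift hfd hh a b z).differentiableAt) ?_ z
  · intro ε hε
    obtain ⟨C, hC⟩ := hft ε hε
    have hC0 : 0 ≤ C := by simpa using (norm_nonneg _).trans (hC 0)
    obtain ⟨B, hB⟩ := isCompact_Icc.exists_bound_of_continuousOn (s := Set.Icc a b) hh.continuousOn
    have hB0 : 0 ≤ B := (norm_nonneg _).trans (hB a ⟨le_rfl, hab⟩)
    set S := max |a| |b|
    refine ⟨C * Real.exp ((x + ε) * S) * B * |b - a|, fun z => ?_⟩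
    have := intervalIntegral.norm_integral_le_of_norm_le_const (a := a) (b := b)
      (f := fun s : ℝ => f (z + s) * h s)
      (C := C * Real.exp ((x + ε) * (‖z‖ + S)) * B) ?_
    · refine this.trans (le_of_eq ?_)
      rw [mul_add, Real.exp_add]; ring
    · intro s hs
      rw [Set.uIoc_of_le hab] at hs
      have hsS : ‖(s : ℂ)‖ ≤ S := by
        rw [Complex.norm_real]; exact abs_le_max_abs_abs hs.1.le hs.2
      rw [norm_mul]
      gcongr
      · refine (hC _).trans ?_
        gcongr
        exact (norm_add_le _ _).trans (by gcongr)
      · exact hB s ⟨hs.1.le, hs.2⟩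
  · intro t
    have hft : MemLp (fun s : ℝ => f ((t : ℂ) + s)) 2 volume := by
      have := hfm.comp_measurePreserving (measurePreserving_add_left volume t)
      simpa [Function.comp_def] using this
    simp only [intervalIntegral.integral_of_le hab]
    refine (norm_integral_mul_le_sqrt (hft.restrict _)
      (memLp_two_restrict_of_continuous hh a b)).trans ?_
    gcongr
    have e : ∫ s : ℝ, ‖f s‖ ^ 2 = ∫ s : ℝ, ‖f ((t : ℂ) + s)‖ ^ 2 := by
      rw [← integral_add_left_eq_self _ t]
      push_cast
      rfl
    rw [e]
    exact setIntegral_le_integral ((memLp_two_iff_integrable_sq_norm hft.1).1 hft)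
      (Eventually.of_forall fun s => by positivity)

theorem continuous_shift (hf : Differentiable ℂ f) (z : ℂ) :
    Continuous fun s : ℝ => f (z + s) := by
  have := hf.continuous
  fun_prop

/-- Duality: testing the previous bound with h(s) = conj f(z + s), for this fixed z, gives J ≤ √Q ·
exp(x|Im z|) · √J for the integral J on the left, and √J cancels. The bound does not depend on the
interval. -/
theorem intervalIntegral_sq_norm_shift_le (hx : 0 ≤ x) (hf : f ∈ paleyWienerSubmodule x)
    (z : ℂ) {a b : ℝ} (hab : a ≤ b) :
    ∫ s in a..b, ‖f (z + s)‖ ^ 2 ≤ (∫ t : ℝ, ‖f t‖ ^ 2) * Real.exp (x * |z.im|) ^ 2 := by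
  have hcs := continuous_shift hf.1 z
  have hc : Continuous fun s : ℝ => conj (f (z + s)) := Complex.continuous_conj.comp hcs
  have h := norm_integral_shift_le hx hf hc hab z
  set J := ∫ s in a..b, ‖f (z + s)‖ ^ 2 with hJ
  have e : ∫ s in a..b, f (z + s) * conj (f (z + s)) = (J : ℂ) := by
    rw [hJ, ← intervalIntegral.integral_ofReal]
    congr 1
    ext s
    rw [Complex.mul_conj, Complex.normSq_eq_norm_sq]
  have hJ0 : 0 ≤ J := intervalIntegral.integral_nonneg hab fun s _ => by positivity
  have e2 : ∫ s in a..b, ‖conj (f (z + s))‖ ^ 2 = J := by simp [hJ]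
  rw [e, e2, Complex.norm_of_nonneg hJ0] at h
  set Q := ∫ t : ℝ, ‖f t‖ ^ 2
  have hQ0 : 0 ≤ Q := integral_nonneg fun t => by positivity
  have hle : √J * √J ≤ √Q * Real.exp (x * |z.im|) * √J := by
    rw [Real.mul_self_sqrt hJ0]; linarith
  have h2 : √J ≤ √Q * Real.exp (x * |z.im|) := by
    rcases (Real.sqrt_nonneg J).eq_or_lt with h0 | h0
    · rw [← h0]; positivity
    · exact le_of_mul_le_mul_right hle h0
  calc J = √J ^ 2 := (Real.sq_sqrt hJ0).symm
    _ ≤ (√Q * Real.exp (x * |z.im|)) ^ 2 := by gcongr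
    _ = _ := by rw [mul_pow, Real.sq_sqrt hQ0]

/-- Functions of the Paley-Wiener space are square integrable on horizontal lines. -/
theorem integrable_sq_norm_shift (hx : 0 ≤ x) (hf : f ∈ paleyWienerSubmodule x) (z : ℂ) :
    Integrable fun s : ℝ => ‖f (z + s)‖ ^ 2 := by
  have hcs : Continuous fun s : ℝ => ‖f (z + s)‖ ^ 2 := (continuous_shift hf.1 z).norm.pow 2
  refine integrable_of_intervalIntegral_norm_bounded (l := atTop) (a := fun N : ℕ => -(N : ℝ))
    (b := fun N : ℕ => (N : ℝ)) ((∫ t : ℝ, ‖f t‖ ^ 2) * Real.exp (x * |z.im|) ^ 2)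
    (fun N => (hcs.integrableOn_Icc).mono_set Set.Ioc_subset_Icc_self)
    (tendsto_neg_atTop_atBot.comp tendsto_natCast_atTop_atTop) tendsto_natCast_atTop_atTop ?_
  refine Eventually.of_forall fun N => ?_
  have := intervalIntegral_sq_norm_shift_le hx hf z (a := -(N : ℝ)) (b := N)
    (by have : (0 : ℝ) ≤ N := N.cast_nonneg
        linarith)
  simpa using this

theorem integral_sq_norm_shift_le (hx : 0 ≤ x) (hf : f ∈ paleyWienerSubmodule x) (z : ℂ) :
    ∫ s : ℝ, ‖f (z + s)‖ ^ 2 ≤ (∫ t : ℝ, ‖f t‖ ^ 2) * Real.exp (x * |z.im|) ^ 2 := by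
  refine le_of_tendsto (intervalIntegral_tendsto_integral (integrable_sq_norm_shift hx hf z)
    (tendsto_neg_atTop_atBot.comp tendsto_natCast_atTop_atTop)
    (tendsto_natCast_atTop_atTop (R := ℝ))) (Eventually.of_forall fun N => ?_)
  exact intervalIntegral_sq_norm_shift_le hx hf z
    (by have : (0 : ℝ) ≤ N := N.cast_nonneg
        simp only [Function.comp]; linarith)

/-- Functions of the Paley-Wiener space are bounded on horizontal lines. -/
theorem exists_norm_le_exp (hx : 0 ≤ x) (hf : f ∈ paleyWienerSubmodule x) :
    ∃ C : ℝ, 0 ≤ C ∧ ∀ z : ℂ, ‖f z‖ ≤ C * Real.exp (x * |z.im|) := by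
  have hfd := hf.1
  have hh : Continuous fun s : ℝ => (1 - s : ℂ) := by fun_prop
  set Q := √(∫ t : ℝ, ‖f t‖ ^ 2)
  set H := √(∫ s in (0 : ℝ)..1, ‖(1 - s : ℂ)‖ ^ 2)
  -- The weight 1 - s is chosen so that integration by parts gives F'(z) = -f(z) + ∫₀¹ f(z + s) ds.
  -- Hence f is an average minus F', and both are controlled through averages of f.
  set F : ℂ → ℂ := fun z => ∫ s in (0 : ℝ)..1, f (z + s) * (1 - s : ℂ) with hF
  have hFd := hasDerivAt_intervalIntegral_shift hfd hh 0 1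
  have hFdiff : Differentiable ℂ F := fun z => (hFd z).differentiableAt
  have hFb : ∀ z, ‖F z‖ ≤ Q * H * Real.exp (x * |z.im|) :=
    norm_integral_shift_le hx hf hh zero_le_one
  have hcd : Continuous (deriv f) := (hfd.contDiff (n := 1)).continuous_deriv le_rfl
  have hparts : ∀ z, deriv F z = -f z + ∫ s in (0 : ℝ)..1, f (z + s) * 1 := by
    intro z
    rw [(hFd z).deriv]
    have hd1 : ∀ s ∈ Set.uIcc (0 : ℝ) 1,
        HasDerivAt (fun s : ℝ => f (z + s)) (deriv f (z + s)) s := fun s _ => by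
      have h1 : HasDerivAt (fun w : ℂ => f (z + w)) (deriv f (z + s)) (s : ℂ) :=
        (hfd (z + s)).hasDerivAt.comp_const_add z (s : ℂ)
      exact h1.comp_ofReal
    have hd2 : ∀ s ∈ Set.uIcc (0 : ℝ) 1, HasDerivAt (fun s : ℝ => (1 - s : ℂ)) (-1) s :=
      fun s _ => by simpa using (Complex.ofRealCLM.hasDerivAt (x := s)).const_sub 1
    have hp := intervalIntegral.integral_deriv_mul_eq_sub hd1 hd2
      ((by fun_prop : Continuous fun s : ℝ => deriv f (z + s)).intervalIntegrable 0 1)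
      (intervalIntegrable_const)
    have hcs := continuous_shift hfd z
    rw [intervalIntegral.integral_add
      ((by fun_prop : Continuous fun s : ℝ => deriv f (z + s) * (1 - s : ℂ)).intervalIntegrable 0 1)
      ((show Continuous fun s : ℝ => f (z + s) * (-1 : ℂ) from
        hcs.mul continuous_const).intervalIntegrable 0 1)] at hp
    simp only [mul_neg, mul_one, intervalIntegral.integral_neg, Complex.ofReal_one, sub_self,
      mul_zero, Complex.ofReal_zero, add_zero, sub_zero, zero_sub] at hp ⊢
    linear_combination hp
  refine ⟨Q * H * Real.exp x + Q, by positivity, fun z => ?_⟩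
  -- Cauchy's estimate on the unit circle, which reaches height |Im z| + 1; this is the source of
  -- the factor exp(x) in the constant.
  have h1 : ‖deriv F z‖ ≤ Q * H * Real.exp (x * (|z.im| + 1)) / 1 := by
    refine Complex.norm_deriv_le_of_forall_mem_sphere_norm_le one_pos hFdiff.diffContOnCl ?_
    intro w hw
    refine (hFb w).trans ?_
    have h2 : |w.im| ≤ |z.im| + 1 := by
      have h3 : |(w - z).im| ≤ 1 :=
        (Complex.abs_im_le_norm _).trans (by rw [← dist_eq_norm]; exact (Metric.mem_sphere.1 hw).le)
      rw [Complex.sub_im] at h3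
      have h4 := abs_add_le (w.im - z.im) z.im
      rw [sub_add_cancel] at h4
      linarith
    gcongr
  have h2 := norm_integral_shift_le hx hf (continuous_const (y := (1 : ℂ))) zero_le_one z
  have h3 : f z = (∫ s in (0 : ℝ)..1, f (z + s) * 1) - deriv F z := by rw [hparts]; ring
  rw [h3]
  refine (norm_sub_le _ _).trans ((add_le_add h2 h1).trans (le_of_eq ?_))
  rw [mul_add, Real.exp_add]
  simp only [norm_one, one_pow, intervalIntegral.integral_const, sub_zero, smul_eq_mul, mul_one,
    Real.sqrt_one, div_one]
  ring

end bounds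

/-! ## Cauchy's theorem for the upper half-plane -/

theorem integral_inv_sub_sq_add_sq (r : ℝ) {Y : ℝ} (hY : 0 < Y) :
    Integrable (fun t : ℝ => ((t - r) ^ 2 + Y ^ 2)⁻¹) ∧
      ∫ t : ℝ, ((t - r) ^ 2 + Y ^ 2)⁻¹ = Real.pi / Y := by
  have e : (fun t : ℝ => ((t - r) ^ 2 + Y ^ 2)⁻¹) =
      fun t => (Y ^ 2)⁻¹ * (1 + ((t - r) / Y) ^ 2)⁻¹ := by
    funext t
    rw [← mul_inv]
    congr 1
    field_simp
    ring
  rw [e]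
  constructor
  · exact ((integrable_inv_one_add_sq.comp_div hY.ne').comp_sub_right r).const_mul _
  · rw [integral_const_mul, integral_sub_right_eq_self (fun t => (1 + (t / Y) ^ 2)⁻¹) r,
      Measure.integral_comp_div (fun t : ℝ => (1 + t ^ 2)⁻¹) Y, integral_univ_inv_one_add_sq,
      abs_of_pos hY, smul_eq_mul]
    field_simp

/-- Cauchy's theorem on the rectangle [-U, U] × [0, R]. For fixed R the vertical sides are O(R/U)
and vanish as U → ∞; only then does R grow, which is why the bound on the top side has to be uniform
in U. -/
theorem integral_eq_zero_of_upper_halfPlane {φ : ℂ → ℂ}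
    (hd : DifferentiableOn ℂ φ {z | 0 ≤ z.im}) (hi : Integrable fun t : ℝ => φ t) {C R₀ : ℝ}
    (hC : ∀ ζ : ℂ, 0 ≤ ζ.im → R₀ ≤ |ζ.re| → ‖φ ζ‖ ≤ C / |ζ.re|)
    {ε : ℝ → ℝ} (hε : Tendsto ε atTop (𝓝 0))
    (hR : ∀ᶠ R : ℝ in atTop, ∀ U : ℝ, 0 ≤ U → ‖∫ t in (-U)..U, φ (t + R * Complex.I)‖ ≤ ε R) :
    ∫ t : ℝ, φ t = 0 := by
  have key : ∀ᶠ R in atTop, ‖∫ t : ℝ, φ t‖ ≤ ε R := by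
    filter_upwards [hR, eventually_ge_atTop 0] with R hR hR0
    have hlim : Tendsto (fun U : ℝ => ‖∫ t in (-U)..U, φ t‖) atTop (𝓝 ‖∫ t : ℝ, φ t‖) :=
      (intervalIntegral_tendsto_integral hi tendsto_neg_atTop_atBot tendsto_id).norm
    have hlim2 : Tendsto (fun U : ℝ => ε R + 2 * (C / U * |R - 0|)) atTop (𝓝 (ε R)) := by
      have : Tendsto (fun U : ℝ => C / U) atTop (𝓝 0) := tendsto_const_nhds.div_atTop tendsto_id
      simpa using ((this.mul_const |R - 0|).const_mul 2).const_add (ε R)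
    refine le_of_tendsto_of_tendsto hlim hlim2 ?_
    filter_upwards [eventually_ge_atTop R₀, eventually_gt_atTop 0] with U hU hU0
    have hrect := Complex.integral_boundary_rect_eq_zero_of_differentiableOn φ (-U : ℝ)
      (U + R * Complex.I) (hd.mono ?_)
    · simp only [Complex.ofReal_re, Complex.add_re, Complex.mul_re, Complex.I_re, mul_zero,
        Complex.ofReal_im, Complex.I_im, mul_one, sub_self, add_zero, Complex.add_im,
        Complex.mul_im, zero_add, Complex.ofReal_zero, zero_mul] at hrect
      have hside : ∀ V : ℝ, |V| = U →
          ‖∫ y in (0 : ℝ)..R, φ (V + y * Complex.I)‖ ≤ C / U * |R - 0| := by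
        intro V hV
        refine intervalIntegral.norm_integral_le_of_norm_le_const fun y hy => ?_
        rw [Set.uIoc_of_le hR0] at hy
        have := hC (V + y * Complex.I) (by simpa using hy.1.le) (by simpa [hV] using hU)
        simpa [hV] using this
      have e : ∫ t in (-U)..U, φ t = (∫ t in (-U)..U, φ (t + R * Complex.I)) -
          Complex.I • (∫ y in (0 : ℝ)..R, φ (U + y * Complex.I)) +
          Complex.I • ∫ y in (0 : ℝ)..R, φ ((-U : ℝ) + y * Complex.I) := by
        linear_combination hrect
      rw [e]
      refine (norm_add_le _ _).trans ((add_le_add_left (norm_sub_le _ _) _).trans ?_)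
      rw [norm_smul, norm_smul, Complex.norm_I, one_mul, one_mul]
      have h1 := hside U (abs_of_pos hU0)
      have h2 := hside (-U) (by rw [abs_neg, abs_of_pos hU0])
      have h3 := hR U hU0.le
      linarith
    · intro ζ hζ
      have := (Complex.mem_reProdIm.1 hζ).2
      simp only [Complex.ofReal_im, Complex.add_im, Complex.mul_im, Complex.ofReal_re,
        Complex.I_im, mul_one, Complex.I_re, mul_zero, add_zero, zero_add] at this
      rw [Set.uIcc_of_le hR0] at this
      exact this.1
  have : ‖∫ t : ℝ, φ t‖ ≤ 0 := ge_of_tendsto hε key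
  exact norm_le_zero_iff.1 this

/-- A function which is holomorphic and bounded on the closed upper half-plane, and bounded in
square mean on the horizontal lines. -/
structure IsUpperHardy (h : ℂ → ℂ) : Prop where
  diff : DifferentiableOn ℂ h {z | 0 ≤ z.im}
  bdd : ∃ C, ∀ z : ℂ, 0 ≤ z.im → ‖h z‖ ≤ C
  sq_int : ∀ y : ℝ, 0 ≤ y → Integrable fun t : ℝ => ‖h (t + y * Complex.I)‖ ^ 2
  sq_le : ∃ M, ∀ y : ℝ, 0 ≤ y → ∫ t : ℝ, ‖h (t + y * Complex.I)‖ ^ 2 ≤ M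

namespace IsUpperHardy

variable {g h : ℂ → ℂ}

theorem continuous_line (hh : IsUpperHardy h) {y : ℝ} (hy : 0 ≤ y) :
    Continuous fun t : ℝ => h (t + y * Complex.I) := by
  refine hh.diff.continuousOn.comp_continuous (by fun_prop) fun t => ?_
  simpa using hy

theorem memLp (hh : IsUpperHardy h) {y : ℝ} (hy : 0 ≤ y) :
    MemLp (fun t : ℝ => h (t + y * Complex.I)) 2 volume :=
  (memLp_two_iff_integrable_sq_norm (hh.continuous_line hy).aestronglyMeasurable).2
    (hh.sq_int y hy)

theorem sub_const_mul (hg : IsUpperHardy g) (hh : IsUpperHardy h) (c : ℂ) :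
    IsUpperHardy fun z => g z - c * h z := by
  have hle : ∀ y : ℝ, ∀ t : ℝ, ‖g (t + y * Complex.I) - c * h (t + y * Complex.I)‖ ^ 2 ≤
      2 * ‖g (t + y * Complex.I)‖ ^ 2 + 2 * ‖c‖ ^ 2 * ‖h (t + y * Complex.I)‖ ^ 2 := by
    intro y t
    have h1 := norm_sub_le (g (t + y * Complex.I)) (c * h (t + y * Complex.I))
    rw [norm_mul] at h1
    nlinarith [sq_nonneg (‖g (t + y * Complex.I)‖ - ‖c‖ * ‖h (t + y * Complex.I)‖),
      norm_nonneg (g (t + y * Complex.I) - c * h (t + y * Complex.I))]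
  have hint : ∀ y : ℝ, 0 ≤ y →
      Integrable fun t : ℝ => ‖g (t + y * Complex.I) - c * h (t + y * Complex.I)‖ ^ 2 := by
    intro y hy
    exact (memLp_two_iff_integrable_sq_norm
      ((hg.continuous_line hy).sub ((hh.continuous_line hy).const_mul c)).aestronglyMeasurable).1
      ((hg.memLp hy).sub ((hh.memLp hy).const_mul c))
  obtain ⟨C, hC⟩ := hg.bdd
  obtain ⟨D, hD⟩ := hh.bdd
  obtain ⟨M, hM⟩ := hg.sq_le
  obtain ⟨N, hN⟩ := hh.sq_le
  refine ⟨hg.diff.sub (hh.diff.const_mul c), ⟨C + ‖c‖ * D, fun z hz => ?_⟩, hint,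
    ⟨2 * M + 2 * ‖c‖ ^ 2 * N, fun y hy => ?_⟩⟩
  · refine (norm_sub_le _ _).trans ?_
    rw [norm_mul]
    gcongr
    exacts [hC z hz, hD z hz]
  · calc _ ≤ ∫ t : ℝ, (2 * ‖g (t + y * Complex.I)‖ ^ 2 +
          2 * ‖c‖ ^ 2 * ‖h (t + y * Complex.I)‖ ^ 2) :=
          integral_mono (hint y hy)
            (((hg.sq_int y hy).const_mul _).add ((hh.sq_int y hy).const_mul _)) (hle y)
      _ = 2 * (∫ t : ℝ, ‖g (t + y * Complex.I)‖ ^ 2) +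
          2 * ‖c‖ ^ 2 * ∫ t : ℝ, ‖h (t + y * Complex.I)‖ ^ 2 := by
          rw [integral_add ((hg.sq_int y hy).const_mul _) ((hh.sq_int y hy).const_mul _),
            integral_const_mul, integral_const_mul]
      _ ≤ _ := by
          gcongr
          exacts [hM y hy, hN y hy]

theorem norm_inv_sub_sq (t y : ℝ) (z : ℂ) :
    ‖((t : ℂ) + y * Complex.I - z)⁻¹‖ ^ 2 = ((t - z.re) ^ 2 + (y - z.im) ^ 2)⁻¹ := by
  rw [norm_inv, inv_pow, ← Complex.normSq_eq_norm_sq, Complex.normSq_apply]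
  simp [sq]

theorem memLp_inv_sub {y : ℝ} {z : ℂ} (hz : y ≠ z.im) :
    MemLp (fun t : ℝ => ((t : ℂ) + y * Complex.I - z)⁻¹) 2 volume := by
  have hne : ∀ t : ℝ, (t : ℂ) + y * Complex.I - z ≠ 0 := by
    intro t h0
    have := congrArg Complex.im h0
    simp only [Complex.sub_im, Complex.add_im, Complex.ofReal_im, Complex.mul_im,
      Complex.ofReal_re, Complex.I_im, mul_one, Complex.I_re, mul_zero, add_zero, zero_add,
      Complex.zero_im] at this
    exact hz (sub_eq_zero.1 this)
  have hc : Continuous fun t : ℝ => ((t : ℂ) + y * Complex.I - z)⁻¹ :=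
    Continuous.inv₀ (by fun_prop) hne
  refine (memLp_two_iff_integrable_sq_norm hc.aestronglyMeasurable).2 ?_
  simp only [norm_inv_sub_sq]
  have := (integral_inv_sub_sq_add_sq z.re (abs_pos.2 (sub_ne_zero.2 hz))).1
  simpa only [sq_abs] using this

/-- The function φ stands for h(ζ)/(ζ - z) with any singularity in the half-plane removed, so that
one argument serves both z below the axis and a zero of h at z. The top side is estimated by
Cauchy-Schwarz from the mean square of h and ∫ |t + iR - z|⁻² dt = π/(R - Im z). -/
theorem integral_eq_zero (hh : IsUpperHardy h) {φ : ℂ → ℂ} {z : ℂ} (hz : z.im ≠ 0)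
    (hφ : DifferentiableOn ℂ φ {z | 0 ≤ z.im}) (he : ∀ ζ, ζ ≠ z → φ ζ = h ζ * (ζ - z)⁻¹) :
    ∫ t : ℝ, φ t = 0 := by
  have hne : ∀ t y : ℝ, y ≠ z.im → (t : ℂ) + y * Complex.I ≠ z := by
    rintro t y hy rfl
    simp at hy
  obtain ⟨C, hC⟩ := hh.bdd
  obtain ⟨M, hM⟩ := hh.sq_le
  -- Beyond |Re ζ| = 2|Re z| + 1 one has |ζ - z| ≥ |Re ζ|/2, whence the constant 2C.
  refine integral_eq_zero_of_upper_halfPlane (C := 2 * C) (R₀ := 2 * |z.re| + 1)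
    (ε := fun R => √M * √(Real.pi / (R - z.im))) hφ ?_ ?_ ?_ ?_
  · have := (hh.memLp le_rfl).integrable_mul (memLp_inv_sub (y := 0) (z := z) hz.symm)
    refine this.congr (Eventually.of_forall fun t => ?_)
    have h1 := he t (by simpa using hne t 0 hz.symm)
    simp [h1]
  · intro ζ hζ hR
    have h0 : 0 < |ζ.re| := by have := abs_nonneg z.re; linarith
    have h1 : |ζ.re| / 2 ≤ ‖ζ - z‖ := by
      refine le_trans ?_ (Complex.abs_re_le_norm _)
      rw [Complex.sub_re]
      have := abs_sub_abs_le_abs_sub ζ.re z.re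
      linarith
    have h2 : ζ ≠ z := by
      rintro rfl
      simp at h1
      linarith
    rw [he ζ h2, norm_mul, norm_inv]
    calc ‖h ζ‖ * ‖ζ - z‖⁻¹ ≤ C * (|ζ.re| / 2)⁻¹ := by
          gcongr
          · exact (norm_nonneg _).trans (hC ζ hζ)
          · exact hC ζ hζ
      _ = 2 * C / |ζ.re| := by field_simp
  · have h1 : Tendsto (fun R : ℝ => Real.pi / (R - z.im)) atTop (𝓝 0) :=
      tendsto_const_nhds.div_atTop (tendsto_atTop_add_const_right _ _ tendsto_id)
    have h2 := (Real.continuous_sqrt.tendsto 0).comp h1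
    simpa using h2.const_mul √M
  · filter_upwards [eventually_gt_atTop z.im, eventually_ge_atTop 0] with R hR hR0 U hU
    have e : ∀ t : ℝ, φ (t + R * Complex.I) =
        h (t + R * Complex.I) * ((t : ℂ) + R * Complex.I - z)⁻¹ :=
      fun t => he _ (hne t R hR.ne')
    simp only [e]
    rw [intervalIntegral.integral_of_le (by linarith)]
    refine (norm_integral_mul_le_sqrt ((hh.memLp hR0).restrict _)
      ((memLp_inv_sub hR.ne').restrict _)).trans ?_
    have hY : 0 < R - z.im := sub_pos.2 hR
    obtain ⟨hi, hv⟩ := integral_inv_sub_sq_add_sq z.re hY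
    gcongr
    · exact (setIntegral_le_integral (hh.sq_int R hR0)
        (Eventually.of_forall fun s => by positivity)).trans (hM R hR0)
    · simp only [norm_inv_sub_sq]
      rw [← hv]
      exact setIntegral_le_integral hi (Eventually.of_forall fun s => by positivity)

theorem integral_div_sub_of_neg (hh : IsUpperHardy h) {z : ℂ} (hz : z.im < 0) :
    ∫ t : ℝ, h t * ((t : ℂ) - z)⁻¹ = 0 := by
  refine hh.integral_eq_zero (φ := fun ζ => h ζ * (ζ - z)⁻¹) hz.ne ?_ fun _ _ => rfl
  refine hh.diff.mul ?_
  intro ζ hζ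
  have : ζ - z ≠ 0 := by
    intro h0
    rw [sub_eq_zero.1 h0] at hζ
    exact absurd hζ (not_le.2 hz)
  exact ((differentiableAt_id.sub_const z).inv this).differentiableWithinAt

/-- This function takes the value 1 at z and its only pole, conj z, is in the lower half-plane. It
serves to subtract off the value h(z) without leaving the Hardy class. -/
theorem conj_kernel {z : ℂ} (hz : 0 < z.im) :
    IsUpperHardy fun ζ => (z - conj z) * (ζ - conj z)⁻¹ := by
  have him : ∀ y : ℝ, 0 ≤ y → y ≠ (conj z).im := by
    intro y hy
    rw [Complex.conj_im]
    linarith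
  have hcc : ∀ y : ℝ, 0 ≤ y → ∀ t : ℝ,
      ‖(z - conj z) * ((t : ℂ) + y * Complex.I - conj z)⁻¹‖ ^ 2 =
        ‖z - conj z‖ ^ 2 * ((t - z.re) ^ 2 + (y + z.im) ^ 2)⁻¹ := by
    intro y _ t
    rw [norm_mul, mul_pow, norm_inv_sub_sq]
    simp
  refine ⟨?_, ⟨‖z - conj z‖ * (z.im)⁻¹, fun ζ hζ => ?_⟩, fun y hy => ?_,
    ⟨‖z - conj z‖ ^ 2 * (Real.pi / z.im), fun y hy => ?_⟩⟩
  · intro ζ hζ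
    have : ζ - conj z ≠ 0 := by
      intro h0
      rw [sub_eq_zero.1 h0] at hζ
      have : 0 ≤ (conj z).im := hζ
      rw [Complex.conj_im] at this
      linarith
    exact (((differentiableAt_fun_id.sub_const (conj z)).inv this).const_mul _).differentiableWithinAt
  · rw [norm_mul, norm_inv]
    gcongr
    refine le_trans ?_ (Complex.abs_im_le_norm _)
    rw [Complex.sub_im, Complex.conj_im, sub_neg_eq_add]
    exact (by linarith : z.im ≤ ζ.im + z.im).trans (le_abs_self _)
  · simp only [hcc y hy]
    exact (integral_inv_sub_sq_add_sq z.re (by linarith : 0 < y + z.im)).1.const_mul _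
  · simp only [hcc y hy]
    rw [integral_const_mul, (integral_inv_sub_sq_add_sq z.re (by linarith : 0 < y + z.im)).2]
    gcongr
    linarith

/-- No residue is taken: h - h(z)ψ vanishes at z, so its quotient by ζ - z is holomorphic and
integrates to zero. What remains is the Poisson integral ψ(t)/(t - z) = 2i Im z/|t - z|², whose
integral is 2πi. -/
theorem integral_div_sub (hh : IsUpperHardy h) {z : ℂ} (hz : 0 < z.im) :
    ∫ t : ℝ, h t * ((t : ℂ) - z)⁻¹ = 2 * Real.pi * Complex.I * h z := by
  set ψ : ℂ → ℂ := fun ζ => (z - conj z) * (ζ - conj z)⁻¹ with hψ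
  have hψH : IsUpperHardy ψ := conj_kernel hz
  have hzc : z - conj z ≠ 0 := by
    intro h0
    have := congrArg Complex.im h0
    simp at this
    linarith
  have hψz : ψ z = 1 := mul_inv_cancel₀ hzc
  have hH := hh.sub_const_mul hψH (h z)
  have h0 := hH.integral_eq_zero (φ := dslope (fun ζ => h ζ - h z * ψ ζ) z) hz.ne' ?_ ?_
  · have hne : ∀ t : ℝ, (t : ℂ) ≠ z := by
      rintro t rfl
      simp at hz
    have hI : ∀ {k : ℂ → ℂ}, IsUpperHardy k → Integrable fun t : ℝ => k t * ((t : ℂ) - z)⁻¹ := by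
      intro k hk
      have := (hk.memLp le_rfl).integrable_mul (memLp_inv_sub (y := 0) (z := z) hz.ne)
      simpa [Pi.mul_def] using this
    have e1 : ∀ t : ℝ, dslope (fun ζ => h ζ - h z * ψ ζ) z t =
        h t * ((t : ℂ) - z)⁻¹ - h z * (ψ t * ((t : ℂ) - z)⁻¹) := by
      intro t
      rw [dslope_of_ne _ (hne t), slope_def_field, hψz]
      ring
    simp only [e1] at h0
    rw [integral_sub (hI hh) ((hI hψH).const_mul _), integral_const_mul, sub_eq_zero] at h0
    have e2 : ∀ t : ℝ, ψ t * ((t : ℂ) - z)⁻¹ =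
        2 * Complex.I * z.im * (((t - z.re) ^ 2 + z.im ^ 2)⁻¹ : ℝ) := by
      intro t
      have e3 : z - conj z = 2 * Complex.I * z.im := by rw [Complex.sub_conj]; push_cast; ring
      have e4 : ((t : ℂ) - conj z) * (t - z) = ((t - z.re) ^ 2 + z.im ^ 2 : ℝ) := by
        have : ((t : ℂ) - conj z) = conj ((t : ℂ) - z) := by simp
        rw [this, ← Complex.normSq_eq_conj_mul_self, Complex.normSq_apply]
        simp [sq]
      rw [hψ, mul_assoc, ← mul_inv, e4, e3, Complex.ofReal_inv]
    simp only [e2] at h0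
    rw [integral_const_mul, integral_complex_ofReal, (integral_inv_sub_sq_add_sq z.re hz).2] at h0
    rw [h0]
    have : (z.im : ℂ) ≠ 0 := by exact_mod_cast hz.ne'
    push_cast
    field_simp
  · have : {z : ℂ | 0 ≤ z.im} ∈ 𝓝 z :=
      mem_of_superset ((isOpen_lt continuous_const Complex.continuous_im).mem_nhds hz)
        fun w (hw : 0 < w.im) => hw.le
    exact (Complex.differentiableOn_dslope this).2 hH.diff
  · intro ζ hζ
    rw [dslope_of_ne _ hζ, slope_def_field, hψz]
    ring

end IsUpperHardy

/-- The modulus exp(-x Im ζ) of the factor exactly offsets the growth allowed in `PW_x`, both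
pointwise and in mean square. -/
theorem isUpperHardy_mul_exp {x : ℝ} (hx : 0 ≤ x) {f : ℂ → ℂ} (hf : f ∈ paleyWienerSubmodule x) :
    IsUpperHardy fun ζ => f ζ * Complex.exp (Complex.I * x * ζ) := by
  obtain ⟨C, hC0, hC⟩ := exists_norm_le_exp hx hf
  have hn : ∀ ζ : ℂ, ‖f ζ * Complex.exp (Complex.I * x * ζ)‖ =
      ‖f ζ‖ * Real.exp (-(x * ζ.im)) := by
    intro ζ
    rw [norm_mul, Complex.norm_exp]
    simp [mul_comm]
  have hl : ∀ y : ℝ, ∀ t : ℝ, ‖f (t + y * Complex.I) *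
      Complex.exp (Complex.I * x * (t + y * Complex.I))‖ ^ 2 =
      Real.exp (-(x * y)) ^ 2 * ‖f (y * Complex.I + t)‖ ^ 2 := by
    intro y t
    rw [hn, add_comm (t : ℂ), mul_pow, mul_comm]
    simp
  refine ⟨?_, ⟨C, fun z hz => ?_⟩, fun y hy => ?_, ⟨∫ t : ℝ, ‖f t‖ ^ 2, fun y hy => ?_⟩⟩
  · have := hf.1
    exact Differentiable.differentiableOn (by fun_prop)
  · rw [hn]
    have := hC z
    rw [abs_of_nonneg hz] at this
    calc _ ≤ C * Real.exp (x * z.im) * Real.exp (-(x * z.im)) := by gcongr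
      _ = C := by rw [mul_assoc, ← Real.exp_add, add_neg_cancel, Real.exp_zero, mul_one]
  · simp only [hl]
    exact (integrable_sq_norm_shift hx hf _).const_mul _
  · simp only [hl]
    rw [integral_const_mul]
    have := integral_sq_norm_shift_le hx hf (y * Complex.I)
    have e : ((y : ℂ) * Complex.I).im = y := by simp
    rw [e, abs_of_nonneg hy] at this
    calc _ ≤ Real.exp (-(x * y)) ^ 2 * ((∫ t : ℝ, ‖f t‖ ^ 2) * Real.exp (x * y) ^ 2) := by gcongr
      _ = (∫ t : ℝ, ‖f t‖ ^ 2) * (Real.exp (-(x * y)) * Real.exp (x * y)) ^ 2 := by ring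
      _ = _ := by rw [← Real.exp_add, neg_add_cancel, Real.exp_zero, one_pow, mul_one]

/-! ## The reproducing kernel of the Paley-Wiener space -/

/-- The function `w ↦ ∫_{-x}^x exp (i y (conj z - w)) dy`. -/
noncomputable def pwKernel (x : ℝ) (z w : ℂ) : ℂ :=
  ∫ y in (-x)..x, Complex.exp (Complex.I * y * (conj z - w))

theorem hasDerivAt_pwKernel (x : ℝ) (z w : ℂ) :
    HasDerivAt (pwKernel x z)
      (∫ y in (-x)..x, -Complex.I * y * Complex.exp (Complex.I * y * (conj z - w))) w := by
  refine hasDerivAt_intervalIntegral_of_continuous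
    (g := fun w y => Complex.exp (Complex.I * y * (conj z - w)))
    (g' := fun w y => -Complex.I * y * Complex.exp (Complex.I * y * (conj z - w)))
    (-x) x (fun w y => ?_) ?_ ?_ w
  · have := (((hasDerivAt_id w).const_sub (conj z)).const_mul (Complex.I * y)).cexp
    refine this.congr_deriv ?_
    simp only [id]
    ring
  · simp only [Function.uncurry_def]; fun_prop
  · simp only [Function.uncurry_def]; fun_prop

theorem differentiable_pwKernel (x : ℝ) (z : ℂ) : Differentiable ℂ (pwKernel x z) :=
  fun w => (hasDerivAt_pwKernel x z w).differentiableAt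

theorem norm_pwKernel_le {x : ℝ} (hx : 0 ≤ x) (z w : ℂ) :
    ‖pwKernel x z w‖ ≤ 2 * x * Real.exp (x * |(conj z - w).im|) := by
  have := intervalIntegral.norm_integral_le_of_norm_le_const (a := -x) (b := x)
    (f := fun y : ℝ => Complex.exp (Complex.I * y * (conj z - w)))
    (C := Real.exp (x * |(conj z - w).im|)) ?_
  · refine this.trans (le_of_eq ?_)
    rw [sub_neg_eq_add, abs_of_nonneg (by linarith : (0 : ℝ) ≤ x + x)]
    ring
  · intro y hy
    rw [Set.uIoc_of_le (by linarith)] at hy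
    rw [Complex.norm_exp]
    gcongr
    have e : (Complex.I * y * (conj z - w)).re = -(y * (conj z - w).im) := by simp [mul_assoc]
    rw [e]
    refine (le_abs_self _).trans ?_
    rw [abs_neg, abs_mul]
    gcongr
    exact abs_le.2 ⟨hy.1.le, hy.2⟩

theorem pwKernel_mul (x : ℝ) (z w : ℂ) :
    Complex.I * (conj z - w) * pwKernel x z w =
      Complex.exp (Complex.I * x * (conj z - w)) - Complex.exp (-(Complex.I * x * (conj z - w))) := by
  by_cases h : conj z - w = 0
  · simp [h]
  · have hc : Complex.I * (conj z - w) ≠ 0 := mul_ne_zero Complex.I_ne_zero h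
    have := integral_exp_mul_complex (a := -x) (b := x) hc
    rw [pwKernel]
    have e : ∀ y : ℝ, Complex.exp (Complex.I * y * (conj z - w)) =
        Complex.exp (Complex.I * (conj z - w) * y) := fun y => by ring_nf
    simp only [e]
    rw [this, mul_div_cancel₀ _ hc]
    push_cast
    ring_nf

/-- Combines the trivial bound near Re z with the decay 1/|t - Re z| from `pwKernel_mul`. The result
is square integrable and locally uniform in Im z, so it also serves as a dominating function. -/
theorem pwKernel_ofReal_bound {x : ℝ} (hx : 0 ≤ x) (z : ℂ) (t : ℝ) :
    ‖pwKernel x z t‖ ≤ (2 * x + 2) * Real.exp (x * |z.im|) * √((1 + (t - z.re) ^ 2)⁻¹) := by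
  have him : (conj z - t).im = -z.im := by simp
  have h1 := norm_pwKernel_le hx z t
  rw [him, abs_neg] at h1
  have h2 : |t - z.re| * ‖pwKernel x z t‖ ≤ 2 * Real.exp (x * |z.im|) := by
    have h3 := congrArg norm (pwKernel_mul x z t)
    rw [norm_mul, norm_mul, Complex.norm_I, one_mul] at h3
    have h4 : |t - z.re| ≤ ‖conj z - t‖ := by
      have := Complex.abs_re_le_norm (conj z - t)
      simpa [abs_sub_comm] using this
    calc _ ≤ ‖conj z - t‖ * ‖pwKernel x z t‖ := by gcongr
      _ ≤ _ := by
        rw [h3]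
        refine (norm_sub_le _ _).trans ?_
        rw [Complex.norm_exp, Complex.norm_exp, two_mul]
        have e : (Complex.I * x * (conj z - t)).re = x * z.im := by simp [mul_assoc]
        rw [Complex.neg_re, e]
        gcongr
        · exact le_abs_self _
        · rw [← mul_neg]; gcongr; exact neg_le_abs _
  set N := ‖pwKernel x z t‖
  set W := Real.exp (x * |z.im|)
  have hN : 0 ≤ N := norm_nonneg _
  have hW : 0 < W := Real.exp_pos _
  rw [Real.sqrt_inv, ← div_eq_mul_inv, le_div_iff₀ (by positivity)]
  have h5 : √(1 + (t - z.re) ^ 2) ≤ 1 + |t - z.re| := by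
    rw [Real.sqrt_le_left (by positivity)]
    nlinarith [abs_nonneg (t - z.re), sq_abs (t - z.re)]
  calc N * √(1 + (t - z.re) ^ 2) ≤ N * (1 + |t - z.re|) := by gcongr
    _ ≤ _ := by nlinarith

theorem memLp_sqrt_inv_one_add_sq (r K : ℝ) :
    MemLp (fun t : ℝ => K * √((1 + (t - r) ^ 2)⁻¹)) 2 volume := by
  have hc : Continuous fun t : ℝ => K * √((1 + (t - r) ^ 2)⁻¹) := by
    have : Continuous fun t : ℝ => (1 + (t - r) ^ 2)⁻¹ :=
      Continuous.inv₀ (by fun_prop) fun t => by positivity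
    fun_prop
  refine (memLp_two_iff_integrable_sq_norm hc.aestronglyMeasurable).2 ?_
  have e : (fun t : ℝ => ‖K * √((1 + (t - r) ^ 2)⁻¹)‖ ^ 2) =
      fun t => K ^ 2 * (1 + (t - r) ^ 2)⁻¹ := by
    funext t
    rw [Real.norm_eq_abs, sq_abs, mul_pow, Real.sq_sqrt (by positivity)]
  rw [e]
  exact (integrable_inv_one_add_sq.comp_sub_right r).const_mul _

theorem pwKernel_mem {x : ℝ} (hx : 0 ≤ x) (z : ℂ) : pwKernel x z ∈ paleyWienerSubmodule x := by
  refine ⟨differentiable_pwKernel x z, fun ε hε => ⟨2 * x * Real.exp (x * ‖z‖), fun w => ?_⟩, ?_⟩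
  · refine (norm_pwKernel_le hx z w).trans ?_
    rw [mul_assoc (2 * x), ← Real.exp_add]
    gcongr
    have h1 : |(conj z - w).im| ≤ ‖z‖ + ‖w‖ :=
      (Complex.abs_im_le_norm _).trans ((norm_sub_le _ _).trans (by simp))
    calc x * |(conj z - w).im| ≤ x * (‖z‖ + ‖w‖) := by gcongr
      _ ≤ x * ‖z‖ + (x + ε) * ‖w‖ := by nlinarith [norm_nonneg w]
  · have hc : Continuous fun t : ℝ => pwKernel x z t :=
      (differentiable_pwKernel x z).continuous.comp Complex.continuous_ofReal
    exact (memLp_sqrt_inv_one_add_sq z.re _).mono hc.aestronglyMeasurable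
      (Eventually.of_forall fun t => (pwKernel_ofReal_bound hx z t).trans (le_abs_self _))

/-- The conjugate kernel splits into exp(ixt)/(t - z) and exp(-ixt)/(t - z), with constant factors.
Times f, the first is in the upper Hardy class and Cauchy's formula produces f(z). The second
becomes, after t ↦ -t, a Hardy function for f(-·) with its pole at -z below the axis, and
contributes zero. -/
theorem integral_conj_pwKernel_mul_of_pos {x : ℝ} (hx : 0 ≤ x) {f : ℂ → ℂ}
    (hf : f ∈ paleyWienerSubmodule x) {z : ℂ} (hz : 0 < z.im) :
    ∫ t : ℝ, conj (pwKernel x z t) * f t = 2 * Real.pi * f z := by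
  have hfn : (fun ζ => f (-ζ)) ∈ paleyWienerSubmodule x := by
    refine ⟨hf.1.comp differentiable_neg, hf.2.1.comp_neg, ?_⟩
    have := hf.2.2.comp_measurePreserving (Measure.measurePreserving_neg volume)
    simpa [Function.comp_def] using this
  have hH1 := isUpperHardy_mul_exp hx hf
  have hH2 := isUpperHardy_mul_exp hx hfn
  have h1 := hH1.integral_div_sub hz
  have h2 := hH2.integral_div_sub_of_neg (z := -z) (by simpa using hz)
  rw [← integral_neg_eq_self] at h2
  have hi1 : Integrable fun t : ℝ =>
      f t * Complex.exp (Complex.I * x * t) * ((t : ℂ) - z)⁻¹ := by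
    have := (hH1.memLp le_rfl).integrable_mul
      (IsUpperHardy.memLp_inv_sub (y := 0) (z := z) hz.ne)
    simpa [Pi.mul_def] using this
  have hi2 : Integrable fun t : ℝ =>
      f (-((-t : ℝ) : ℂ)) * Complex.exp (Complex.I * x * (-t : ℝ)) * (((-t : ℝ) : ℂ) - -z)⁻¹ := by
    have := (hH2.memLp le_rfl).integrable_mul
      (IsUpperHardy.memLp_inv_sub (y := 0) (z := -z) (by simpa using hz.ne'))
    have := (by simpa [Pi.mul_def] using this : Integrable fun t : ℝ =>
      f (-(t : ℂ)) * Complex.exp (Complex.I * x * t) * ((t : ℂ) - -z)⁻¹)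
    exact this.comp_neg
  have e : ∀ t : ℝ, conj (pwKernel x z t) * f t =
      -Complex.I * Complex.exp (-(Complex.I * x * z)) *
        (f t * Complex.exp (Complex.I * x * t) * ((t : ℂ) - z)⁻¹) +
      -Complex.I * Complex.exp (Complex.I * x * z) *
        (f (-((-t : ℝ) : ℂ)) * Complex.exp (Complex.I * x * (-t : ℝ)) *
          (((-t : ℝ) : ℂ) - -z)⁻¹) := by
    intro t
    have hne : (t : ℂ) - z ≠ 0 := by
      intro h0
      rw [← sub_eq_zero.1 h0] at hz
      simp at hz
    have hm := congrArg conj (pwKernel_mul x z t)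
    simp only [map_mul, Complex.conj_I, map_sub, Complex.conj_conj, Complex.conj_ofReal,
      ← Complex.exp_conj, map_neg] at hm
    have hk : conj (pwKernel x z t) = (Complex.exp (Complex.I * x * (t - z)) -
        Complex.exp (-(Complex.I * x * (t - z)))) * (-Complex.I * (t - z)⁻¹) := by
      have e1 : -Complex.I * x * (z - t) = Complex.I * x * (t - z) := by ring
      rw [e1] at hm
      rw [← hm]
      field_simp
      rw [Complex.I_sq]
      ring
    rw [hk]
    push_cast
    have e2 : (-(t : ℂ) - -z)⁻¹ = -((t : ℂ) - z)⁻¹ := by rw [← inv_neg]; congr 1; ring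
    have e3 : Complex.exp (Complex.I * x * (t - z)) =
        Complex.exp (-(Complex.I * x * z)) * Complex.exp (Complex.I * x * t) := by
      rw [← Complex.exp_add]; ring_nf
    have e4 : Complex.exp (-(Complex.I * x * (t - z))) =
        Complex.exp (Complex.I * x * z) * Complex.exp (Complex.I * x * -t) := by
      rw [← Complex.exp_add]; ring_nf
    rw [e2, e3, e4, neg_neg]
    ring
  simp only [e]
  rw [integral_add (hi1.const_mul _) (hi2.const_mul _), integral_const_mul, integral_const_mul,
    h1, h2, mul_zero, add_zero]
  have e5 : Complex.exp (-(Complex.I * x * z)) * Complex.exp (Complex.I * x * z) = 1 := by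
    rw [← Complex.exp_add, neg_add_cancel, Complex.exp_zero]
  linear_combination (2 * Real.pi * f z) * e5 - 2 * Real.pi * f z * Complex.exp (-(Complex.I * x * z)) * Complex.exp (Complex.I * x * z) * Complex.I_mul_I

theorem continuous_pwKernel_left (x : ℝ) (w : ℂ) : Continuous fun z => pwKernel x z w := by
  refine intervalIntegral.continuous_parametric_intervalIntegral_of_continuous' ?_ _ _
  simp only [Function.uncurry_def]
  have := Complex.continuous_conj
  fun_prop

/-- Points below the axis reduce to points above it through f(-·); a real point is a limit of z +
iη, the integrals converging by domination. -/
theorem integral_conj_pwKernel_mul {x : ℝ} (hx : 0 ≤ x) {f : ℂ → ℂ}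
    (hf : f ∈ paleyWienerSubmodule x) (z : ℂ) :
    ∫ t : ℝ, conj (pwKernel x z t) * f t = 2 * Real.pi * f z := by
  rcases lt_trichotomy z.im 0 with hz | hz | hz
  · have hfn : (fun ζ => f (-ζ)) ∈ paleyWienerSubmodule x := by
      refine ⟨hf.1.comp differentiable_neg, hf.2.1.comp_neg, ?_⟩
      have := hf.2.2.comp_measurePreserving (Measure.measurePreserving_neg volume)
      simpa [Function.comp_def] using this
    have h := integral_conj_pwKernel_mul_of_pos hx hfn (z := -z) (by simpa using hz)
    rw [← integral_neg_eq_self, neg_neg] at h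
    rw [← h]
    congr 1
    ext t
    push_cast
    rw [neg_neg]
    congr 2
    have := intervalIntegral.integral_comp_neg (a := -x) (b := x)
      (fun y : ℝ => Complex.exp (Complex.I * y * (conj z - t)))
    rw [neg_neg] at this
    rw [pwKernel, ← this, pwKernel]
    congr 1
    ext y
    push_cast
    rw [map_neg]
    ring_nf
  · have hlim1 : Tendsto (fun η : ℝ => 2 * Real.pi * f (z + η * Complex.I)) (𝓝[>] 0)
        (𝓝 (2 * Real.pi * f z)) := by
      have := hf.1.continuous
      refine Tendsto.mono_left ?_ nhdsWithin_le_nhds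
      exact Continuous.tendsto' (by fun_prop) _ _ (by simp)
    have hlim2 : Tendsto (fun η : ℝ => ∫ t : ℝ, conj (pwKernel x (z + η * Complex.I) t) * f t)
        (𝓝[>] 0) (𝓝 (∫ t : ℝ, conj (pwKernel x z t) * f t)) := by
      refine tendsto_integral_filter_of_dominated_convergence
        (fun t => ((2 * x + 2) * Real.exp x * √((1 + (t - z.re) ^ 2)⁻¹)) * ‖f t‖) ?_ ?_ ?_ ?_
      · refine Eventually.of_forall fun η => ?_
        have h1 : Continuous fun t : ℝ => pwKernel x (z + η * Complex.I) t :=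
          (differentiable_pwKernel x _).continuous.comp Complex.continuous_ofReal
        have h2 : Continuous fun t : ℝ => f t := hf.1.continuous.comp Complex.continuous_ofReal
        exact ((Complex.continuous_conj.comp h1).mul h2).aestronglyMeasurable
      · have h1 : Set.Ioo (0 : ℝ) 1 ∈ 𝓝[>] (0 : ℝ) := Ioo_mem_nhdsGT one_pos
        filter_upwards [h1] with η hη
        refine Eventually.of_forall fun t => ?_
        rw [norm_mul, RCLike.norm_conj]
        gcongr
        refine (pwKernel_ofReal_bound hx _ t).trans ?_
        have e1 : (z + η * Complex.I).im = η := by simp [hz]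
        have e2 : (z + η * Complex.I).re = z.re := by simp
        rw [e1, e2, abs_of_pos hη.1]
        gcongr
        nlinarith [hη.2]
      · exact (memLp_sqrt_inv_one_add_sq z.re _).integrable_mul hf.2.2.norm
      · refine Eventually.of_forall fun t => ?_
        refine Tendsto.mul_const _ ?_
        refine Tendsto.mono_left ?_ nhdsWithin_le_nhds
        have h1 := Complex.continuous_conj.comp (continuous_pwKernel_left x t)
        refine Continuous.tendsto' (f := fun η : ℝ => conj (pwKernel x (z + η * Complex.I) t)) ?_ _ _
          (by simp)
        exact h1.comp (by fun_prop : Continuous fun η : ℝ => z + η * Complex.I)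
    refine tendsto_nhds_unique hlim2 (hlim1.congr' ?_)
    filter_upwards [self_mem_nhdsWithin] with η hη
    refine (integral_conj_pwKernel_mul_of_pos hx hf ?_).symm
    have hη : 0 < η := hη
    simpa [hz] using hη
  · exact integral_conj_pwKernel_mul_of_pos hx hf hz

namespace PaleyWiener

variable {x : ℝ}

/-- The evaluator at `z` of the Paley-Wiener space. -/
noncomputable def evaluator (hx : 0 ≤ x) (z : ℂ) : PaleyWiener x := ⟨pwKernel x z, pwKernel_mem hx z⟩

theorem evaluator_apply (hx : 0 ≤ x) (z w : ℂ) : evaluator hx z w = pwKernel x z w := rfl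

theorem inner_evaluator (hx : 0 ≤ x) (z : ℂ) (f : PaleyWiener x) :
    inner ℂ (evaluator hx z) f = f z := by
  rw [inner_def]
  have := integral_conj_pwKernel_mul hx f.2 z
  have hpi : (2 * Real.pi : ℂ) ≠ 0 := by
    have := Real.pi_ne_zero
    exact_mod_cast mul_ne_zero two_ne_zero this
  change (2 * Real.pi : ℂ)⁻¹ * ∫ t : ℝ, conj (pwKernel x z t) * f.1 t = f.1 z
  rw [this, inv_mul_cancel_left₀ hpi]

theorem norm_evaluator_le (hx : 0 ≤ x) (z : ℂ) :
    ‖evaluator hx z‖ ≤ √(2 * x) * Real.exp (x * |z.im|) := by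
  have h1 : ‖evaluator hx z‖ ^ 2 = ‖pwKernel x z z‖ := by
    have := inner_self_eq_norm_sq_to_K (𝕜 := ℂ) (evaluator hx z)
    rw [inner_evaluator, evaluator_apply] at this
    rw [this]
    simp
  have h2 := norm_pwKernel_le hx z z
  have e : (conj z - z).im = -(2 * z.im) := by simp; ring
  rw [e, abs_neg, abs_mul, abs_two] at h2
  refine le_of_sq_le_sq ?_ (by positivity)
  rw [h1, mul_pow, Real.sq_sqrt (by positivity)]
  refine h2.trans (le_of_eq ?_)
  rw [sq, ← Real.exp_add]
  ring_nf

theorem norm_apply_le (hx : 0 ≤ x) (f : PaleyWiener x) (z : ℂ) :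
    ‖f z‖ ≤ √(2 * x) * Real.exp (x * |z.im|) * ‖f‖ := by
  rw [← inner_evaluator hx z f]
  exact (norm_inner_le_norm _ _).trans
    (mul_le_mul_of_nonneg_right (norm_evaluator_le hx z) (norm_nonneg _))

theorem norm_sq_eq (f : PaleyWiener x) :
    ‖f‖ ^ 2 = (2 * Real.pi)⁻¹ * ∫ t : ℝ, ‖f (t : ℂ)‖ ^ 2 := by
  have h1 := inner_self_eq_norm_sq_to_K (𝕜 := ℂ) f
  have h2 := scalarProd_self f
  have h3 : ((‖f‖ ^ 2 : ℝ) : ℂ) = (((2 * Real.pi)⁻¹ * ∫ t : ℝ, ‖f (t : ℂ)‖ ^ 2 : ℝ) : ℂ) := by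
    rw [← h2]
    push_cast
    exact h1.symm
  exact_mod_cast h3

end PaleyWiener

/-! ## Completeness of the Paley-Wiener space -/

namespace PaleyWiener

variable {x : ℝ}

theorem eLpNorm_eq (f : PaleyWiener x) :
    eLpNorm (fun t : ℝ => f (t : ℂ)) 2 volume = ENNReal.ofReal (√(2 * Real.pi) * ‖f‖) := by
  rw [f.memLp.eLpNorm_eq_integral_rpow_norm two_ne_zero ENNReal.ofNat_ne_top]
  congr 1
  have h : ∫ t : ℝ, ‖f (t : ℂ)‖ ^ (2 : ENNReal).toReal = 2 * Real.pi * ‖f‖ ^ 2 := by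
    rw [norm_sq_eq, mul_inv_cancel_left₀ (by positivity)]
    congr 1
    ext t
    simp
  rw [h]
  have h2 : (2 : ENNReal).toReal⁻¹ = 1 / 2 := by norm_num
  rw [h2, ← Real.sqrt_eq_rpow, Real.sqrt_mul (by positivity), Real.sqrt_sq (norm_nonneg _)]

theorem sub_apply (f g : PaleyWiener x) (w : ℂ) : (f - g) w = f w - g w := rfl

/-- Evaluator bounds turn norm convergence into locally uniform convergence, so the limit is entire,
and the bound of the norms gives its exponential type. Fatou's lemma on the real line gives square
integrability and convergence in norm. -/
theorem completeSpace (hx : 0 ≤ x) : CompleteSpace (PaleyWiener x) := by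
  refine Metric.complete_of_cauchySeq_tendsto fun u hu => ?_
  set B : ℂ → ℝ := fun z => √(2 * x) * Real.exp (x * |z.im|) with hB
  have hB0 : ∀ z, 0 ≤ B z := fun z => by positivity
  have hsub : ∀ m n z, ‖u m z - u n z‖ ≤ B z * ‖u m - u n‖ := fun m n z => by
    rw [← sub_apply]
    exact norm_apply_le hx _ z
  have hpt : ∀ z, CauchySeq fun n => u n z := by
    intro z
    refine Metric.cauchySeq_iff'.2 fun ε hε => ?_
    obtain ⟨N, hN⟩ := Metric.cauchySeq_iff'.1 hu (ε / (B z + 1)) (by have := hB0 z; positivity)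
    refine ⟨N, fun n hn => ?_⟩
    rw [dist_eq_norm]
    have h1 := hN n hn
    rw [dist_eq_norm, lt_div_iff₀ (by have := hB0 z; positivity)] at h1
    have h2 := hsub n N z
    nlinarith [norm_nonneg (u n - u N)]
  choose F hF using fun z => cauchySeq_tendsto_of_complete (hpt z)
  have hunif : ∀ ε > 0, ∃ N, ∀ n ≥ N, ∀ z, ‖F z - u n z‖ ≤ B z * ε := by
    intro ε hε
    obtain ⟨N, hN⟩ := Metric.cauchySeq_iff.1 hu ε hε
    refine ⟨N, fun n hn z => ?_⟩
    refine le_of_tendsto ((hF z).sub_const (u n z)).norm ?_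
    filter_upwards [eventually_ge_atTop N] with m hm
    refine (hsub m n z).trans ?_
    have := (hN m hm n hn).le
    rw [dist_eq_norm] at this
    have := hB0 z
    gcongr
  have hdiff : Differentiable ℂ F := by
    have hlu : TendstoLocallyUniformlyOn (fun n => (u n : ℂ → ℂ)) F atTop Set.univ := by
      rw [tendstoLocallyUniformlyOn_univ, Metric.tendstoLocallyUniformly_iff]
      intro ε hε z
      set R := √(2 * x) * Real.exp (x * (|z.im| + 1)) with hR
      have hR0 : 0 ≤ R := by positivity
      obtain ⟨N, hN⟩ := hunif (ε / (2 * (R + 1))) (by positivity)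
      refine ⟨Metric.ball z 1, Metric.ball_mem_nhds z one_pos, ?_⟩
      filter_upwards [eventually_ge_atTop N] with n hn y hy
      rw [dist_eq_norm]
      have hyB : B y ≤ R := by
        have h1 : |y.im - z.im| ≤ 1 := by
          rw [← Complex.sub_im]
          exact (Complex.abs_im_le_norm _).trans (mem_ball_iff_norm.1 hy).le
        have h2 := abs_sub_abs_le_abs_sub y.im z.im
        rw [hB, hR]
        dsimp only
        gcongr
        linarith
      calc _ ≤ B y * (ε / (2 * (R + 1))) := hN n hn y
        _ ≤ (R + 1) * (ε / (2 * (R + 1))) := by gcongr; linarith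
        _ = ε / 2 := by field_simp
        _ < ε := half_lt_self hε
    have := hlu.differentiableOn (Eventually.of_forall fun n => (u n).2.1.differentiableOn)
      isOpen_univ
    exact differentiableOn_univ.1 this
  have hexp : ExpTypeLE x F := by
    obtain ⟨M, hM⟩ := hu.norm_bddAbove
    have hM' : ∀ n, ‖u n‖ ≤ M := fun n => hM ⟨n, rfl⟩
    have hM0 : 0 ≤ M := (norm_nonneg _).trans (hM' 0)
    intro ε hε
    refine ⟨√(2 * x) * M, fun z => ?_⟩
    refine le_of_tendsto (hF z).norm (Eventually.of_forall fun n => ?_)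
    calc ‖u n z‖ ≤ B z * ‖u n‖ := norm_apply_le hx _ z
      _ ≤ √(2 * x) * Real.exp ((x + ε) * ‖z‖) * M := by
        rw [hB]
        dsimp only
        gcongr
        · linarith
        · exact Complex.abs_im_le_norm z
        · exact hM' n
      _ = _ := by ring
  have hcont : Continuous fun t : ℝ => F t := hdiff.continuous.comp Complex.continuous_ofReal
  have huc : ∀ n, Continuous fun t : ℝ => u n (t : ℂ) := fun n =>
    (u n).2.1.continuous.comp Complex.continuous_ofReal
  have hL2 : ∀ ε > 0, ∃ N, ∀ n ≥ N, eLpNorm (fun t : ℝ => F t - u n t) 2 volume ≤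
      ENNReal.ofReal (√(2 * Real.pi) * ε) := by
    intro ε hε
    obtain ⟨N, hN⟩ := Metric.cauchySeq_iff.1 hu ε hε
    refine ⟨N, fun n hn => ?_⟩
    refine (Lp.eLpNorm_lim_le_liminf_eLpNorm (f := fun m (t : ℝ) => u m t - u n t)
      (fun m => ((huc m).sub (huc n)).aestronglyMeasurable) _
      (Eventually.of_forall fun t => (hF t).sub_const _)).trans ?_
    refine liminf_le_of_frequently_le' (Eventually.frequently ?_)
    filter_upwards [eventually_ge_atTop N] with m hm
    refine (eLpNorm_eq (u m - u n)).le.trans ?_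
    have := (hN m hm n hn).le
    rw [dist_eq_norm] at this
    gcongr
  have hmem : MemLp (fun t : ℝ => F t) 2 volume := by
    obtain ⟨N, hN⟩ := hL2 1 one_pos
    have h1 : MemLp (fun t : ℝ => F t - u N t) 2 volume :=
      ⟨(hcont.sub (huc N)).aestronglyMeasurable, (hN N le_rfl).trans_lt ENNReal.ofReal_lt_top⟩
    simpa [Pi.add_def] using h1.add (u N).memLp
  obtain ⟨G, hG⟩ : ∃ G : PaleyWiener x, ∀ z, G z = F z :=
    ⟨⟨F, hdiff, hexp, hmem⟩, fun _ => rfl⟩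
  refine ⟨G, Metric.tendsto_atTop.2 fun ε hε => ?_⟩
  obtain ⟨N, hN⟩ := hL2 (ε / 2) (half_pos hε)
  refine ⟨N, fun n hn => ?_⟩
  rw [dist_comm, dist_eq_norm]
  have h1 := eLpNorm_eq (G - u n)
  simp only [sub_apply, hG] at h1
  have h2 := h1.symm.le.trans (hN n hn)
  rw [ENNReal.ofReal_le_ofReal_iff (by positivity)] at h2
  have h3 := le_of_mul_le_mul_left h2 (by positivity)
  linarith

theorem isClosed_vanishing (hx : 0 ≤ x) {n : ℕ} (z : Fin n → ℂ) :
    IsClosed {f : PaleyWiener x | ∀ j, f (z j) = 0} := by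
  have : {f : PaleyWiener x | ∀ j, f (z j) = 0} =
      ⋂ j, (fun f => inner ℂ (evaluator hx (z j)) f) ⁻¹' {0} := by
    ext f
    simp [inner_evaluator]
  rw [this]
  exact isClosed_iInter fun j => isClosed_singleton.preimage (continuous_const.inner continuous_id)

end PaleyWiener

/-! ## Division by a polynomial with simple zeros -/

/-- One zero is removed at a time by `dslope`; distinctness keeps the remaining points zeros of the
quotient. -/
theorem exists_entire_eq_prod_mul {n : ℕ} {z : Fin n → ℂ} (hz : Function.Injective z)
    {f : ℂ → ℂ} (hf : Differentiable ℂ f) (h0 : ∀ j, f (z j) = 0) :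
    ∃ F : ℂ → ℂ, Differentiable ℂ F ∧ ∀ w, f w = (∏ j, (w - z j)) * F w := by
  induction n generalizing f with
  | zero => exact ⟨f, hf, fun w => by simp⟩
  | succ n ih =>
    have hd : Differentiable ℂ (dslope f (z 0)) := differentiableOn_univ.1
      ((Complex.differentiableOn_dslope univ_mem).2 hf.differentiableOn)
    have hmul : ∀ w, f w = (w - z 0) * dslope f (z 0) w := fun w => by
      have := sub_smul_dslope f (z 0) w
      rw [h0 0, sub_zero, smul_eq_mul] at this
      exact this.symm
    obtain ⟨F, hF, hF'⟩ := ih (z := fun j => z j.succ)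
      (fun i j h => Fin.succ_injective _ (hz h)) hd (fun j => by
        have h1 := hmul (z j.succ)
        rw [h0] at h1
        refine (mul_eq_zero.1 h1.symm).resolve_left (sub_ne_zero.2 fun h => ?_)
        exact Fin.succ_ne_zero j (hz h))
    exact ⟨F, hF, fun w => by rw [hmul, hF', Fin.prod_univ_succ, mul_assoc]⟩

namespace PaleyWienerMod

variable {x : ℝ} {n : ℕ} {z : Fin n → ℂ}

theorem incomplete_apply_zero (F : PaleyWienerMod x z) (j : Fin n) : incomplete F (z j) = 0 := by
  rw [incomplete_apply, Finset.prod_eq_zero (Finset.mem_univ j) (sub_self _), zero_mul]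

theorem range_incomplete (hz : Function.Injective z) :
    Set.range (incomplete (x := x) (z := z)) = {f : PaleyWiener x | ∀ j, f (z j) = 0} := by
  ext f
  constructor
  · rintro ⟨F, rfl⟩ j
    exact incomplete_apply_zero F j
  · intro hf
    obtain ⟨F, hF, hF'⟩ := exists_entire_eq_prod_mul hz f.2.1 hf
    refine ⟨⟨F, hF, f.1, f.2, hf, fun w hw => ?_⟩, Subtype.ext (funext fun w => (hF' w).symm)⟩
    have hp : ∏ j, (w - z j) ≠ 0 := Finset.prod_ne_zero_iff.2 fun j _ => sub_ne_zero.2 (hw j)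
    rw [hF' w, mul_div_cancel_left₀ _ hp]

/-- `incomplete` as a linear isometry. -/
noncomputable def incompleteIsometry : PaleyWienerMod x z →ₗᵢ[ℂ] PaleyWiener x :=
  (incomplete (x := x) (z := z)).isometryOfInner fun F G => (inner_def F G).symm

theorem norm_incomplete (F : PaleyWienerMod x z) : ‖incomplete F‖ = ‖F‖ :=
  incompleteIsometry.norm_map F

theorem completeSpace (hx : 0 ≤ x) (hz : Function.Injective z) :
    CompleteSpace (PaleyWienerMod x z) := by
  have := PaleyWiener.completeSpace hx
  have hi : Isometry (incompleteIsometry (x := x) (z := z)) := incompleteIsometry.isometry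
  rw [completeSpace_iff_isComplete_range hi.isUniformInducing]
  refine IsClosed.isComplete ?_
  have : Set.range (incompleteIsometry (x := x) (z := z)) =
      {f : PaleyWiener x | ∀ j, f (z j) = 0} := range_incomplete hz
  rw [this]
  exact PaleyWiener.isClosed_vanishing hx z

/-- Dividing by ∏(w - z_j) breaks down when w is one of the z_j. The maximum principle on a circle
around w which avoids all z_j handles every w uniformly. -/
theorem exists_norm_apply_le (hx : 0 ≤ x) (w : ℂ) :
    ∃ C : ℝ, ∀ F : PaleyWienerMod x z, ‖F w‖ ≤ C * ‖F‖ := by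
  obtain ⟨r, hr0, hr⟩ : ∃ r : ℝ, 0 < r ∧ ∀ j, dist (z j) w ≠ r := by
    have hfin : (Set.range fun j => dist (z j) w).Finite := Set.finite_range _
    obtain ⟨r, hr, hr'⟩ := (Set.Ioi_infinite (0 : ℝ)).exists_notMem_finite hfin
    exact ⟨r, hr, fun j hj => hr' ⟨j, hj⟩⟩
  have hne : ∀ ζ ∈ Metric.sphere w r, ∏ j, (ζ - z j) ≠ 0 := fun ζ hζ =>
    Finset.prod_ne_zero_iff.2 fun j _ h => hr j (by
      rw [← sub_eq_zero.1 h]; exact hζ)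
  obtain ⟨C, hC⟩ := (isCompact_sphere w r).exists_bound_of_continuousOn
    (f := fun ζ => (∏ j, (ζ - z j))⁻¹ * ((√(2 * x) * Real.exp (x * |ζ.im|) : ℝ) : ℂ))
    ((ContinuousOn.inv₀ (by fun_prop) hne).mul (by
      have := Complex.continuous_im
      fun_prop))
  refine ⟨C, fun F => ?_⟩
  refine Complex.norm_le_of_forall_mem_frontier_norm_le (U := Metric.ball w r)
    Metric.isBounded_ball F.2.1.diffContOnCl (fun ζ hζ => ?_)
    (subset_closure (Metric.mem_ball_self hr0))
  rw [frontier_ball w hr0.ne'] at hζ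
  have h1 := PaleyWiener.norm_apply_le hx (incomplete F) ζ
  have h2 := hC ζ hζ
  rw [incomplete_apply, norm_mul, norm_incomplete] at h1
  rw [norm_mul, norm_inv, Complex.norm_of_nonneg (by positivity)] at h2
  have h3 : 0 < ‖∏ j, (ζ - z j)‖ := norm_pos_iff.2 (hne ζ hζ)
  change ‖F ζ‖ ≤ _
  calc ‖F ζ‖ = ‖∏ j, (ζ - z j)‖⁻¹ * (‖∏ j, (ζ - z j)‖ * ‖F ζ‖) := by field_simp
    _ ≤ ‖∏ j, (ζ - z j)‖⁻¹ * (√(2 * x) * Real.exp (x * |ζ.im|) * ‖F‖) := by gcongr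
    _ = ‖∏ j, (ζ - z j)‖⁻¹ * (√(2 * x) * Real.exp (x * |ζ.im|)) * ‖F‖ := by ring
    _ ≤ C * ‖F‖ := by gcongr

theorem exists_evaluator (hx : 0 ≤ x) (hz : Function.Injective z) :
    ∃ K : ℂ → PaleyWienerMod x z, ∀ w F, inner ℂ (K w) F = F w := by
  have := completeSpace (x := x) hx hz
  choose C hC using fun w => exists_norm_apply_le (x := x) (z := z) hx w
  let L : ℂ → PaleyWienerMod x z →ₗ[ℂ] ℂ := fun w =>
    { toFun := fun F => F w
      map_add' := fun F G => rfl
      map_smul' := fun c F => rfl }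
  refine ⟨fun w => (InnerProductSpace.toDual ℂ (PaleyWienerMod x z)).symm
    ((L w).mkContinuous (C w) (hC w)), fun w F => ?_⟩
  rw [InnerProductSpace.toDual_symm_apply]
  rfl

end PaleyWienerMod

section

open Matrix

/-! ## Gram matrices of weighted integrals -/

/-- The matrix with entries `∫_a^b f_i f_j ω`. -/
noncomputable def weightedGram {n : ℕ} (f : Fin n → ℝ → ℝ) (ω : ℝ → ℝ) (a b : ℝ) :
    Matrix (Fin n) (Fin n) ℝ :=
  Matrix.of fun i j => ∫ y in a..b, f i y * f j y * ω y

/-- The quadratic form is ∫ (∑ c_i f_i)² ω. Positivity of ω is asked only inside the interval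
because later weights vanish at an endpoint. -/
theorem weightedGram_posDef {n : ℕ} {f : Fin n → ℝ → ℝ} {ω : ℝ → ℝ} {a b : ℝ} (hab : a < b)
    (hf : ∀ i, ContinuousOn (f i) (Set.Icc a b)) (hω : ContinuousOn ω (Set.Icc a b))
    (hpos : ∀ y ∈ Set.Ioo a b, 0 < ω y)
    (hli : ∀ c : Fin n → ℝ, (∀ y ∈ Set.Ioo a b, ∑ i, c i * f i y = 0) → c = 0) :
    (weightedGram f ω a b).PosDef := by
  have hω0 : ∀ y ∈ Set.Icc a b, 0 ≤ ω y := by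
    have : Set.Icc a b ⊆ closure (Set.Ioo a b) := by rw [closure_Ioo hab.ne]
    intro y hy
    have hy' := this hy
    refine ContinuousWithinAt.closure_le (f := fun _ => (0 : ℝ)) hy' continuousWithinAt_const
      ((hω y hy).mono Set.Ioo_subset_Icc_self) fun z hz => (hpos z hz).le
  refine Matrix.PosDef.of_dotProduct_mulVec_pos ?_ fun c hc => ?_
  · ext i j
    simp only [weightedGram, Matrix.conjTranspose_apply, Matrix.of_apply, star_trivial]
    congr 1
    ext y
    ring
  · have e : star c ⬝ᵥ (weightedGram f ω a b *ᵥ c) = ∫ y in a..b, (∑ i, c i * f i y) ^ 2 * ω y := by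
      have e1 : ∀ y, (∑ i, c i * f i y) ^ 2 * ω y =
          ∑ i, ∑ j, c i * (f i y * f j y * ω y * c j) := by
        intro y
        rw [sq, Finset.sum_mul_sum, Finset.sum_mul]
        refine Finset.sum_congr rfl fun i _ => ?_
        rw [Finset.sum_mul]
        exact Finset.sum_congr rfl fun j _ => by ring
      have hint : ∀ i j, IntervalIntegrable (fun y => c i * (f i y * f j y * ω y * c j))
          volume a b := fun i j => ContinuousOn.intervalIntegrable (by
        rw [Set.uIcc_of_le hab.le]
        have h1 := hf i
        have h2 := hf j
        fun_prop)
      have hint2 : ∀ i, IntervalIntegrable (fun y => ∑ j, c i * (f i y * f j y * ω y * c j))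
          volume a b := fun i => ContinuousOn.intervalIntegrable (by
        rw [Set.uIcc_of_le hab.le]
        have h1 := hf i
        fun_prop)
      simp only [e1]
      rw [intervalIntegral.integral_finsetSum
        fun i _ => hint2 i]
      simp only [dotProduct, mulVec, star_trivial, Finset.mul_sum]
      refine Finset.sum_congr rfl fun i _ => ?_
      rw [intervalIntegral.integral_finsetSum fun j _ => hint i j]
      refine Finset.sum_congr rfl fun j _ => ?_
      rw [intervalIntegral.integral_const_mul, intervalIntegral.integral_mul_const]
      rfl
    rw [e]
    obtain ⟨y, hy, hne⟩ : ∃ y ∈ Set.Ioo a b, ∑ i, c i * f i y ≠ 0 := by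
      by_contra! h
      exact hc (hli c h)
    refine intervalIntegral.integral_pos hab ?_ (fun y hy => ?_)
      ⟨y, Set.Ioo_subset_Icc_self hy, ?_⟩
    · fun_prop
    · exact mul_nonneg (sq_nonneg _) (hω0 y (Set.Ioc_subset_Icc_self hy))
    · exact mul_pos (by positivity) (hpos y hy)

/-- Exponentials with distinct exponents are linearly independent on an interval. -/
theorem exp_linearIndependent_on {n : ℕ} {κ : Fin n → ℝ} (hκ : Function.Injective κ) {a b : ℝ}
    (hab : a < b) (c : Fin n → ℝ) (h : ∀ y ∈ Set.Ioo a b, ∑ i, c i * Real.exp (κ i * y) = 0) :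
    c = 0 := by
  -- Repeated differentiation at a single point gives a Vandermonde system for the numbers c_i
  -- exp(κ_i y).
  have hder : ∀ k : ℕ, ∀ y ∈ Set.Ioo a b, ∑ i, c i * κ i ^ k * Real.exp (κ i * y) = 0 := by
    intro k
    induction k with
    | zero => simpa using h
    | succ k ih =>
      intro y hy
      have h1 : HasDerivAt (fun y => ∑ i, c i * κ i ^ k * Real.exp (κ i * y))
          (∑ i, c i * κ i ^ k * (Real.exp (κ i * y) * (κ i * 1))) y :=
        HasDerivAt.fun_sum fun i _ => (((hasDerivAt_id y).const_mul (κ i)).exp).const_mul _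
      have h2 : (fun y => ∑ i, c i * κ i ^ k * Real.exp (κ i * y)) =ᶠ[𝓝 y] fun _ => 0 :=
        mem_of_superset (Ioo_mem_nhds hy.1 hy.2) ih
      have h3 := h1.unique ((hasDerivAt_const y (0 : ℝ)).congr_of_eventuallyEq h2)
      rw [← h3]
      exact Finset.sum_congr rfl fun i _ => by ring
  obtain ⟨y, hy⟩ := exists_between hab
  have h0 : (fun i => c i * Real.exp (κ i * y)) = 0 := by
    refine Matrix.eq_zero_of_forall_pow_sum_mul_pow_eq_zero hκ fun k => ?_
    rw [← hder k y hy]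
    exact Finset.sum_congr rfl fun i _ => by ring
  funext i
  have := congrFun h0 i
  simpa [Real.exp_ne_zero] using this

/-! ## The Gram matrix of exponentials as a function of the interval -/

theorem hasDerivAt_matrix_det {n : ℕ} {M : ℝ → Matrix (Fin n) (Fin n) ℝ}
    {M' : Matrix (Fin n) (Fin n) ℝ} {x : ℝ}
    (h : ∀ i j, HasDerivAt (fun x => M x i j) (M' i j) x) :
    HasDerivAt (fun x => (M x).det) (∑ i, ((M x).updateCol i fun k => M' k i).det) x := by
  have h1 : HasDerivAt (fun x => ∑ σ : Equiv.Perm (Fin n), (Equiv.Perm.sign σ : ℝ) *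
      ∏ i, M x (σ i) i) (∑ σ : Equiv.Perm (Fin n), (Equiv.Perm.sign σ : ℝ) *
      ∑ i, (∏ j ∈ Finset.univ.erase i, M x (σ j) j) • M' (σ i) i) x :=
    HasDerivAt.fun_sum fun σ _ =>
      (HasDerivAt.fun_finsetProd fun i _ => h (σ i) i).const_mul _
  have e : (fun x => (M x).det) = fun x => ∑ σ : Equiv.Perm (Fin n), (Equiv.Perm.sign σ : ℝ) *
      ∏ i, M x (σ i) i := by
    funext x
    rw [Matrix.det_apply']
  rw [e]
  refine h1.congr_deriv ?_
  simp only [Finset.mul_sum]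
  rw [Finset.sum_comm]
  refine Finset.sum_congr rfl fun i _ => ?_
  rw [Matrix.det_apply']
  refine Finset.sum_congr rfl fun σ _ => ?_
  congr 1
  rw [← Finset.mul_prod_erase _ _ (Finset.mem_univ i), Matrix.updateCol_self, smul_eq_mul, mul_comm]
  congr 1
  refine Finset.prod_congr rfl fun j hj => ?_
  rw [Matrix.updateCol_ne (Finset.ne_of_mem_erase hj)]

section gram

variable {n : ℕ} (κ : Fin n → ℝ) (x : ℝ)

/-- The vector `(exp (-x κ_j))`. -/
noncomputable def gramU (j : Fin n) : ℝ := Real.exp (-x * κ j)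

/-- The vector `(exp (x κ_j))`. -/
noncomputable def gramV (j : Fin n) : ℝ := Real.exp (x * κ j)

/-- The solution `c` of `G c = u`. -/
noncomputable def gramC : Fin n → ℝ := (expGram κ x)⁻¹ *ᵥ gramU κ x

/-- The solution `d` of `G d = v`. -/
noncomputable def gramD : Fin n → ℝ := (expGram κ x)⁻¹ *ᵥ gramV κ x

/-- The scalar `vᵀ G⁻¹ u`. -/
noncomputable def gramS : ℝ := gramC κ x ⬝ᵥ gramV κ x

theorem expGram_apply (i j : Fin n) :
    expGram κ x i j = ∫ y in (-x)..x, Real.exp ((κ i + κ j) * y) := rfl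

theorem expGram_symm (i j : Fin n) : expGram κ x i j = expGram κ x j i := by
  rw [expGram_apply, expGram_apply, add_comm]

theorem expGram_transpose : (expGram κ x)ᵀ = expGram κ x := by
  ext i j
  exact expGram_symm κ x j i

theorem expGram_eq_weightedGram :
    expGram κ x = weightedGram (fun i y => Real.exp (κ i * y)) (fun _ => 1) (-x) x := by
  ext i j
  rw [expGram_apply]
  simp only [weightedGram, Matrix.of_apply, mul_one, ← Real.exp_add, add_mul]

variable {κ x}

theorem expGram_posDef (hκ : Function.Injective κ) (hx : 0 < x) : (expGram κ x).PosDef := by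
  rw [expGram_eq_weightedGram]
  refine weightedGram_posDef (by linarith) (fun i => ?_) continuousOn_const
    (fun _ _ => one_pos) (fun c hc => exp_linearIndependent_on hκ (by linarith) c hc)
  fun_prop

theorem expGram_det_pos (hκ : Function.Injective κ) (hx : 0 < x) : 0 < (expGram κ x).det :=
  (expGram_posDef hκ hx).det_pos

/-- Only the endpoints depend on x, so the derivative G' = uuᵀ + vvᵀ has rank at most two. -/
theorem hasDerivAt_expGram (i j : Fin n) :
    HasDerivAt (fun x => expGram κ x i j)
      (gramU κ x i * gramU κ x j + gramV κ x i * gramV κ x j) x := by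
  have hc : Continuous fun y : ℝ => Real.exp ((κ i + κ j) * y) := by fun_prop
  have h1 := fun x => intervalIntegral.integral_hasDerivAt_right (hc.intervalIntegrable 0 x)
    (hc.stronglyMeasurableAtFilter _ _) hc.continuousAt
  have h2 := (h1 x).sub ((h1 (-x)).scomp x (hasDerivAt_neg x))
  have e : (fun x => expGram κ x i j) = (fun x => (∫ y in (0 : ℝ)..x, Real.exp ((κ i + κ j) * y)))
      - (fun u => ∫ y in (0 : ℝ)..u, Real.exp ((κ i + κ j) * y)) ∘ Neg.neg := by
    funext x
    rw [expGram_apply, Pi.sub_apply, Function.comp_apply,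
      intervalIntegral.integral_interval_sub_left (hc.intervalIntegrable _ _)
        (hc.intervalIntegrable _ _)]
  rw [e]
  refine h2.congr_deriv ?_
  simp only [gramU, gramV, ← Real.exp_add, smul_eq_mul]
  ring_nf

/-- The displacement equation KG + GK = vvᵀ - uuᵀ, obtained by integrating a derivative. It is left
undivided so that κ_i + κ_j = 0 is allowed. -/
theorem add_mul_expGram (i j : Fin n) :
    (κ i + κ j) * expGram κ x i j = gramV κ x i * gramV κ x j - gramU κ x i * gramU κ x j := by
  have h : ∀ y ∈ Set.uIcc (-x) x, HasDerivAt (fun y => Real.exp ((κ i + κ j) * y))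
      ((κ i + κ j) * Real.exp ((κ i + κ j) * y)) y := fun y _ => by
    have := ((hasDerivAt_id y).const_mul (κ i + κ j)).exp
    simpa [mul_comm] using this
  have := intervalIntegral.integral_eq_sub_of_hasDerivAt h (Continuous.intervalIntegrable
    (by fun_prop) _ _)
  rw [intervalIntegral.integral_const_mul] at this
  rw [expGram_apply, this]
  simp only [gramU, gramV, ← Real.exp_add]
  ring_nf

theorem expGram_mulVec_inv_mulVec (hG : (expGram κ x).det ≠ 0) (w : Fin n → ℝ) :
    expGram κ x *ᵥ ((expGram κ x)⁻¹ *ᵥ w) = w := by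
  rw [Matrix.mulVec_mulVec, Matrix.mul_nonsing_inv _ (Ne.isUnit hG), Matrix.one_mulVec]

theorem expGram_mulVec_injective (hG : (expGram κ x).det ≠ 0) {w w' : Fin n → ℝ}
    (h : expGram κ x *ᵥ w = expGram κ x *ᵥ w') : w = w' :=
  Matrix.mulVec_injective_of_isUnit ((Matrix.isUnit_iff_isUnit_det _).2 (Ne.isUnit hG)) h

theorem expGram_mulVec_gramC (hG : (expGram κ x).det ≠ 0) :
    expGram κ x *ᵥ gramC κ x = gramU κ x := expGram_mulVec_inv_mulVec hG _

theorem expGram_mulVec_gramD (hG : (expGram κ x).det ≠ 0) :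
    expGram κ x *ᵥ gramD κ x = gramV κ x := expGram_mulVec_inv_mulVec hG _

theorem inv_expGram_transpose : ((expGram κ x)⁻¹)ᵀ = (expGram κ x)⁻¹ := by
  rw [Matrix.transpose_nonsing_inv, expGram_transpose]

theorem dotProduct_inv_expGram_mulVec (w w' : Fin n → ℝ) :
    w ⬝ᵥ ((expGram κ x)⁻¹ *ᵥ w') = w' ⬝ᵥ ((expGram κ x)⁻¹ *ᵥ w) := by
  rw [Matrix.dotProduct_mulVec, ← Matrix.mulVec_transpose, inv_expGram_transpose, dotProduct_comm]

theorem gramD_dotProduct_gramU : gramD κ x ⬝ᵥ gramU κ x = gramS κ x := by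
  rw [gramS, dotProduct_comm, gramD, dotProduct_inv_expGram_mulVec, dotProduct_comm]
  rfl

theorem expGram_mulVec_mul (w : Fin n → ℝ) :
    expGram κ x *ᵥ (κ * w) = (w ⬝ᵥ gramV κ x) • gramV κ x - (w ⬝ᵥ gramU κ x) • gramU κ x
      - κ * (expGram κ x *ᵥ w) := by
  funext i
  simp only [mulVec, dotProduct, Pi.mul_apply, Pi.sub_apply, Pi.smul_apply, smul_eq_mul,
    Finset.sum_mul, Finset.mul_sum, ← Finset.sum_sub_distrib]
  refine Finset.sum_congr rfl fun j _ => ?_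
  linear_combination w j * add_mul_expGram (κ := κ) (x := x) i j

/-- Multiplying the displacement equation by G⁻¹ on both sides gives G⁻¹K + KG⁻¹ = ddᵀ - ccᵀ, since
G⁻¹ is symmetric. -/
theorem inv_expGram_commutator (hG : (expGram κ x).det ≠ 0) (i j : Fin n) :
    (κ i + κ j) * (expGram κ x)⁻¹ i j =
      gramD κ x i * gramD κ x j - gramC κ x i * gramC κ x j := by
  have h1 : Matrix.diagonal κ * expGram κ x + expGram κ x * Matrix.diagonal κ =
      Matrix.vecMulVec (gramV κ x) (gramV κ x) - Matrix.vecMulVec (gramU κ x) (gramU κ x) := by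
    ext i j
    rw [Matrix.add_apply, Matrix.diagonal_mul, Matrix.mul_diagonal, Matrix.sub_apply,
      Matrix.vecMulVec_apply, Matrix.vecMulVec_apply, ← add_mul_expGram]
    ring
  have hu : IsUnit (expGram κ x).det := Ne.isUnit hG
  have h2 : (expGram κ x)⁻¹ * Matrix.diagonal κ + Matrix.diagonal κ * (expGram κ x)⁻¹ =
      Matrix.vecMulVec (gramD κ x) (gramD κ x) - Matrix.vecMulVec (gramC κ x) (gramC κ x) := by
    have h3 := congrArg (fun M => (expGram κ x)⁻¹ * M * (expGram κ x)⁻¹) h1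
    have hv : ∀ w : Fin n → ℝ, w ᵥ* (expGram κ x)⁻¹ = (expGram κ x)⁻¹ *ᵥ w := fun w => by
      rw [← Matrix.mulVec_transpose, inv_expGram_transpose]
    simp only [mul_add, add_mul, mul_sub, sub_mul, Matrix.mul_vecMulVec, Matrix.vecMulVec_mul,
      hv] at h3
    rw [Matrix.mul_assoc, Matrix.mul_assoc, Matrix.mul_nonsing_inv _ hu, Matrix.mul_one,
      Matrix.nonsing_inv_mul_cancel_left _ _ hu] at h3
    exact h3
  have h4 := congrFun (congrFun h2 i) j
  rw [Matrix.add_apply, Matrix.diagonal_mul, Matrix.mul_diagonal, Matrix.sub_apply,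
    Matrix.vecMulVec_apply, Matrix.vecMulVec_apply] at h4
  linear_combination h4

theorem hasDerivAt_gramU (j : Fin n) :
    HasDerivAt (fun x => gramU κ x j) (-κ j * gramU κ x j) x := by
  have := ((hasDerivAt_neg x).mul_const (κ j)).exp
  refine this.congr_deriv ?_
  rw [gramU]; ring

theorem hasDerivAt_gramV (j : Fin n) :
    HasDerivAt (fun x => gramV κ x j) (κ j * gramV κ x j) x := by
  have := ((hasDerivAt_id x).mul_const (κ j)).exp
  refine this.congr_deriv ?_
  rw [gramV, id]; ring

theorem differentiableAt_inv_expGram_mulVec (hG : (expGram κ x).det ≠ 0) {w : ℝ → Fin n → ℝ}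
    (hw : ∀ j, DifferentiableAt ℝ (fun x => w x j) x) (j : Fin n) :
    DifferentiableAt ℝ (fun x => ((expGram κ x)⁻¹ *ᵥ w x) j) x := by
  have e : (fun x => ((expGram κ x)⁻¹ *ᵥ w x) j) =
      fun x => (expGram κ x).det⁻¹ * ((expGram κ x).updateCol j (w x)).det := by
    funext x
    rw [Matrix.inv_def, Ring.inverse_eq_inv', Matrix.smul_mulVec, Pi.smul_apply, smul_eq_mul,
      ← Matrix.cramer_eq_adjugate_mulVec, Matrix.cramer_apply]
  rw [e]
  refine ((hasDerivAt_matrix_det fun i j => hasDerivAt_expGram i j).differentiableAt.inv hG).mul ?_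
  refine (hasDerivAt_matrix_det (M' := Matrix.of fun i k => deriv (fun x =>
    (expGram κ x).updateCol j (w x) i k) x) fun i k => ?_).differentiableAt
  refine DifferentiableAt.hasDerivAt ?_
  by_cases hk : k = j
  · subst hk
    simpa only [Matrix.updateCol_self] using hw i
  · simpa only [Matrix.updateCol_ne hk] using (hasDerivAt_expGram i k).differentiableAt

/-- For q = G⁻¹w, differentiating Gq = w gives Gq' = w' - G'q, and injectivity of G identifies q'
with any candidate solving this. Differentiability of q is known beforehand from Cramer's rule. -/
theorem hasDerivAt_inv_expGram_mulVec (hG : (expGram κ x).det ≠ 0)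
    (hG' : ∀ᶠ y in 𝓝 x, (expGram κ y).det ≠ 0) {w : ℝ → Fin n → ℝ} {w' z : Fin n → ℝ}
    (hw : ∀ j, HasDerivAt (fun x => w x j) (w' j) x)
    (hz : expGram κ x *ᵥ z = w' -
      (((expGram κ x)⁻¹ *ᵥ w x) ⬝ᵥ gramU κ x) • gramU κ x -
      (((expGram κ x)⁻¹ *ᵥ w x) ⬝ᵥ gramV κ x) • gramV κ x) (j : Fin n) :
    HasDerivAt (fun x => ((expGram κ x)⁻¹ *ᵥ w x) j) (z j) x := by
  set q : ℝ → Fin n → ℝ := fun x => (expGram κ x)⁻¹ *ᵥ w x with hq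
  have hqd : ∀ j, HasDerivAt (fun x => q x j) (deriv (fun x => q x j) x) x := fun j =>
    (differentiableAt_inv_expGram_mulVec hG (fun j => (hw j).differentiableAt) j).hasDerivAt
  set q' : Fin n → ℝ := fun j => deriv (fun x => q x j) x
  have hz' : z = q' := by
    refine expGram_mulVec_injective hG ?_
    rw [hz]
    change w' - (q x ⬝ᵥ gramU κ x) • gramU κ x - (q x ⬝ᵥ gramV κ x) • gramV κ x = _
    funext i
    have h1 : HasDerivAt (fun x => ∑ j, expGram κ x i j * q x j)
        (∑ j, ((gramU κ x i * gramU κ x j + gramV κ x i * gramV κ x j) * q x j +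
          expGram κ x i j * q' j)) x :=
      HasDerivAt.fun_sum fun j _ => (hasDerivAt_expGram i j).mul (hqd j)
    have h2 : (fun x => ∑ j, expGram κ x i j * q x j) =ᶠ[𝓝 x] fun x => w x i := by
      filter_upwards [hG'] with y hy
      exact congrFun (expGram_mulVec_inv_mulVec hy (w y)) i
    have h3 := h1.unique ((hw i).congr_of_eventuallyEq h2)
    simp only [Pi.sub_apply, Pi.smul_apply, smul_eq_mul, dotProduct, mulVec]
    rw [← h3, Finset.sum_mul, Finset.sum_mul, ← Finset.sum_sub_distrib, ← Finset.sum_sub_distrib]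
    exact Finset.sum_congr rfl fun j _ => by ring
  rw [hz']
  exact hqd j

theorem eventually_expGram_det_ne_zero (hκ : Function.Injective κ) (hx : 0 < x) :
    ∀ᶠ y in 𝓝 x, (expGram κ y).det ≠ 0 := by
  filter_upwards [lt_mem_nhds hx] with y hy using (expGram_det_pos hκ hy).ne'

/-- Here Gc' = -Ku - (c·u)u - sv, while the displacement equation gives G(Kc) = sv - (c·u)u - Ku.
The difference is -2sv = -2sGd. For d the roles of u and v are exchanged and the sign of K changes.
-/
theorem hasDerivAt_gramC (hκ : Function.Injective κ) (hx : 0 < x) (j : Fin n) :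
    HasDerivAt (fun x => gramC κ x j) (κ j * gramC κ x j - 2 * gramS κ x * gramD κ x j) x := by
  have hG := (expGram_det_pos hκ hx).ne'
  refine hasDerivAt_inv_expGram_mulVec (w' := fun j => -κ j * gramU κ x j)
    (z := κ * gramC κ x - (2 * gramS κ x) • gramD κ x) hG
    (eventually_expGram_det_ne_zero hκ hx) hasDerivAt_gramU ?_ j
  rw [Matrix.mulVec_sub, Matrix.mulVec_smul, expGram_mulVec_mul, expGram_mulVec_gramC hG,
    expGram_mulVec_gramD hG]
  change (gramS κ x) • _ - _ - _ - _ = _ - _ - (gramS κ x) • _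
  funext i
  simp only [Pi.sub_apply, Pi.smul_apply, Pi.mul_apply, smul_eq_mul, gramC]
  ring

theorem hasDerivAt_gramD (hκ : Function.Injective κ) (hx : 0 < x) (j : Fin n) :
    HasDerivAt (fun x => gramD κ x j) (-κ j * gramD κ x j - 2 * gramS κ x * gramC κ x j) x := by
  have hG := (expGram_det_pos hκ hx).ne'
  refine hasDerivAt_inv_expGram_mulVec (w' := fun j => κ j * gramV κ x j)
    (z := -(κ * gramD κ x) - (2 * gramS κ x) • gramC κ x) hG
    (eventually_expGram_det_ne_zero hκ hx) hasDerivAt_gramV ?_ j |>.congr_deriv ?_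
  · rw [Matrix.mulVec_sub, Matrix.mulVec_smul, Matrix.mulVec_neg, expGram_mulVec_mul,
      expGram_mulVec_gramC hG, expGram_mulVec_gramD hG, gramD_dotProduct_gramU]
    change _ = _ - (gramD κ x ⬝ᵥ gramU κ x) • _ - _
    rw [gramD_dotProduct_gramU]
    funext i
    simp only [Pi.sub_apply, Pi.smul_apply, Pi.mul_apply, Pi.neg_apply, smul_eq_mul, gramD]
    ring
  · simp

/-- `(uᵀ G⁻¹ u)' = -2 s ^ 2`. -/
theorem hasDerivAt_gramC_dotProduct_gramU (hκ : Function.Injective κ) (hx : 0 < x) :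
    HasDerivAt (fun x => gramC κ x ⬝ᵥ gramU κ x) (-2 * gramS κ x ^ 2) x := by
  have h : HasDerivAt (fun x => ∑ j, gramC κ x j * gramU κ x j) _ x :=
    HasDerivAt.fun_sum fun j _ => (hasDerivAt_gramC hκ hx j).mul (hasDerivAt_gramU j)
  refine h.congr_deriv ?_
  have e : -2 * gramS κ x ^ 2 = -2 * gramS κ x * (gramD κ x ⬝ᵥ gramU κ x) := by
    rw [gramD_dotProduct_gramU]; ring
  rw [e, dotProduct, Finset.mul_sum]
  exact Finset.sum_congr rfl fun j _ => by ring

/-- `(vᵀ G⁻¹ v)' = -2 s ^ 2`. -/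
theorem hasDerivAt_gramD_dotProduct_gramV (hκ : Function.Injective κ) (hx : 0 < x) :
    HasDerivAt (fun x => gramD κ x ⬝ᵥ gramV κ x) (-2 * gramS κ x ^ 2) x := by
  have h : HasDerivAt (fun x => ∑ j, gramD κ x j * gramV κ x j) _ x :=
    HasDerivAt.fun_sum fun j _ => (hasDerivAt_gramD hκ hx j).mul (hasDerivAt_gramV j)
  refine h.congr_deriv ?_
  have e : -2 * gramS κ x ^ 2 = -2 * gramS κ x * (gramC κ x ⬝ᵥ gramV κ x) := by
    rw [gramS]; ring
  rw [e, dotProduct, Finset.mul_sum]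
  exact Finset.sum_congr rfl fun j _ => by ring

/-- This is tr(G⁻¹G') with G' = uuᵀ + vvᵀ, the trace arising column by column from Cramer's rule. -/
theorem hasDerivAt_expGram_det (hκ : Function.Injective κ) (hx : 0 < x) :
    HasDerivAt (fun x => (expGram κ x).det)
      ((expGram κ x).det * (gramC κ x ⬝ᵥ gramU κ x + gramD κ x ⬝ᵥ gramV κ x)) x := by
  have hG := (expGram_det_pos hκ hx).ne'
  refine (hasDerivAt_matrix_det (M' := Matrix.of fun i j =>
    gramU κ x i * gramU κ x j + gramV κ x i * gramV κ x j)
    fun i j => hasDerivAt_expGram i j).congr_deriv ?_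
  have hcr : ∀ (w : Fin n → ℝ) i, ((expGram κ x).updateCol i w).det =
      (expGram κ x).det * ((expGram κ x)⁻¹ *ᵥ w) i := by
    intro w i
    rw [← Matrix.cramer_apply, Matrix.cramer_eq_adjugate_mulVec, Matrix.inv_def,
      Ring.inverse_eq_inv', Matrix.smul_mulVec, Pi.smul_apply, smul_eq_mul,
      mul_inv_cancel_left₀ hG]
  simp only [hcr]
  have e : ∀ i, (fun k => Matrix.of (fun i j => gramU κ x i * gramU κ x j +
      gramV κ x i * gramV κ x j) k i) = gramU κ x i • gramU κ x + gramV κ x i • gramV κ x := by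
    intro i
    funext k
    simp [mul_comm]
  simp only [e, Matrix.mulVec_add, Matrix.mulVec_smul, Pi.add_apply, Pi.smul_apply, smul_eq_mul]
  rw [dotProduct, dotProduct, ← Finset.sum_add_distrib, Finset.mul_sum]
  refine Finset.sum_congr rfl fun i _ => ?_
  rw [gramC, gramD]
  ring

theorem hasDerivAt_log_expGram_det (hκ : Function.Injective κ) (hx : 0 < x) :
    HasDerivAt (fun x => Real.log (expGram κ x).det)
      (gramC κ x ⬝ᵥ gramU κ x + gramD κ x ⬝ᵥ gramV κ x) x := by
  have hG := (expGram_det_pos hκ hx).ne'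
  refine ((hasDerivAt_expGram_det hκ hx).log hG).congr_deriv ?_
  rw [mul_div_cancel_left₀ _ hG]

section proj

variable {V : Type*} [NormedAddCommGroup V] [NormedSpace ℝ V] {k : ℝ → Fin n → V} {m : Fin n → V}
  {e₁ e₂ : ℝ → V} {e' : V}

/-- An abstract form of the equation A' = -iwA - 2sB. It asks of the k_j only the same endpoint
derivative and displacement relation as the columns of G, with m_j in the place of iw·k_j. It is
applied to the evaluators, to their derivatives in w, and to the column that borders G. -/
theorem hasDerivAt_sub_sum_gramC (hκ : Function.Injective κ) (hx : 0 < x)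
    (hk : ∀ j, HasDerivAt (fun x => k x j) (gramU κ x j • e₁ x + gramV κ x j • e₂ x) x)
    (hm : ∀ j, κ j • k x j + m j = gramV κ x j • e₂ x - gramU κ x j • e₁ x)
    (he : HasDerivAt e₁ e' x) :
    HasDerivAt (fun x => e₁ x - ∑ j, gramC κ x j • k x j)
      (e' + ∑ j, gramC κ x j • m j -
        (2 * gramS κ x) • (e₂ x - ∑ j, gramD κ x j • k x j)) x := by
  have h : HasDerivAt (fun x => e₁ x - ∑ j, gramC κ x j • k x j) _ x :=
    he.sub (HasDerivAt.fun_sum fun j _ => (hasDerivAt_gramC hκ hx j).smul (hk j))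
  refine h.congr_deriv ?_
  have hm' : ∀ j, m j = gramV κ x j • e₂ x - gramU κ x j • e₁ x - κ j • k x j :=
    fun j => eq_sub_of_add_eq' (hm j)
  have e3 : (2 * gramS κ x) • e₂ x = ∑ j, (2 * (gramC κ x j * gramV κ x j)) • e₂ x := by
    rw [← Finset.sum_smul, ← Finset.mul_sum]; rfl
  rw [smul_sub, e3, Finset.smul_sum, sub_eq_add_neg, sub_eq_add_neg, add_assoc,
    ← Finset.sum_neg_distrib, ← Finset.sum_sub_distrib, ← Finset.sum_neg_distrib,
    ← Finset.sum_add_distrib]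
  congr 1
  refine Finset.sum_congr rfl fun j _ => ?_
  rw [hm']
  module

theorem hasDerivAt_sub_sum_gramD (hκ : Function.Injective κ) (hx : 0 < x)
    (hk : ∀ j, HasDerivAt (fun x => k x j) (gramU κ x j • e₁ x + gramV κ x j • e₂ x) x)
    (hm : ∀ j, κ j • k x j + m j = gramV κ x j • e₂ x - gramU κ x j • e₁ x)
    (he : HasDerivAt e₂ e' x) :
    HasDerivAt (fun x => e₂ x - ∑ j, gramD κ x j • k x j)
      (e' - ∑ j, gramD κ x j • m j -
        (2 * gramS κ x) • (e₁ x - ∑ j, gramC κ x j • k x j)) x := by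
  have h : HasDerivAt (fun x => e₂ x - ∑ j, gramD κ x j • k x j) _ x :=
    he.sub (HasDerivAt.fun_sum fun j _ => (hasDerivAt_gramD hκ hx j).smul (hk j))
  refine h.congr_deriv ?_
  have hm' : ∀ j, m j = gramV κ x j • e₂ x - gramU κ x j • e₁ x - κ j • k x j :=
    fun j => eq_sub_of_add_eq' (hm j)
  have e3 : (2 * gramS κ x) • e₁ x = ∑ j, (2 * (gramD κ x j * gramU κ x j)) • e₁ x := by
    rw [← Finset.sum_smul, ← Finset.mul_sum, ← gramD_dotProduct_gramU]; rfl
  rw [smul_sub, e3, Finset.smul_sum, sub_eq_add_neg, sub_eq_add_neg, sub_eq_add_neg, add_assoc,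
    ← Finset.sum_neg_distrib, ← Finset.sum_neg_distrib, ← Finset.sum_sub_distrib,
    ← Finset.sum_neg_distrib, ← Finset.sum_add_distrib]
  congr 1
  refine Finset.sum_congr rfl fun j _ => ?_
  rw [hm']
  module

end proj

end gram

end

section

open Matrix

/-! ## The projected exponentials -/

theorem eq_of_prod_sub_mul_eq {n : ℕ} (z : Fin n → ℂ) {f g : ℂ → ℂ} (hf : Continuous f)
    (hg : Continuous g) (h : ∀ w, (∏ j, (w - z j)) * f w = (∏ j, (w - z j)) * g w) : f = g := by
  have hd : Dense (Set.range z)ᶜ := (Set.finite_range z).countable.dense_compl ℝ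
  refine Continuous.ext_on hd hf hg fun w hw => mul_left_cancel₀ ?_ (h w)
  exact Finset.prod_ne_zero_iff.2 fun j _ => sub_ne_zero.2 fun h => hw ⟨j, h.symm⟩

/-- The derivative of `pwKernel x z` at `w`. -/
noncomputable def pwKernelDeriv (x : ℝ) (z w : ℂ) : ℂ :=
  ∫ y in (-x)..x, -Complex.I * y * Complex.exp (Complex.I * y * (conj z - w))

theorem hasDerivAt_symm_intervalIntegral {f : ℝ → ℂ} (hf : Continuous f) (x : ℝ) :
    HasDerivAt (fun x => ∫ y in (-x)..x, f y) (f x + f (-x)) x := by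
  have h1 := fun x => intervalIntegral.integral_hasDerivAt_right (hf.intervalIntegrable 0 x)
    (hf.stronglyMeasurableAtFilter _ _) hf.continuousAt
  have h2 := (h1 x).sub ((h1 (-x)).scomp x (hasDerivAt_neg x))
  have e : (fun x => ∫ y in (-x)..x, f y) = (fun x => (∫ y in (0 : ℝ)..x, f y))
      - (fun u => ∫ y in (0 : ℝ)..u, f y) ∘ Neg.neg := by
    funext x
    rw [Pi.sub_apply, Function.comp_apply, intervalIntegral.integral_interval_sub_left
      (hf.intervalIntegrable _ _) (hf.intervalIntegrable _ _)]
  rw [e]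
  refine h2.congr_deriv ?_
  rw [neg_smul, one_smul, sub_neg_eq_add]

theorem conj_pwKernel_symm (x : ℝ) (z w : ℂ) : conj (pwKernel x z w) = pwKernel x w z := by
  rw [pwKernel, ← intervalIntegral.intervalIntegral_conj, pwKernel]
  congr 1
  ext y
  rw [← Complex.exp_conj]
  congr 1
  simp only [map_mul, Complex.conj_I, Complex.conj_ofReal, map_sub, Complex.conj_conj]
  ring

section generator

variable {n : ℕ} (κ : Fin n → ℝ) (x : ℝ)

theorem conj_trivialZeros (j : Fin n) : conj (trivialZeros κ j) = Complex.I * κ j := by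
  simp [trivialZeros]

theorem trivialZeros_injective {κ : Fin n → ℝ} (hκ : Function.Injective κ) :
    Function.Injective (trivialZeros κ) := by
  intro i j h
  have := mul_left_cancel₀ (neg_ne_zero.2 Complex.I_ne_zero) h
  exact hκ (Complex.ofReal_injective this)

theorem exp_trivialZeros_sub (j : Fin n) (w : ℂ) :
    Complex.exp (Complex.I * x * (conj (trivialZeros κ j) - w)) =
      gramU κ x j * Complex.exp (-(Complex.I * x * w)) := by
  rw [conj_trivialZeros, gramU, Complex.ofReal_exp, ← Complex.exp_add]
  congr 1
  push_cast
  linear_combination (x * κ j : ℂ) * Complex.I_mul_I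

theorem exp_neg_trivialZeros_sub (j : Fin n) (w : ℂ) :
    Complex.exp (-(Complex.I * x * (conj (trivialZeros κ j) - w))) =
      gramV κ x j * Complex.exp (Complex.I * x * w) := by
  rw [conj_trivialZeros, gramV, Complex.ofReal_exp, ← Complex.exp_add]
  congr 1
  push_cast
  linear_combination -(x * κ j : ℂ) * Complex.I_mul_I

theorem pwKernel_trivialZeros_mul (j : Fin n) (w : ℂ) :
    (κ j + Complex.I * w) * pwKernel x (trivialZeros κ j) w =
      gramV κ x j * Complex.exp (Complex.I * x * w) -
        gramU κ x j * Complex.exp (-(Complex.I * x * w)) := by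
  have h := pwKernel_mul x (trivialZeros κ j) w
  rw [exp_trivialZeros_sub, exp_neg_trivialZeros_sub, conj_trivialZeros] at h
  linear_combination -h + κ j * pwKernel x (trivialZeros κ j) w * Complex.I_mul_I

theorem hasDerivAt_exp_neg_mul (w : ℂ) : HasDerivAt (fun w => Complex.exp (-(Complex.I * x * w)))
    (-(Complex.I * x) * Complex.exp (-(Complex.I * x * w))) w := by
  have := ((hasDerivAt_id w).const_mul (Complex.I * x)).fun_neg.cexp
  refine this.congr_deriv ?_
  simp only [id]; ring

theorem hasDerivAt_exp_mul (w : ℂ) : HasDerivAt (fun w => Complex.exp (Complex.I * x * w))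
    (Complex.I * x * Complex.exp (Complex.I * x * w)) w := by
  have := ((hasDerivAt_id w).const_mul (Complex.I * x)).cexp
  refine this.congr_deriv ?_
  simp only [id]; ring

theorem pwKernelDeriv_trivialZeros_mul (j : Fin n) (w : ℂ) :
    (κ j + Complex.I * w) * pwKernelDeriv x (trivialZeros κ j) w +
        Complex.I * pwKernel x (trivialZeros κ j) w =
      gramV κ x j * (Complex.I * x * Complex.exp (Complex.I * x * w)) -
        gramU κ x j * (-(Complex.I * x) * Complex.exp (-(Complex.I * x * w))) := by
  have h1 : HasDerivAt (fun w => (κ j + Complex.I * w) * pwKernel x (trivialZeros κ j) w) _ w :=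
    (((hasDerivAt_id w).const_mul Complex.I).const_add (κ j : ℂ)).mul
      (hasDerivAt_pwKernel x (trivialZeros κ j) w)
  have h2 : HasDerivAt (fun w => (gramV κ x j : ℂ) * Complex.exp (Complex.I * x * w) -
      gramU κ x j * Complex.exp (-(Complex.I * x * w))) _ w :=
    ((hasDerivAt_exp_mul x w).const_mul _).sub ((hasDerivAt_exp_neg_mul x w).const_mul _)
  simp only [pwKernel_trivialZeros_mul] at h1
  have h3 := h1.unique h2
  rw [← h3, pwKernelDeriv]
  simp only [id]
  ring

theorem hasDerivAt_pwKernel_width (j : Fin n) (w : ℂ) :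
    HasDerivAt (fun x => pwKernel x (trivialZeros κ j) w)
      (gramU κ x j • Complex.exp (-(Complex.I * x * w)) +
        gramV κ x j • Complex.exp (Complex.I * x * w)) x := by
  have h := hasDerivAt_symm_intervalIntegral (f := fun y : ℝ =>
    Complex.exp (Complex.I * y * (conj (trivialZeros κ j) - w))) (by fun_prop) x
  refine h.congr_deriv ?_
  rw [exp_trivialZeros_sub, Complex.real_smul, Complex.real_smul, ← exp_neg_trivialZeros_sub]
  push_cast
  ring_nf

theorem hasDerivAt_pwKernelDeriv_width (j : Fin n) (w : ℂ) :
    HasDerivAt (fun x => pwKernelDeriv x (trivialZeros κ j) w)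
      (gramU κ x j • (-(Complex.I * x) * Complex.exp (-(Complex.I * x * w))) +
        gramV κ x j • (Complex.I * x * Complex.exp (Complex.I * x * w))) x := by
  have h := hasDerivAt_symm_intervalIntegral (f := fun y : ℝ =>
    -Complex.I * y * Complex.exp (Complex.I * y * (conj (trivialZeros κ j) - w))) (by fun_prop) x
  refine h.congr_deriv ?_
  have e : Complex.exp (Complex.I * ((-x : ℝ) : ℂ) * (conj (trivialZeros κ j) - w)) =
      gramV κ x j * Complex.exp (Complex.I * x * w) := by
    rw [← exp_neg_trivialZeros_sub]; push_cast; ring_nf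
  rw [e, exp_trivialZeros_sub, Complex.real_smul, Complex.real_smul]
  push_cast
  ring

theorem pwKernel_trivialZeros_trivialZeros (i j : Fin n) :
    pwKernel x (trivialZeros κ i) (trivialZeros κ j) = expGram κ x i j := by
  have := intervalIntegral.integral_comp_neg (a := -x) (b := x)
    (fun y : ℝ => Real.exp ((κ i + κ j) * y))
  rw [neg_neg] at this
  rw [expGram_apply, ← this, ← intervalIntegral.integral_ofReal, pwKernel]
  congr 1
  ext y
  rw [conj_trivialZeros, trivialZeros, Complex.ofReal_exp]
  congr 1
  push_cast
  linear_combination (y * (κ i + κ j) : ℂ) * Complex.I_mul_I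

/-- The function `exp (-i x w)`, orthogonalized against the evaluators at the trivial zeros. -/
noncomputable def projMinus (w : ℂ) : ℂ :=
  Complex.exp (-(Complex.I * x * w)) - ∑ j, gramC κ x j • pwKernel x (trivialZeros κ j) w

/-- The function `exp (i x w)`, orthogonalized against the evaluators at the trivial zeros. -/
noncomputable def projPlus (w : ℂ) : ℂ :=
  Complex.exp (Complex.I * x * w) - ∑ j, gramD κ x j • pwKernel x (trivialZeros κ j) w

/-- The derivative of `projMinus`. -/
noncomputable def projMinusDeriv (w : ℂ) : ℂ :=
  -(Complex.I * x) * Complex.exp (-(Complex.I * x * w)) -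
    ∑ j, gramC κ x j • pwKernelDeriv x (trivialZeros κ j) w

/-- The derivative of `projPlus`. -/
noncomputable def projPlusDeriv (w : ℂ) : ℂ :=
  Complex.I * x * Complex.exp (Complex.I * x * w) -
    ∑ j, gramD κ x j • pwKernelDeriv x (trivialZeros κ j) w

theorem hasDerivAt_projMinus (w : ℂ) : HasDerivAt (projMinus κ x) (projMinusDeriv κ x w) w :=
  (hasDerivAt_exp_neg_mul x w).sub
    (HasDerivAt.fun_sum fun j _ => (hasDerivAt_pwKernel x (trivialZeros κ j) w).fun_const_smul _)

theorem hasDerivAt_projPlus (w : ℂ) : HasDerivAt (projPlus κ x) (projPlusDeriv κ x w) w :=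
  (hasDerivAt_exp_mul x w).sub
    (HasDerivAt.fun_sum fun j _ => (hasDerivAt_pwKernel x (trivialZeros κ j) w).fun_const_smul _)

theorem differentiable_projMinus : Differentiable ℂ (projMinus κ x) := fun w =>
  (hasDerivAt_projMinus κ x w).differentiableAt

theorem differentiable_projPlus : Differentiable ℂ (projPlus κ x) := fun w =>
  (hasDerivAt_projPlus κ x w).differentiableAt

variable {κ x}

theorem exp_neg_trivialZeros (m : Fin n) :
    Complex.exp (-(Complex.I * x * trivialZeros κ m)) = gramU κ x m := by
  rw [gramU, Complex.ofReal_exp, trivialZeros]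
  congr 1
  push_cast
  linear_combination (x * κ m : ℂ) * Complex.I_mul_I

theorem projMinus_trivialZeros (hG : (expGram κ x).det ≠ 0) (m : Fin n) :
    projMinus κ x (trivialZeros κ m) = 0 := by
  have h := congrFun (expGram_mulVec_gramC hG) m
  rw [projMinus, exp_neg_trivialZeros, ← h]
  simp only [pwKernel_trivialZeros_trivialZeros, mulVec, dotProduct, Complex.real_smul]
  push_cast
  rw [sub_eq_zero]
  exact Finset.sum_congr rfl fun j _ => by rw [expGram_symm, mul_comm]

theorem hasDerivAt_exp_neg_width (w : ℂ) (x : ℝ) :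
    HasDerivAt (fun x : ℝ => Complex.exp (-(Complex.I * x * w)))
      (-(Complex.I * w) * Complex.exp (-(Complex.I * x * w))) x := by
  have h : HasDerivAt (fun x : ℂ => Complex.exp (-(Complex.I * x * w))) _ (x : ℂ) :=
    (((hasDerivAt_id (x : ℂ)).const_mul Complex.I).mul_const w).fun_neg.cexp
  refine h.comp_ofReal.congr_deriv ?_
  simp only [id]; ring

theorem hasDerivAt_projMinus_width (hκ : Function.Injective κ) (hx : 0 < x) (w : ℂ) :
    HasDerivAt (fun x => projMinus κ x w)
      (-(Complex.I * w) * projMinus κ x w - (2 * gramS κ x) • projPlus κ x w) x := by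
  refine (hasDerivAt_sub_sum_gramC hκ hx
    (k := fun x j => pwKernel x (trivialZeros κ j) w)
    (m := fun j => Complex.I * w * pwKernel x (trivialZeros κ j) w)
    (e₁ := fun x : ℝ => Complex.exp (-(Complex.I * x * w)))
    (e₂ := fun x : ℝ => Complex.exp (Complex.I * x * w))
    (fun j => hasDerivAt_pwKernel_width κ x j w) (fun j => ?_)
    (hasDerivAt_exp_neg_width w x)).congr_deriv ?_
  · have := pwKernel_trivialZeros_mul κ x j w
    simp only [Complex.real_smul]
    linear_combination this
  · rw [projMinus, projPlus, mul_sub, Finset.mul_sum, neg_mul]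
    simp only [Complex.real_smul]
    congr 1
    rw [sub_eq_add_neg, ← Finset.sum_neg_distrib]
    congr 1
    exact Finset.sum_congr rfl fun j _ => by ring

theorem hasDerivAt_projMinusDeriv_width (hκ : Function.Injective κ) (hx : 0 < x) (w : ℂ) :
    HasDerivAt (fun x => projMinusDeriv κ x w)
      (-(Complex.I * w) * projMinusDeriv κ x w - Complex.I * projMinus κ x w -
        (2 * gramS κ x) • projPlusDeriv κ x w) x := by
  have he : HasDerivAt (fun x : ℝ => -(Complex.I * x) * Complex.exp (-(Complex.I * x * w)))
      (-Complex.I * Complex.exp (-(Complex.I * x * w)) + -(Complex.I * x) *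
        (-(Complex.I * w) * Complex.exp (-(Complex.I * x * w)))) x := by
    refine HasDerivAt.mul ?_ (hasDerivAt_exp_neg_width w x)
    have h : HasDerivAt (fun x : ℂ => -(Complex.I * x)) _ (x : ℂ) :=
      ((hasDerivAt_id (x : ℂ)).const_mul Complex.I).neg
    refine h.comp_ofReal.congr_deriv (by ring)
  refine (hasDerivAt_sub_sum_gramC hκ hx
    (k := fun x j => pwKernelDeriv x (trivialZeros κ j) w)
    (m := fun j => Complex.I * w * pwKernelDeriv x (trivialZeros κ j) w +
      Complex.I * pwKernel x (trivialZeros κ j) w)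
    (e₁ := fun x : ℝ => -(Complex.I * x) * Complex.exp (-(Complex.I * x * w)))
    (e₂ := fun x : ℝ => Complex.I * x * Complex.exp (Complex.I * x * w))
    (fun j => hasDerivAt_pwKernelDeriv_width κ x j w) (fun j => ?_) he).congr_deriv ?_
  · have := pwKernelDeriv_trivialZeros_mul κ x j w
    simp only [Complex.real_smul]
    linear_combination this
  · rw [projMinusDeriv, projPlusDeriv, projMinus]
    simp only [Complex.real_smul]
    have e : ∑ j, (gramC κ x j : ℂ) * (Complex.I * w * pwKernelDeriv x (trivialZeros κ j) w +
        Complex.I * pwKernel x (trivialZeros κ j) w) =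
        Complex.I * w * ∑ j, (gramC κ x j : ℂ) * pwKernelDeriv x (trivialZeros κ j) w +
          Complex.I * ∑ j, (gramC κ x j : ℂ) * pwKernel x (trivialZeros κ j) w := by
      rw [Finset.mul_sum, Finset.mul_sum, ← Finset.sum_add_distrib]
      exact Finset.sum_congr rfl fun j _ => by ring
    rw [e]
    ring

/-! ## The functional equation -/

/-- A Schur complement obtained by row elimination, with a solution y of yG = u in place of uG⁻¹. -/
theorem det_fromBlocks_of_vecMul_eq {m : ℕ} {G : Matrix (Fin m) (Fin m) ℂ} {u y k : Fin m → ℂ}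
    (hy : y ᵥ* G = u) (Q : ℂ) :
    (fromBlocks G (of fun i (_ : Unit) => k i) (of fun (_ : Unit) j => u j)
      (of fun (_ _ : Unit) => Q)).det = G.det * (Q - y ⬝ᵥ k) := by
  have h1 : (fromBlocks (1 : Matrix (Fin m) (Fin m) ℂ) (0 : Matrix (Fin m) Unit ℂ)
      (of fun (_ : Unit) j => -y j) (1 : Matrix Unit Unit ℂ)).det = 1 := by
    rw [det_fromBlocks_zero₁₂, det_one, det_one, one_mul]
  have h2 : fromBlocks (1 : Matrix (Fin m) (Fin m) ℂ) (0 : Matrix (Fin m) Unit ℂ)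
      (of fun (_ : Unit) j => -y j) (1 : Matrix Unit Unit ℂ) *
      fromBlocks G (of fun i (_ : Unit) => k i) (of fun (_ : Unit) j => u j)
        (of fun (_ _ : Unit) => Q) =
      fromBlocks G (of fun i (_ : Unit) => k i) 0 (of fun (_ _ : Unit) => Q - y ⬝ᵥ k) := by
    rw [fromBlocks_multiply]
    congr 1
    · simp
    · simp
    · ext i j
      have := congrFun hy j
      simp only [vecMul, dotProduct] at this
      simp [Matrix.mul_apply, this]
    · ext i j
      simp [Matrix.mul_apply, dotProduct]
      ring
  have h3 := congrArg det h2
  rw [det_mul, h1, one_mul, det_fromBlocks_zero₂₁] at h3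
  rw [h3]
  simp

/-- Row operations on one bordered matrix and column operations on the other give the same matrix:
the main block is (t + κ_i)G_ij + u_iu_j = (t - κ_j)G_ij + v_iv_j, the displacement equation, and
the borders are the relations for k and k'. The determinants of the elementary factors give the two
products, and P cancels. -/
theorem prod_mul_det_fromBlocks {m : ℕ} {G : Matrix (Fin m) (Fin m) ℂ} {κ u v k k' : Fin m → ℂ}
    {t P Q : ℂ} (hP : P ≠ 0)
    (hG : ∀ i j, (κ i + κ j) * G i j = v i * v j - u i * u j)
    (hk : ∀ j, (t - κ j) * k j = P * u j - Q * v j)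
    (hk' : ∀ j, (t + κ j) * k' j = P * v j - Q * u j) :
    (∏ j, (t + κ j)) * (fromBlocks G (of fun i (_ : Unit) => k' i) (of fun (_ : Unit) j => u j)
      (of fun (_ _ : Unit) => Q)).det =
    (∏ j, (t - κ j)) * (fromBlocks G (of fun i (_ : Unit) => v i) (of fun (_ : Unit) j => k j)
      (of fun (_ _ : Unit) => Q)).det := by
  have hd : ∀ d : Fin m → ℂ, (fromBlocks (diagonal d) (0 : Matrix (Fin m) Unit ℂ) 0
      (1 : Matrix Unit Unit ℂ)).det = ∏ j, d j := fun d => by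
    rw [det_fromBlocks_zero₁₂, det_diagonal, det_one, mul_one]
  have hP' : (fromBlocks (1 : Matrix (Fin m) (Fin m) ℂ) (0 : Matrix (Fin m) Unit ℂ) 0
      (of fun (_ _ : Unit) => P)).det = P := by
    rw [det_fromBlocks_zero₁₂, det_one, one_mul]
    simp
  have hu : (fromBlocks (1 : Matrix (Fin m) (Fin m) ℂ) (of fun i (_ : Unit) => u i) 0
      (1 : Matrix Unit Unit ℂ)).det = 1 := by
    rw [det_fromBlocks_zero₂₁, det_one, det_one, one_mul]
  have hv : (fromBlocks (1 : Matrix (Fin m) (Fin m) ℂ) 0 (of fun (_ : Unit) j => v j)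
      (1 : Matrix Unit Unit ℂ)).det = 1 := by
    rw [det_fromBlocks_zero₁₂, det_one, det_one, one_mul]
  have key : fromBlocks (1 : Matrix (Fin m) (Fin m) ℂ) (0 : Matrix (Fin m) Unit ℂ) 0
        (of fun (_ _ : Unit) => P) *
      (fromBlocks (1 : Matrix (Fin m) (Fin m) ℂ) (of fun i (_ : Unit) => u i) 0
        (1 : Matrix Unit Unit ℂ) *
      (fromBlocks (diagonal fun j => t + κ j) (0 : Matrix (Fin m) Unit ℂ) 0
        (1 : Matrix Unit Unit ℂ) *
      fromBlocks G (of fun i (_ : Unit) => k' i) (of fun (_ : Unit) j => u j)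
        (of fun (_ _ : Unit) => Q))) =
      ((fromBlocks G (of fun i (_ : Unit) => v i) (of fun (_ : Unit) j => k j)
        (of fun (_ _ : Unit) => Q) *
      fromBlocks (diagonal fun j => t - κ j) (0 : Matrix (Fin m) Unit ℂ) 0
        (1 : Matrix Unit Unit ℂ)) *
      fromBlocks (1 : Matrix (Fin m) (Fin m) ℂ) 0 (of fun (_ : Unit) j => v j)
        (1 : Matrix Unit Unit ℂ)) *
      fromBlocks (1 : Matrix (Fin m) (Fin m) ℂ) (0 : Matrix (Fin m) Unit ℂ) 0
        (of fun (_ _ : Unit) => P) := by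
    simp only [fromBlocks_multiply]
    congr 1
    · ext i j
      simp [Matrix.mul_apply, diagonal_apply]
      linear_combination hG i j
    · ext i j
      simp [Matrix.mul_apply, diagonal_apply]
      linear_combination hk' i
    · ext i j
      simp [Matrix.mul_apply, diagonal_apply]
      linear_combination -hk j
    · ext i j
      simp [Matrix.mul_apply]
      ring
  have h := congrArg det key
  simp only [det_mul, hd, hP', hu, hv, one_mul, mul_one] at h
  refine mul_left_cancel₀ hP (h.trans ?_)
  ring

theorem gramC_vecMul (hG : (expGram κ x).det ≠ 0) :
    (fun j => (gramC κ x j : ℂ)) ᵥ* (expGram κ x).map Complex.ofReal =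
      fun j => (gramU κ x j : ℂ) := by
  funext j
  have h := congrFun (expGram_mulVec_gramC hG) j
  rw [← h]
  simp only [vecMul, mulVec, dotProduct, Matrix.map_apply]
  push_cast
  exact Finset.sum_congr rfl fun i _ => by rw [expGram_symm, mul_comm]

theorem gramD_vecMul (hG : (expGram κ x).det ≠ 0) :
    (fun j => (gramD κ x j : ℂ)) ᵥ* (expGram κ x).map Complex.ofReal =
      fun j => (gramV κ x j : ℂ) := by
  funext j
  have h := congrFun (expGram_mulVec_gramD hG) j
  rw [← h]
  simp only [vecMul, mulVec, dotProduct, Matrix.map_apply]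
  push_cast
  exact Finset.sum_congr rfl fun i _ => by rw [expGram_symm, mul_comm]

/-- The determinant identity at t = -iw, P = exp(-ixw), Q = exp(ixw): by Schur complements the two
bordered determinants are det G · A(-w) and det G · B(w), where A = `projMinus` and B = `projPlus`.
The relations for k' are those for k at -w. -/
theorem prod_mul_projMinus_neg (hG : (expGram κ x).det ≠ 0) (w : ℂ) :
    (∏ j, (w - trivialZeros κ j)) * projMinus κ x (-w) =
      (-1) ^ n * (∏ j, (-w - trivialZeros κ j)) * projPlus κ x w := by
  have hGc : ((expGram κ x).map Complex.ofReal).det ≠ 0 := by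
    have : ((expGram κ x).map Complex.ofReal).det = ((expGram κ x).det : ℂ) :=
      (RingHom.map_det Complex.ofRealHom (expGram κ x)).symm
    rw [this]
    exact_mod_cast hG
  have h := prod_mul_det_fromBlocks (G := (expGram κ x).map Complex.ofReal)
    (κ := fun j => (κ j : ℂ)) (u := fun j => (gramU κ x j : ℂ)) (v := fun j => (gramV κ x j : ℂ))
    (k := fun j => pwKernel x (trivialZeros κ j) w)
    (k' := fun j => pwKernel x (trivialZeros κ j) (-w))
    (t := -(Complex.I * w)) (P := Complex.exp (-(Complex.I * x * w)))
    (Q := Complex.exp (Complex.I * x * w)) (Complex.exp_ne_zero _)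
    (fun i j => by
      have := add_mul_expGram (κ := κ) (x := x) i j
      rw [Matrix.map_apply]
      exact_mod_cast this)
    (fun j => by linear_combination -pwKernel_trivialZeros_mul κ x j w)
    (fun j => by
      have := pwKernel_trivialZeros_mul κ x j (-w)
      simp only [mul_neg, neg_neg] at this
      linear_combination this)
  have ht : (fromBlocks ((expGram κ x).map Complex.ofReal)
      (of fun i (_ : Unit) => (gramV κ x i : ℂ))
      (of fun (_ : Unit) j => pwKernel x (trivialZeros κ j) w)
      (of fun (_ _ : Unit) => Complex.exp (Complex.I * x * w))).det =
      (fromBlocks ((expGram κ x).map Complex.ofReal)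
      (of fun i (_ : Unit) => pwKernel x (trivialZeros κ i) w)
      (of fun (_ : Unit) j => (gramV κ x j : ℂ))
      (of fun (_ _ : Unit) => Complex.exp (Complex.I * x * w))).det := by
    rw [← det_transpose, fromBlocks_transpose, ← transpose_map, expGram_transpose]
    rfl
  rw [ht, det_fromBlocks_of_vecMul_eq (gramC_vecMul hG),
    det_fromBlocks_of_vecMul_eq (gramD_vecMul hG)] at h
  have eA : projMinus κ x (-w) = Complex.exp (Complex.I * x * w) -
      (fun j => (gramC κ x j : ℂ)) ⬝ᵥ fun j => pwKernel x (trivialZeros κ j) (-w) := by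
    rw [projMinus, mul_neg, neg_neg]
    simp only [Complex.real_smul, dotProduct]
  have eB : projPlus κ x w = Complex.exp (Complex.I * x * w) -
      (fun j => (gramD κ x j : ℂ)) ⬝ᵥ fun j => pwKernel x (trivialZeros κ j) w := by
    rw [projPlus]
    simp only [Complex.real_smul, dotProduct]
  rw [← eA, ← eB] at h
  have h' : (∏ j, (-(Complex.I * w) + κ j)) * projMinus κ x (-w) =
      (∏ j, (-(Complex.I * w) - κ j)) * projPlus κ x w := mul_left_cancel₀ hGc (by
    linear_combination h)
  have e1 : ∏ j, (-(Complex.I * w) + κ j) =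
      (-Complex.I) ^ n * ∏ j, (w - trivialZeros κ j) := by
    have : ∀ j, -(Complex.I * w) + κ j = -Complex.I * (w - trivialZeros κ j) := fun j => by
      rw [trivialZeros]; linear_combination (κ j : ℂ) * Complex.I_mul_I
    simp only [this, Finset.prod_mul_distrib, Finset.prod_const, Finset.card_univ,
      Fintype.card_fin]
  have e2 : ∏ j, (-(Complex.I * w) - κ j) =
      (-Complex.I) ^ n * ((-1) ^ n * ∏ j, (-w - trivialZeros κ j)) := by
    have : ∀ j, -(Complex.I * w) - κ j = -Complex.I * (-1 * (-w - trivialZeros κ j)) := fun j => by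
      rw [trivialZeros]; linear_combination -(κ j : ℂ) * Complex.I_mul_I
    simp only [this, Finset.prod_mul_distrib, Finset.prod_const, Finset.card_univ,
      Fintype.card_fin]
  rw [e1, e2] at h'
  have hI : (-Complex.I) ^ n ≠ 0 := pow_ne_zero _ (neg_ne_zero.2 Complex.I_ne_zero)
  exact mul_left_cancel₀ hI (by linear_combination h')

end generator

end

section

open Matrix

/-! ## Nonvanishing elements of the modified spaces -/

theorem mul_mem_paleyWienerSubmodule {a δ C : ℝ} {f g : ℂ → ℂ} (hf : f ∈ paleyWienerSubmodule a)
    (hδ : 0 ≤ δ) (hg : Differentiable ℂ g) (hC : ∀ w, ‖g w‖ ≤ C * Real.exp (δ * |w.im|)) :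
    (fun w => g w * f w) ∈ paleyWienerSubmodule (a + δ) := by
  have hC0 : 0 ≤ C := by
    have := (norm_nonneg _).trans (hC 0)
    simpa using this
  refine ⟨hg.mul hf.1, fun ε hε => ?_, ?_⟩
  · obtain ⟨C', hC'⟩ := hf.2.1 ε hε
    refine ⟨C * C', fun w => ?_⟩
    have hC'0 : 0 ≤ C' * Real.exp ((a + ε) * ‖w‖) := (norm_nonneg _).trans (hC' w)
    calc ‖g w * f w‖ = ‖g w‖ * ‖f w‖ := norm_mul _ _
      _ ≤ (C * Real.exp (δ * ‖w‖)) * (C' * Real.exp ((a + ε) * ‖w‖)) := by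
        refine mul_le_mul ((hC w).trans ?_) (hC' w) (norm_nonneg _) (by positivity)
        gcongr
        exact Complex.abs_im_le_norm w
      _ = C * C' * Real.exp ((a + δ + ε) * ‖w‖) := by
        rw [show (a + δ + ε) * ‖w‖ = δ * ‖w‖ + (a + ε) * ‖w‖ by ring, Real.exp_add]
        ring
  · refine MemLp.of_le_mul (c := C) hf.2.2 ?_ (Eventually.of_forall fun t => ?_)
    · exact ((hg.continuous.mul hf.1.continuous).comp
        Complex.continuous_ofReal).aestronglyMeasurable
    · have := hC t
      rw [Complex.ofReal_im, abs_zero, mul_zero, Real.exp_zero, mul_one] at this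
      rw [norm_mul]
      exact mul_le_mul_of_nonneg_right this (norm_nonneg _)

/-- The kernel decays like 1/w along horizontal lines, which absorbs one linear factor at the cost
of type δ. -/
theorem norm_sub_mul_pwKernel_le {δ : ℝ} (hδ : 0 ≤ δ) (ζ w : ℂ) :
    ‖(w - ζ) * pwKernel δ 0 w‖ ≤ (2 + ‖ζ‖ * (2 * δ)) * Real.exp (δ * |w.im|) := by
  have h1 := pwKernel_mul δ 0 w
  rw [map_zero, zero_sub] at h1
  have h2 := norm_pwKernel_le hδ 0 w
  rw [map_zero, zero_sub, Complex.neg_im, abs_neg] at h2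
  have h3 : ‖w * pwKernel δ 0 w‖ ≤ 2 * Real.exp (δ * |w.im|) := by
    have e : ‖w * pwKernel δ 0 w‖ = ‖Complex.I * -w * pwKernel δ 0 w‖ := by simp
    rw [e, h1]
    refine (norm_sub_le _ _).trans ?_
    rw [Complex.norm_exp, Complex.norm_exp, two_mul]
    have hre : (Complex.I * δ * -w).re = δ * w.im := by simp
    rw [Complex.neg_re, hre]
    have := le_abs_self w.im
    have := neg_abs_le w.im
    gcongr
    nlinarith
  calc ‖(w - ζ) * pwKernel δ 0 w‖ = ‖w * pwKernel δ 0 w - ζ * pwKernel δ 0 w‖ := by rw [sub_mul]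
    _ ≤ ‖w * pwKernel δ 0 w‖ + ‖ζ‖ * ‖pwKernel δ 0 w‖ := by
      rw [← norm_mul]; exact norm_sub_le _ _
    _ ≤ 2 * Real.exp (δ * |w.im|) + ‖ζ‖ * (2 * δ * Real.exp (δ * |w.im|)) := by gcongr
    _ = _ := by ring

/-- The witness is the power k^{n+1} of the kernel k at 0 for width x/(n + 1): each of n copies
absorbs one factor w - z_j, the last one supplies square integrability, and the types add up to x.
On the imaginary axis k is an integral of positive exponentials. -/
theorem PaleyWienerMod.exists_apply_ne_zero {x : ℝ} (hx : 0 < x) {n : ℕ} (z : Fin n → ℂ) (t : ℝ) :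
    ∃ F : PaleyWienerMod x z, F (Complex.I * t) ≠ 0 := by
  set δ : ℝ := x / (n + 1) with hδ
  have hδ0 : 0 < δ := by positivity
  have hmem : ∀ S : Finset (Fin n), (fun w => (∏ j ∈ S, ((w - z j) * pwKernel δ 0 w)) *
      pwKernel δ 0 w) ∈ paleyWienerSubmodule (δ + S.card * δ) := by
    intro S
    induction S using Finset.induction_on with
    | empty => simpa using pwKernel_mem hδ0.le 0
    | insert j S hj ih =>
      have := mul_mem_paleyWienerSubmodule ih hδ0.le
        (g := fun w => (w - z j) * pwKernel δ 0 w)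
        ((differentiable_id.sub_const _).mul (differentiable_pwKernel δ 0))
        (norm_sub_mul_pwKernel_le hδ0.le (z j))
      rw [Finset.card_insert_of_notMem hj]
      convert this using 1
      · congr 1
        push_cast; ring
      · funext w
        rw [Finset.prod_insert hj, mul_assoc]
  have h := hmem Finset.univ
  rw [Finset.card_univ, Fintype.card_fin, show δ + n * δ = x by rw [hδ]; field_simp; ring] at h
  have hd : Differentiable ℂ fun w => pwKernel δ 0 w ^ n * pwKernel δ 0 w :=
    ((differentiable_pwKernel δ 0).pow n).mul (differentiable_pwKernel δ 0)
  refine ⟨⟨fun w => pwKernel δ 0 w ^ n * pwKernel δ 0 w, hd, _, h, fun j => ?_, fun w hw => ?_⟩, ?_⟩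
  · rw [Finset.prod_eq_zero (Finset.mem_univ j) (by rw [sub_self, zero_mul]), zero_mul]
  · have hp : ∏ j, (w - z j) ≠ 0 := Finset.prod_ne_zero_iff.2 fun j _ => sub_ne_zero.2 (hw j)
    rw [Finset.prod_mul_distrib, Finset.prod_const, Finset.card_univ, Fintype.card_fin, mul_assoc,
      mul_div_cancel_left₀ _ hp]
  · have hk : pwKernel δ 0 (Complex.I * t) = ((∫ y in (-δ)..δ, Real.exp (y * t) : ℝ) : ℂ) := by
      rw [pwKernel, ← intervalIntegral.integral_ofReal]
      congr 1
      ext y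
      rw [Complex.ofReal_exp]
      congr 1
      rw [map_zero]
      push_cast
      linear_combination (-(y : ℂ) * t) * Complex.I_mul_I
    have hpos : 0 < ∫ y in (-δ)..δ, Real.exp (y * t) :=
      intervalIntegral.intervalIntegral_pos_of_pos
        (Continuous.intervalIntegrable (by fun_prop) _ _) (fun y => Real.exp_pos _) (by linarith)
    have hk0 : pwKernel δ 0 (Complex.I * t) ≠ 0 := by
      rw [hk]; exact_mod_cast hpos.ne'
    exact mul_ne_zero (pow_ne_zero _ hk0) hk0

/-! ## The generating function -/

section generator

variable {n : ℕ} {κ : Fin n → ℝ} {x : ℝ}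

theorem exists_kernelGen (hκ : Function.Injective κ) (hx : 0 < x) :
    ∃ E : ℂ → ℂ, Differentiable ℂ E ∧
      ∀ w, Complex.I ^ n * projMinus κ x w = (∏ j, (w - trivialZeros κ j)) * E w :=
  exists_entire_eq_prod_mul (trivialZeros_injective hκ)
    ((differentiable_projMinus κ x).const_mul _) fun j => by
    rw [projMinus_trivialZeros (expGram_det_pos hκ hx).ne', mul_zero]

open scoped Classical in
/-- The entire function `i ^ n A / ∏ j, (w - z_j)` where `A = projMinus κ x`. -/
noncomputable def kernelGen {n : ℕ} (κ : Fin n → ℝ) (x : ℝ) : ℂ → ℂ :=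
  if h : Function.Injective κ ∧ 0 < x then (exists_kernelGen h.1 h.2).choose else 0

theorem differentiable_kernelGen (hκ : Function.Injective κ) (hx : 0 < x) :
    Differentiable ℂ (kernelGen κ x) := by
  rw [kernelGen, dif_pos ⟨hκ, hx⟩]
  exact (exists_kernelGen hκ hx).choose_spec.1

theorem prod_mul_kernelGen (hκ : Function.Injective κ) (hx : 0 < x) (w : ℂ) :
    (∏ j, (w - trivialZeros κ j)) * kernelGen κ x w = Complex.I ^ n * projMinus κ x w := by
  rw [kernelGen, dif_pos ⟨hκ, hx⟩]
  exact ((exists_kernelGen hκ hx).choose_spec.2 w).symm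

/-- So E(-w) stands to `projPlus` as E(w) does to `projMinus`. The functional equation yields this
after multiplication by ∏(w + z_j), and continuity removes that factor. -/
theorem prod_mul_kernelGen_neg (hκ : Function.Injective κ) (hx : 0 < x) (w : ℂ) :
    (∏ j, (w - trivialZeros κ j)) * kernelGen κ x (-w) =
      (-1) ^ n * Complex.I ^ n * projPlus κ x w := by
  have hE := differentiable_kernelGen hκ hx
  have h : (fun w => (∏ j, (w - trivialZeros κ j)) * kernelGen κ x (-w)) =
      fun w => (-1) ^ n * Complex.I ^ n * projPlus κ x w := by
    refine eq_of_prod_sub_mul_eq (fun j => -trivialZeros κ j) ?_ ?_ fun w => ?_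
    · exact (continuous_finsetProd _ fun j _ => by fun_prop).mul
        (hE.continuous.comp continuous_neg)
    · exact continuous_const.mul (differentiable_projPlus κ x).continuous
    · have h1 := prod_mul_kernelGen hκ hx (-w)
      have h2 := prod_mul_projMinus_neg (expGram_det_pos hκ hx).ne' w
      have h3 : ∏ j, (w - -trivialZeros κ j) = (-1) ^ n * ∏ j, (-w - trivialZeros κ j) := by
        have : ∀ j, w - -trivialZeros κ j = -1 * (-w - trivialZeros κ j) := fun j => by ring
        simp only [this, Finset.prod_mul_distrib, Finset.prod_const, Finset.card_univ,
          Fintype.card_fin]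
      have h4 : ((-1 : ℂ) ^ n) * (-1) ^ n = 1 := by rw [← mul_pow]; simp
      rw [h3]
      linear_combination (-1) ^ n * (∏ j, (w - trivialZeros κ j)) * h1 +
        (-1) ^ n * Complex.I ^ n * h2
  exact congrFun h w

theorem conj_projMinus_conj (w : ℂ) : conj (projMinus κ x (conj w)) = projMinus κ x (-w) := by
  have hk : ∀ j, conj (pwKernel x (trivialZeros κ j) (conj w)) =
      pwKernel x (trivialZeros κ j) (-w) := fun j => by
    rw [pwKernel, ← intervalIntegral.intervalIntegral_conj, pwKernel]
    congr 1
    ext y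
    rw [← Complex.exp_conj]
    congr 1
    simp [trivialZeros]
    ring
  rw [projMinus, projMinus, map_sub, map_sum, ← Complex.exp_conj]
  congr 1
  · congr 1
    simp
  · refine Finset.sum_congr rfl fun j _ => ?_
    rw [Complex.real_smul, Complex.real_smul, map_mul, Complex.conj_ofReal, hk]

theorem conj_kernelGen_conj (hκ : Function.Injective κ) (hx : 0 < x) (w : ℂ) :
    conj (kernelGen κ x (conj w)) = kernelGen κ x (-w) := by
  have hE := differentiable_kernelGen hκ hx
  have h : (fun w => conj (kernelGen κ x (conj w))) = fun w => kernelGen κ x (-w) := by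
    refine eq_of_prod_sub_mul_eq (fun j => -trivialZeros κ j) ?_ ?_ fun w => ?_
    · exact Complex.continuous_conj.comp (hE.continuous.comp Complex.continuous_conj)
    · exact hE.continuous.comp continuous_neg
    · have h1 := congrArg conj (prod_mul_kernelGen hκ hx (conj w))
      have h2 := prod_mul_kernelGen hκ hx (-w)
      have hp : conj (∏ j, (conj w - trivialZeros κ j)) = ∏ j, (w - -trivialZeros κ j) := by
        rw [map_prod]
        refine Finset.prod_congr rfl fun j _ => ?_
        rw [map_sub, Complex.conj_conj, conj_trivialZeros, trivialZeros]
        ring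
      have h3 : ∏ j, (w - -trivialZeros κ j) = (-1) ^ n * ∏ j, (-w - trivialZeros κ j) := by
        have : ∀ j, w - -trivialZeros κ j = -1 * (-w - trivialZeros κ j) := fun j => by ring
        simp only [this, Finset.prod_mul_distrib, Finset.prod_const, Finset.card_univ,
          Fintype.card_fin]
      rw [map_mul, map_mul, hp, conj_projMinus_conj, map_pow, Complex.conj_I, neg_pow] at h1
      rw [h1, h3]
      linear_combination -(-1) ^ n * h2
  exact congrFun h w

/-! ## The differential equation in the width -/

/-- Away from the z_j this is the equation of `projMinus` divided by the product, with
`prod_mul_kernelGen_neg` turning `projPlus` into E(-w) up to sign. -/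
theorem hasDerivAt_kernelGen_width (hκ : Function.Injective κ) (hx : 0 < x) (w : ℂ) :
    HasDerivAt (fun x => kernelGen κ x w)
      (-(Complex.I * w) * kernelGen κ x w -
        (2 * (-1) ^ n * gramS κ x : ℝ) * kernelGen κ x (-w)) x := by
  have hsq : ((-1 : ℂ) ^ n) * (-1) ^ n = 1 := by rw [← mul_pow]; simp
  by_cases hw : ∀ j, w ≠ trivialZeros κ j
  · have hp : ∏ j, (w - trivialZeros κ j) ≠ 0 :=
      Finset.prod_ne_zero_iff.2 fun j _ => sub_ne_zero.2 (hw j)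
    have h := ((hasDerivAt_projMinus_width hκ hx w).const_mul (Complex.I ^ n)).const_mul
      (∏ j, (w - trivialZeros κ j))⁻¹
    have e : ∀ᶠ x in 𝓝 x, kernelGen κ x w =
        (∏ j, (w - trivialZeros κ j))⁻¹ * (Complex.I ^ n * projMinus κ x w) := by
      filter_upwards [lt_mem_nhds hx] with y hy
      rw [← prod_mul_kernelGen hκ hy, inv_mul_cancel_left₀ hp]
    refine (h.congr_of_eventuallyEq e).congr_deriv ?_
    refine mul_left_cancel₀ hp ?_
    rw [mul_inv_cancel_left₀ hp, Complex.real_smul]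
    push_cast
    linear_combination Complex.I * w * prod_mul_kernelGen hκ hx w +
      2 * (-1) ^ n * gramS κ x * prod_mul_kernelGen_neg hκ hx w +
      2 * gramS κ x * Complex.I ^ n * projPlus κ x w * hsq
  -- At w = z_m the quotient is a derivative: E(z_m) is iⁿ times `projMinusDeriv` at z_m over the
  -- product of the other factors. The extra term -i · `projMinus` in the equation of
  -- `projMinusDeriv` vanishes there.
  · push Not at hw
    obtain ⟨m, rfl⟩ := hw
    set ζ := trivialZeros κ m with hζ
    set P : ℂ := ∏ j ∈ Finset.univ.erase m, (ζ - trivialZeros κ j) with hP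
    have hP0 : P ≠ 0 := Finset.prod_ne_zero_iff.2 fun j hj => sub_ne_zero.2 fun h =>
      Finset.ne_of_mem_erase hj (trivialZeros_injective hκ h).symm
    have hpd : ∀ (f : ℂ → ℂ), Differentiable ℂ f →
        HasDerivAt (fun w => (∏ j, (w - trivialZeros κ j)) * f w) (P * f ζ) ζ := fun f hf => by
      have h1 : HasDerivAt (fun w : ℂ => (w - trivialZeros κ m) *
          ((∏ j ∈ Finset.univ.erase m, (w - trivialZeros κ j)) * f w)) _ ζ :=
        ((hasDerivAt_id ζ).sub_const _).mul (DifferentiableAt.hasDerivAt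
          (f := fun w => (∏ j ∈ Finset.univ.erase m, (w - trivialZeros κ j)) * f w)
          ((DifferentiableAt.fun_finsetProd fun j _ => by fun_prop).mul hf.differentiableAt))
      have e : (fun w => (∏ j, (w - trivialZeros κ j)) * f w) =
          fun w : ℂ => (w - trivialZeros κ m) *
          ((∏ j ∈ Finset.univ.erase m, (w - trivialZeros κ j)) * f w) := by
        funext w
        rw [← Finset.mul_prod_erase _ _ (Finset.mem_univ m), mul_assoc]
      rw [e]
      refine h1.congr_deriv ?_
      simp only [id, ← hζ, sub_self, zero_mul, add_zero, one_mul, hP]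
    have hA : ∀ y, 0 < y → P * kernelGen κ y ζ = Complex.I ^ n * projMinusDeriv κ y ζ := by
      intro y hy
      have h1 := hpd _ (differentiable_kernelGen hκ hy)
      simp only [prod_mul_kernelGen hκ hy] at h1
      exact h1.unique ((hasDerivAt_projMinus κ y ζ).const_mul _)
    have hB : P * kernelGen κ x (-ζ) = (-1) ^ n * Complex.I ^ n * projPlusDeriv κ x ζ := by
      have h1 := hpd (fun w => kernelGen κ x (-w))
        ((differentiable_kernelGen hκ hx).comp differentiable_neg)
      simp only [prod_mul_kernelGen_neg hκ hx] at h1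
      exact h1.unique ((hasDerivAt_projPlus κ x ζ).const_mul _)
    have h := ((hasDerivAt_projMinusDeriv_width hκ hx ζ).const_mul (Complex.I ^ n)).const_mul P⁻¹
    have e : ∀ᶠ x in 𝓝 x, kernelGen κ x ζ =
        P⁻¹ * (Complex.I ^ n * projMinusDeriv κ x ζ) := by
      filter_upwards [lt_mem_nhds hx] with y hy
      rw [← hA y hy, inv_mul_cancel_left₀ hP0]
    refine (h.congr_of_eventuallyEq e).congr_deriv ?_
    refine mul_left_cancel₀ hP0 ?_
    rw [mul_inv_cancel_left₀ hP0, Complex.real_smul, hζ,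
      projMinus_trivialZeros (expGram_det_pos hκ hx).ne', ← hζ]
    push_cast
    linear_combination Complex.I * ζ * hA x hx + 2 * (-1) ^ n * gramS κ x * hB +
      2 * gramS κ x * Complex.I ^ n * projPlusDeriv κ x ζ * hsq

end generator

end

section

open Matrix

section generator

variable {n : ℕ} {κ : Fin n → ℝ} {x : ℝ}

/-! ## The kernel formula -/

theorem sum_inv_expGram_mul (hG : (expGram κ x).det ≠ 0) (l k : Fin n → ℂ) :
    ∑ i, ∑ j, ((expGram κ x)⁻¹ i j : ℂ) * ((κ i + κ j) * (l i * k j)) =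
      (∑ i, gramD κ x i * l i) * ∑ j, gramD κ x j * k j -
        (∑ i, gramC κ x i * l i) * ∑ j, gramC κ x j * k j := by
  simp only [Finset.sum_mul_sum, ← Finset.sum_sub_distrib]
  refine Finset.sum_congr rfl fun i _ => Finset.sum_congr rfl fun j _ => ?_
  have h : ((κ i : ℂ) + κ j) * ((expGram κ x)⁻¹ i j : ℂ) =
      gramD κ x i * gramD κ x j - gramC κ x i * gramC κ x j := by
    exact_mod_cast inv_expGram_commutator hG i j
  linear_combination l i * k j * h

theorem sum_inv_expGram_row (w : Fin n → ℝ) (k : Fin n → ℂ) :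
    ∑ i, ∑ j, ((expGram κ x)⁻¹ i j : ℂ) * (w i * k j) =
      ∑ j, (((expGram κ x)⁻¹ *ᵥ w) j : ℂ) * k j := by
  rw [Finset.sum_comm]
  refine Finset.sum_congr rfl fun j _ => ?_
  simp only [mulVec, dotProduct, Complex.ofReal_sum, Finset.sum_mul]
  refine Finset.sum_congr rfl fun i _ => ?_
  rw [← inv_expGram_transpose, transpose_apply, inv_expGram_transpose]
  push_cast
  ring

theorem sum_inv_expGram_col (w : Fin n → ℝ) (l : Fin n → ℂ) :
    ∑ i, ∑ j, ((expGram κ x)⁻¹ i j : ℂ) * (l i * w j) =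
      ∑ i, (((expGram κ x)⁻¹ *ᵥ w) i : ℂ) * l i := by
  refine Finset.sum_congr rfl fun i _ => ?_
  simp only [mulVec, dotProduct, Complex.ofReal_sum, Finset.sum_mul]
  refine Finset.sum_congr rfl fun j _ => ?_
  push_cast
  ring

/-- The orthogonal projection of the evaluator of the Paley-Wiener space onto the functions
vanishing at the trivial zeros. -/
noncomputable def projKernel (κ : Fin n → ℝ) (x : ℝ) (z w : ℂ) : ℂ :=
  pwKernel x z w - ∑ i, ∑ j, ((expGram κ x)⁻¹ i j : ℂ) *
    (conj (pwKernel x (trivialZeros κ i) z) * pwKernel x (trivialZeros κ j) w)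

theorem conj_exp_neg (z : ℂ) : conj (Complex.exp (-(Complex.I * x * z))) =
    Complex.exp (Complex.I * x * conj z) := by
  rw [← Complex.exp_conj]; congr 1; simp

theorem conj_exp_pos (z : ℂ) : conj (Complex.exp (Complex.I * x * z)) =
    Complex.exp (-(Complex.I * x * conj z)) := by
  rw [← Complex.exp_conj]; congr 1; simp

/-- With G⁻¹ subjected to `inv_expGram_commutator`, the double sum breaks into products of the sums
occurring in `projMinus` and `projPlus`, and the four products with exponentials complete the
factorization. -/
theorem mul_projKernel (hG : (expGram κ x).det ≠ 0) (z w : ℂ) :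
    Complex.I * (conj z - w) * projKernel κ x z w =
      conj (projMinus κ x z) * projMinus κ x w - conj (projPlus κ x z) * projPlus κ x w := by
  set l : Fin n → ℂ := fun i => conj (pwKernel x (trivialZeros κ i) z) with hl
  set k : Fin n → ℂ := fun j => pwKernel x (trivialZeros κ j) w with hk
  set Em := Complex.exp (Complex.I * x * conj z) with hEm
  set Ep := Complex.exp (-(Complex.I * x * conj z)) with hEp
  set em := Complex.exp (-(Complex.I * x * w)) with hem
  set ep := Complex.exp (Complex.I * x * w) with hep
  have hlr : ∀ i, (κ i - Complex.I * conj z) * l i = gramV κ x i * Ep - gramU κ x i * Em := by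
    intro i
    have := congrArg conj (pwKernel_trivialZeros_mul κ x i z)
    simp only [map_mul, map_add, map_sub, Complex.conj_ofReal, Complex.conj_I, conj_exp_neg,
      conj_exp_pos] at this
    linear_combination this
  have hkr : ∀ j, (κ j + Complex.I * w) * k j = gramV κ x j * ep - gramU κ x j * em := fun j =>
    pwKernel_trivialZeros_mul κ x j w
  have h1 : Complex.I * (conj z - w) * pwKernel x z w = Em * em - Ep * ep := by
    rw [pwKernel_mul, hEm, hem, hEp, hep, ← Complex.exp_add, ← Complex.exp_add]
    ring_nf
  -- The splitting i(conj z - w) = (κ_i + κ_j) - (κ_i - i conj z) - (κ_j + iw), each of the last two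
  -- brackets being absorbed by one of the kernels.
  have h2 : Complex.I * (conj z - w) * ∑ i, ∑ j, ((expGram κ x)⁻¹ i j : ℂ) * (l i * k j) =
      (∑ i, ∑ j, ((expGram κ x)⁻¹ i j : ℂ) * ((κ i + κ j) * (l i * k j))) -
      Ep * (∑ i, ∑ j, ((expGram κ x)⁻¹ i j : ℂ) * (gramV κ x i * k j)) +
      Em * (∑ i, ∑ j, ((expGram κ x)⁻¹ i j : ℂ) * (gramU κ x i * k j)) -
      ep * (∑ i, ∑ j, ((expGram κ x)⁻¹ i j : ℂ) * (l i * gramV κ x j)) +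
      em * (∑ i, ∑ j, ((expGram κ x)⁻¹ i j : ℂ) * (l i * gramU κ x j)) := by
    simp only [Finset.mul_sum, ← Finset.sum_sub_distrib, ← Finset.sum_add_distrib]
    refine Finset.sum_congr rfl fun i _ => Finset.sum_congr rfl fun j _ => ?_
    linear_combination -((expGram κ x)⁻¹ i j : ℂ) * k j * hlr i -
      ((expGram κ x)⁻¹ i j : ℂ) * l i * hkr j
  rw [projKernel, mul_sub, h1, h2, sum_inv_expGram_mul hG, sum_inv_expGram_row,
    sum_inv_expGram_row, sum_inv_expGram_col, sum_inv_expGram_col]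
  simp only [projMinus, projPlus, map_sub, map_sum, conj_exp_neg, conj_exp_pos, Complex.real_smul,
    map_mul, Complex.conj_ofReal]
  change _ = (Em - ∑ i, gramC κ x i * l i) * (em - ∑ j, gramC κ x j * k j) -
    (Ep - ∑ i, gramD κ x i * l i) * (ep - ∑ j, gramD κ x j * k j)
  simp only [gramC, gramD]
  ring

theorem PaleyWiener.sum_apply {ι : Type*} (S : Finset ι) (f : ι → PaleyWiener x) (w : ℂ) :
    (∑ i ∈ S, f i) w = ∑ i ∈ S, f i w := by
  classical
  induction S using Finset.induction_on with
  | empty => rfl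
  | insert i S hi ih => rw [Finset.sum_insert hi, Finset.sum_insert hi, ← ih]; rfl

/-- The corrected evaluator H vanishes on σ and reproduces f(z) for every f vanishing on σ. Under
the isometry f = ∏(w - z_j)F, the value f(z) is ∏(z - z_j)F(z), so H comes from conj(∏(z - z_j))
K_z. -/
theorem projKernel_eq_of_evaluator (hκ : Function.Injective κ) (hx : 0 < x)
    {K : ℂ → PaleyWienerMod x (trivialZeros κ)}
    (hK : ∀ z (F : PaleyWienerMod x (trivialZeros κ)), inner ℂ (K z) F = F z) (z w : ℂ) :
    projKernel κ x z w =
      conj (∏ j, (z - trivialZeros κ j)) * ((∏ j, (w - trivialZeros κ j)) * K z w) := by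
  set H : PaleyWiener x := PaleyWiener.evaluator hx.le z -
    ∑ i, ∑ j, (((expGram κ x)⁻¹ i j : ℂ) * conj (pwKernel x (trivialZeros κ i) z)) •
      PaleyWiener.evaluator hx.le (trivialZeros κ j) with hH
  have happ : ∀ w, H w = projKernel κ x z w := fun w => by
    rw [hH, PaleyWiener.sub_apply, PaleyWiener.sum_apply, projKernel]
    simp only [PaleyWiener.sum_apply, PaleyWiener.smul_apply, PaleyWiener.evaluator_apply,
      mul_assoc]
  have hG := (expGram_det_pos hκ hx).ne'
  have hzero : ∀ m, H (trivialZeros κ m) = 0 := fun m => by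
    rw [happ, projKernel, sub_eq_zero, ← conj_pwKernel_symm x (trivialZeros κ m) z]
    simp only [pwKernel_trivialZeros_trivialZeros]
    have h1 : ∀ i, ∑ j, ((expGram κ x)⁻¹ i j : ℂ) *
        (conj (pwKernel x (trivialZeros κ i) z) * (expGram κ x j m : ℂ)) =
        if i = m then conj (pwKernel x (trivialZeros κ i) z) else 0 := fun i => by
      have h2 : ∑ j, ((expGram κ x)⁻¹ i j : ℂ) * (expGram κ x j m : ℂ) =
          if i = m then 1 else 0 := by
        have := congrFun (congrFun (Matrix.nonsing_inv_mul _ (Ne.isUnit hG)) i) m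
        rw [Matrix.mul_apply, Matrix.one_apply] at this
        have h3 := congrArg (Complex.ofReal) this
        push_cast at h3
        rw [h3]
        split_ifs <;> simp
      have h4 : ∑ j, ((expGram κ x)⁻¹ i j : ℂ) *
          (conj (pwKernel x (trivialZeros κ i) z) * (expGram κ x j m : ℂ)) =
          conj (pwKernel x (trivialZeros κ i) z) *
          ∑ j, ((expGram κ x)⁻¹ i j : ℂ) * (expGram κ x j m : ℂ) := by
        rw [Finset.mul_sum]
        exact Finset.sum_congr rfl fun j _ => by ring
      rw [h4, h2, mul_ite, mul_one, mul_zero]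
    simp only [h1, Finset.sum_ite_eq', Finset.mem_univ, if_true]
  have hrange := PaleyWienerMod.range_incomplete (x := x) (trivialZeros_injective hκ)
  obtain ⟨F, hF⟩ : H ∈ Set.range (PaleyWienerMod.incomplete (x := x) (z := trivialZeros κ)) := by
    rw [hrange]; exact hzero
  have hinner : ∀ f : PaleyWienerMod x (trivialZeros κ),
      inner ℂ H (PaleyWienerMod.incomplete f) = PaleyWienerMod.incomplete f z := fun f => by
    rw [hH, inner_sub_left, PaleyWiener.inner_evaluator, sum_inner]
    simp only [sum_inner, inner_smul_left, PaleyWiener.inner_evaluator,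
      PaleyWienerMod.incomplete_apply_zero, mul_zero, Finset.sum_const_zero, sub_zero]
  have hFK : F = conj (∏ j, (z - trivialZeros κ j)) • K z := by
    refine ext_inner_right ℂ fun f => ?_
    rw [PaleyWienerMod.inner_def, hF, hinner, inner_smul_left, hK, Complex.conj_conj,
      PaleyWienerMod.incomplete_apply]
  rw [← happ, ← hF, hFK, map_smul, PaleyWiener.smul_apply, PaleyWienerMod.incomplete_apply]

/-- The identity for the projected kernel carries the factors conj p(z) and p(w), p(w) = ∏(w - z_j).
They are removed by density, first in w and then in z; continuity in z comes from K_z(w) = conj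
K_w(z). -/
theorem mul_evaluator_eq (hκ : Function.Injective κ) (hx : 0 < x)
    {K : ℂ → PaleyWienerMod x (trivialZeros κ)}
    (hK : ∀ z (F : PaleyWienerMod x (trivialZeros κ)), inner ℂ (K z) F = F z) (z w : ℂ) :
    Complex.I * (conj z - w) * K z w = conj (kernelGen κ x z) * kernelGen κ x w -
      conj (kernelGen κ x (-z)) * kernelGen κ x (-w) := by
  have hG := (expGram_det_pos hκ hx).ne'
  have hE := differentiable_kernelGen hκ hx
  set p : ℂ → ℂ := fun w => ∏ j, (w - trivialZeros κ j) with hp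
  have hsym : ∀ z w, K z w = conj (K w z) := fun z w => by
    rw [← hK w (K z), ← hK z (K w), inner_conj_symm]
  have hI : conj (Complex.I ^ n) * Complex.I ^ n = 1 := by
    rw [map_pow, Complex.conj_I, ← mul_pow]; simp
  have hm : ((-1 : ℂ) ^ n) * (-1) ^ n = 1 := by rw [← mul_pow]; simp
  have h1 : ∀ z w, conj (p z) * (p w * (Complex.I * (conj z - w) * K z w)) =
      conj (p z) * (p w * (conj (kernelGen κ x z) * kernelGen κ x w -
        conj (kernelGen κ x (-z)) * kernelGen κ x (-w))) := fun z w => by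
    have e1 := mul_projKernel hG z w
    rw [projKernel_eq_of_evaluator hκ hx hK] at e1
    have a1 := prod_mul_kernelGen hκ hx w
    have a2 := congrArg conj (prod_mul_kernelGen hκ hx z)
    have b1 := prod_mul_kernelGen_neg hκ hx w
    have b2 := congrArg conj (prod_mul_kernelGen_neg hκ hx z)
    simp only [map_mul, map_pow, map_neg, map_one] at a2 b2
    rw [← map_pow] at a2 b2
    simp only [hp]
    calc _ = Complex.I * (conj z - w) * (conj (∏ j, (z - trivialZeros κ j)) *
          ((∏ j, (w - trivialZeros κ j)) * K z w)) := by ring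
      _ = (conj (∏ j, (z - trivialZeros κ j)) * conj (kernelGen κ x z)) *
          ((∏ j, (w - trivialZeros κ j)) * kernelGen κ x w) -
          (conj (∏ j, (z - trivialZeros κ j)) * conj (kernelGen κ x (-z))) *
          ((∏ j, (w - trivialZeros κ j)) * kernelGen κ x (-w)) := by
        rw [e1, a1, a2, b1, b2]
        linear_combination
          (conj (projPlus κ x z) * projPlus κ x w - conj (projMinus κ x z) * projMinus κ x w) * hI +
          conj (projPlus κ x z) * projPlus κ x w * conj (Complex.I ^ n) * Complex.I ^ n * hm
      _ = _ := by ring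
  have hcK : ∀ z, Continuous fun w => K z w := fun z => (K z).2.1.continuous
  have h2 : ∀ z w, conj (p z) * (Complex.I * (conj z - w) * K z w) =
      conj (p z) * (conj (kernelGen κ x z) * kernelGen κ x w -
        conj (kernelGen κ x (-z)) * kernelGen κ x (-w)) := fun z => by
    refine congrFun (eq_of_prod_sub_mul_eq (trivialZeros κ) ?_ ?_ fun w => ?_)
    · have := hcK z
      fun_prop
    · have := hE.continuous
      fun_prop
    · linear_combination h1 z w
  have h3 : (fun z => conj (Complex.I * (conj z - w) * K z w)) = fun z =>
      conj (conj (kernelGen κ x z) * kernelGen κ x w -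
        conj (kernelGen κ x (-z)) * kernelGen κ x (-w)) := by
    have hcc := Complex.continuous_conj
    have hcE := hE.continuous
    refine eq_of_prod_sub_mul_eq (trivialZeros κ) ?_ ?_ fun z => ?_
    · have : Continuous fun z => K z w := by
        have e : (fun z => K z w) = fun z => conj (K w z) := funext fun z => hsym z w
        rw [e]
        exact hcc.comp (hcK w)
      fun_prop
    · fun_prop
    · have := congrArg conj (h2 z w)
      rw [map_mul (starRingEnd ℂ) (conj (p z)), map_mul (starRingEnd ℂ) (conj (p z)),
        Complex.conj_conj] at this
      exact this
  have h4 := congrArg conj (congrFun h3 z)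
  simpa only [Complex.conj_conj] using h4

/-! ## Positivity at the origin -/

theorem evaluator_self_pos (hx : 0 < x) {z : Fin n → ℂ} {K : ℂ → PaleyWienerMod x z}
    (hK : ∀ w (F : PaleyWienerMod x z), inner ℂ (K w) F = F w) (t : ℝ) :
    0 < (K (Complex.I * t) (Complex.I * t)).re := by
  obtain ⟨F, hF⟩ := PaleyWienerMod.exists_apply_ne_zero hx z t
  have h0 : K (Complex.I * t) ≠ 0 := fun h => hF (by rw [← hK, h, inner_zero_left])
  have h := hK (Complex.I * t) (K (Complex.I * t))
  rw [← h, inner_self_eq_norm_sq_to_K]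
  have : 0 < ‖K (Complex.I * t)‖ := norm_pos_iff.2 h0
  change 0 < (((‖K (Complex.I * t)‖ : ℝ) : ℂ) ^ 2).re
  rw [← Complex.ofReal_pow, Complex.ofReal_re]
  positivity

/-- If E(it) = 0 with t > 0, the kernel formula makes 2t K(it, it) equal to -|E(-it)|², against
positivity. If E(0) = 0, it makes K_0 vanish off the origin, hence identically. -/
theorem kernelGen_imag_ne_zero (hκ : Function.Injective κ) (hx : 0 < x) {t : ℝ} (ht : 0 ≤ t) :
    kernelGen κ x (Complex.I * t) ≠ 0 := by
  obtain ⟨K, hK⟩ := PaleyWienerMod.exists_evaluator hx.le (trivialZeros_injective hκ)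
  have hpos := evaluator_self_pos hx hK t
  intro h0
  have h := mul_evaluator_eq hκ hx hK (Complex.I * t)
  rcases ht.eq_or_lt with rfl | ht
  · simp only [Complex.ofReal_zero, mul_zero, neg_zero] at h h0 hpos
    have h1 : K 0 = 0 := by
      refine Subtype.ext (Continuous.ext_on (dense_compl_singleton (0 : ℂ))
        (K 0).2.1.continuous continuous_zero fun w hw => ?_)
      have h2 := h w
      rw [h0, map_zero, zero_mul, zero_mul, zero_sub, sub_zero] at h2
      exact (mul_eq_zero.1 h2).resolve_left (mul_ne_zero Complex.I_ne_zero (neg_ne_zero.2 hw))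
    rw [h1] at hpos
    exact absurd hpos (lt_irrefl _)
  · have h2 := congrArg Complex.re (h (Complex.I * t))
    rw [h0, mul_zero, zero_sub, ← Complex.normSq_eq_conj_mul_self] at h2
    have e : Complex.I * (conj (Complex.I * t) - Complex.I * t) = ((2 * t : ℝ) : ℂ) := by
      rw [map_mul, Complex.conj_I, Complex.conj_ofReal]
      push_cast
      linear_combination (-2 * t : ℂ) * Complex.I_mul_I
    rw [e, Complex.re_ofReal_mul, Complex.neg_re, Complex.ofReal_re] at h2
    have h3 := Complex.normSq_nonneg (kernelGen κ x (-(Complex.I * t)))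
    have : 0 < 2 * t * (K (Complex.I * t) (Complex.I * t)).re := by positivity
    linarith

theorem prod_imag (t : ℝ) : ∏ j, (Complex.I * t - trivialZeros κ j) =
    Complex.I ^ n * ((∏ j, (t + κ j) : ℝ) : ℂ) := by
  have : ∀ j, Complex.I * t - trivialZeros κ j = Complex.I * ((t + κ j : ℝ) : ℂ) := fun j => by
    rw [trivialZeros]; push_cast; ring
  simp only [this, Finset.prod_mul_distrib, Finset.prod_const, Finset.card_univ, Fintype.card_fin,
    Complex.ofReal_prod]

theorem prod_mul_kernelGen_imag (hκ : Function.Injective κ) (hx : 0 < x) (t : ℝ) :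
    ((∏ j, (t + κ j) : ℝ) : ℂ) * kernelGen κ x (Complex.I * t) =
      projMinus κ x (Complex.I * t) := by
  have h := prod_mul_kernelGen hκ hx (Complex.I * t)
  rw [prod_imag, mul_assoc] at h
  exact mul_left_cancel₀ (pow_ne_zero _ Complex.I_ne_zero) h

theorem prod_mul_kernelGen_neg_imag (hκ : Function.Injective κ) (hx : 0 < x) (t : ℝ) :
    ((∏ j, (t + κ j) : ℝ) : ℂ) * kernelGen κ x (-(Complex.I * t)) =
      (-1) ^ n * projPlus κ x (Complex.I * t) := by
  have h := prod_mul_kernelGen_neg hκ hx (Complex.I * t)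
  rw [prod_imag, mul_assoc] at h
  refine mul_left_cancel₀ (pow_ne_zero n Complex.I_ne_zero) (h.trans ?_)
  ring

theorem kernelGen_imag_im (hκ : Function.Injective κ) (hx : 0 < x) (t : ℝ) :
    (kernelGen κ x (Complex.I * t)).im = 0 := by
  have h := conj_kernelGen_conj hκ hx (-(Complex.I * t))
  have e : conj (-(Complex.I * (t : ℂ))) = Complex.I * t := by simp
  rw [e, neg_neg] at h
  exact Complex.conj_eq_iff_im.1 h

theorem tendsto_exp_neg_mul_atTop {c : ℝ} (hc : 0 < c) :
    Tendsto (fun t : ℝ => Complex.exp (-(c * t : ℝ))) atTop (𝓝 0) := by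
  have h : Tendsto (fun t : ℝ => Real.exp (-(c * t))) atTop (𝓝 0) :=
    Real.tendsto_exp_neg_atTop_nhds_zero.comp (tendsto_id.const_mul_atTop hc)
  have h2 := (Complex.continuous_ofReal.tendsto 0).comp h
  refine h2.congr fun t => ?_
  simp

theorem tendsto_exp_mul_pwKernel (hx : 0 < x) (j : Fin n) :
    Tendsto (fun t : ℝ => Complex.exp (-(x * t : ℝ)) *
      pwKernel x (trivialZeros κ j) (Complex.I * t)) atTop (𝓝 0) := by
  have h1 := tendsto_exp_neg_mul_atTop (c := 2 * x) (by positivity)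
  have h2 : Tendsto (fun t : ℝ => ((κ j - t : ℝ) : ℂ)⁻¹) atTop (𝓝 0) := by
    have h3 : Tendsto (fun t : ℝ => (κ j - t)⁻¹) atTop (𝓝 0) :=
      tendsto_inv_atBot_zero.comp (tendsto_atBot_add_const_left _ _ tendsto_neg_atTop_atBot)
    have := (Complex.continuous_ofReal.tendsto 0).comp h3
    refine this.congr fun t => ?_
    simp
  have h3 := h2.mul ((h1.const_mul (gramV κ x j : ℂ)).sub_const (gramU κ x j : ℂ))
  rw [zero_mul] at h3
  refine h3.congr' ?_
  filter_upwards [eventually_gt_atTop (κ j)] with t ht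
  have h4 := pwKernel_trivialZeros_mul κ x j (Complex.I * t)
  have hne : ((κ j - t : ℝ) : ℂ) ≠ 0 := by
    exact_mod_cast (sub_neg.2 ht).ne
  rw [inv_mul_eq_iff_eq_mul₀ hne]
  have e1 : Complex.exp (Complex.I * x * (Complex.I * t)) = Complex.exp (-(x * t : ℝ)) := by
    congr 1
    push_cast
    linear_combination (x * t : ℂ) * Complex.I_mul_I
  have e2 : Complex.exp (-(Complex.I * x * (Complex.I * t))) = Complex.exp (x * t : ℝ) := by
    congr 1
    push_cast
    linear_combination -(x * t : ℂ) * Complex.I_mul_I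
  have e3 : Complex.exp (-(x * t : ℝ)) * Complex.exp (x * t : ℝ) = 1 := by
    rw [← Complex.exp_add]; simp
  have e4 : Complex.exp (-(2 * x * t : ℝ)) =
      Complex.exp (-(x * t : ℝ)) * Complex.exp (-(x * t : ℝ)) := by
    rw [← Complex.exp_add]; congr 1; push_cast; ring
  rw [e1, e2] at h4
  rw [e4]
  push_cast at h4 e3 ⊢
  linear_combination -Complex.exp (-(x * t)) * h4 + gramU κ x j * e3 +
    Complex.exp (-(x * t)) * pwKernel x (trivialZeros κ j) (Complex.I * t) * t * Complex.I_mul_I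

/-- On the positive imaginary axis the kernels at the z_j are smaller than exp(xt) by a factor of
order 1/t, so `projMinus` grows like exp(xt), while `projPlus` is negligible against it. This gives
both the sign of E(it) for large t and the limit condition. -/
theorem tendsto_exp_mul_projMinus (hx : 0 < x) :
    Tendsto (fun t : ℝ => Complex.exp (-(x * t : ℝ)) * projMinus κ x (Complex.I * t))
      atTop (𝓝 1) := by
  have h := (tendsto_const_nhds (x := (1 : ℂ))).sub (tendsto_finsetSum Finset.univ fun j _ =>
    (tendsto_exp_mul_pwKernel (κ := κ) hx j).const_mul (gramC κ x j : ℂ))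
  simp only [mul_zero, Finset.sum_const_zero, sub_zero] at h
  refine h.congr fun t => ?_
  have e : Complex.exp (-(x * t : ℝ)) * Complex.exp (-(Complex.I * x * (Complex.I * t))) = 1 := by
    rw [← Complex.exp_add, Complex.exp_eq_one_iff]
    refine ⟨0, ?_⟩
    push_cast
    linear_combination -(x * t : ℂ) * Complex.I_mul_I
  rw [projMinus, mul_sub, e, Finset.mul_sum]
  congr 1
  refine Finset.sum_congr rfl fun j _ => ?_
  rw [Complex.real_smul]
  ring

theorem tendsto_exp_mul_projPlus (hx : 0 < x) :
    Tendsto (fun t : ℝ => Complex.exp (-(x * t : ℝ)) * projPlus κ x (Complex.I * t))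
      atTop (𝓝 0) := by
  have h := (tendsto_exp_neg_mul_atTop (c := 2 * x) (by positivity)).sub
    (tendsto_finsetSum Finset.univ fun j _ =>
    (tendsto_exp_mul_pwKernel (κ := κ) hx j).const_mul (gramD κ x j : ℂ))
  simp only [mul_zero, Finset.sum_const_zero, sub_zero] at h
  refine h.congr fun t => ?_
  have e : Complex.exp (-(x * t : ℝ)) * Complex.exp (Complex.I * x * (Complex.I * t)) =
      Complex.exp (-(2 * x * t : ℝ)) := by
    rw [← Complex.exp_add]
    congr 1
    push_cast
    linear_combination (x * t : ℂ) * Complex.I_mul_I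
  rw [projPlus, mul_sub, e, Finset.mul_sum]
  congr 1
  refine Finset.sum_congr rfl fun j _ => ?_
  rw [Complex.real_smul]
  ring

theorem eventually_prod_add_pos (κ : Fin n → ℝ) : ∀ᶠ t : ℝ in atTop, 0 < ∏ j, (t + κ j) := by
  have : ∀ᶠ t : ℝ in atTop, ∀ j, -κ j < t := eventually_all.2 fun j => eventually_gt_atTop _
  filter_upwards [this] with t ht
  exact Finset.prod_pos fun j _ => by linarith [ht j]

/-- E(it) is real, without zeros for t ≥ 0 and positive for large t, so the intermediate value
theorem forces E(0) > 0. -/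
theorem kernelGen_zero_pos (hκ : Function.Injective κ) (hx : 0 < x) :
    0 < (kernelGen κ x 0).re := by
  have hre := (Complex.continuous_re.tendsto 1).comp (tendsto_exp_mul_projMinus (κ := κ) hx)
  have hev := (hre.eventually_const_lt (u := 0) (by simp)).and
    ((eventually_prod_add_pos κ).and (eventually_ge_atTop 0))
  obtain ⟨T, hT, hT2, hT0⟩ := hev.exists
  have hTpos : 0 < (kernelGen κ x (Complex.I * T)).re := by
    have e : Complex.exp (-(x * T : ℝ)) = ((Real.exp (-(x * T)) : ℝ) : ℂ) := by simp
    rw [Function.comp_apply, ← prod_mul_kernelGen_imag hκ hx, e, Complex.re_ofReal_mul,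
      Complex.re_ofReal_mul] at hT
    have := pos_of_mul_pos_right hT (Real.exp_pos _).le
    exact pos_of_mul_pos_right this hT2.le
  by_contra hneg
  have hcont : ContinuousOn (fun t : ℝ => (kernelGen κ x (Complex.I * t)).re) (Set.Icc 0 T) := by
    have := (differentiable_kernelGen hκ hx).continuous
    fun_prop
  obtain ⟨t, ht, ht0⟩ := intermediate_value_Icc hT0 hcont
    (show (0 : ℝ) ∈ _ from ⟨by simpa using not_lt.1 hneg, hTpos.le⟩)
  exact kernelGen_imag_ne_zero hκ hx ht.1 (Complex.ext ht0 (kernelGen_imag_im hκ hx t))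

theorem isKernelGenerator_kernelGen (hκ : Function.Injective κ) (hx : 0 < x) :
    IsKernelGenerator x κ (kernelGen κ x) where
  entire := differentiable_kernelGen hκ hx
  real_on_imag := kernelGen_imag_im hκ hx
  pos_zero := kernelGen_zero_pos hκ hx
  tendsto_zero := by
    have h := ((tendsto_exp_mul_projPlus (κ := κ) hx).const_mul ((-1) ^ n)).div
      (tendsto_exp_mul_projMinus (κ := κ) hx) one_ne_zero
    rw [mul_zero, zero_div] at h
    refine h.congr' ?_
    filter_upwards [eventually_prod_add_pos κ] with t ht
    have hne : ((∏ j, (t + κ j) : ℝ) : ℂ) ≠ 0 := by exact_mod_cast ht.ne'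
    have hne2 := Complex.exp_ne_zero (-(x * t : ℝ))
    rw [Pi.div_apply, ← mul_div_mul_left (kernelGen κ x (-(Complex.I * t))) _ hne, prod_mul_kernelGen_imag hκ hx,
      prod_mul_kernelGen_neg_imag hκ hx, mul_left_comm, mul_div_mul_left _ _ hne2]
  kernel := by
    obtain ⟨K, hK⟩ := PaleyWienerMod.exists_evaluator hx.le (trivialZeros_injective hκ)
    refine ⟨K, hK, fun z w hzw => ?_⟩
    have hne : Complex.I * (conj z - w) ≠ 0 := mul_ne_zero Complex.I_ne_zero (sub_ne_zero.2 hzw)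
    rw [hK, eq_div_iff hne, mul_comm, mul_evaluator_eq hκ hx hK, conj_kernelGen_conj hκ hx,
      ← conj_kernelGen_conj hκ hx z, Complex.conj_conj]

end generator

/-! ## Uniqueness -/

section uniqueness

variable {n : ℕ} {κ : Fin n → ℝ} {x : ℝ} {E : ℂ → ℂ}

theorem IsKernelGenerator.ofReal_re (hE : IsKernelGenerator x κ E) (t : ℝ) :
    ((E (Complex.I * t)).re : ℂ) = E (Complex.I * t) :=
  Complex.ext rfl (by rw [hE.real_on_imag]; simp)

theorem IsKernelGenerator.sub_eq (hE : IsKernelGenerator x κ E)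
    {K : ℂ → PaleyWienerMod x (trivialZeros κ)}
    (hK : ∀ z (F : PaleyWienerMod x (trivialZeros κ)), inner ℂ (K z) F = F z) (t s : ℝ) :
    (E (Complex.I * t)).re * (E (Complex.I * s)).re -
      (E (Complex.I * (-t : ℝ))).re * (E (Complex.I * (-s : ℝ))).re =
      (t + s) * (K (Complex.I * t) (Complex.I * s)).re := by
  -- On this line the kernel formula says nothing, but both sides vanish identically.
  by_cases hts : t + s = 0
  · obtain rfl : s = -t := by linarith
    rw [neg_neg, hts]
    ring
  obtain ⟨K', hK', hk⟩ := hE.kernel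
  have hKK : K' = K := funext fun z => ext_inner_right ℂ fun F => by rw [hK, hK']
  have e1 : ∀ t : ℝ, conj (Complex.I * (t : ℂ)) = Complex.I * ((-t : ℝ) : ℂ) := fun t => by simp
  have e2 : Complex.I * (Complex.I * ((-t : ℝ) : ℂ) - Complex.I * s) = ((t + s : ℝ) : ℂ) := by
    push_cast
    linear_combination (-(t + s) : ℂ) * Complex.I_mul_I
  have hne : ((t + s : ℝ) : ℂ) ≠ 0 := by exact_mod_cast hts
  have h := hk (Complex.I * t) (Complex.I * s) fun h => hne (by
    rw [← e2, ← e1, h, sub_self, mul_zero])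
  rw [hKK, hK, e1, e1, e2, eq_div_iff hne, ← hE.ofReal_re t, ← hE.ofReal_re s,
    ← hE.ofReal_re (-t), ← hE.ofReal_re (-s)] at h
  simp only [Complex.conj_ofReal] at h
  have h2 := congrArg Complex.re h
  rw [mul_comm, Complex.re_ofReal_mul] at h2
  rw [h2]
  simp

/-- In terms of the even part p and the odd part r of e, the common expression is 2(p(t)r(s) +
r(t)p(s)). Setting s = 0 shows that the odd part of f is λr, and then its even part is p/λ, with λ =
e(0)/f(0). Since e(-t)/e(t) → 0, the ratio f(-t)/f(t) tends to (1 - λ²)/(1 + λ²), so its vanishing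
forces λ = 1. -/
theorem eq_of_skew_product_eq {e f : ℝ → ℝ} (he0 : 0 < e 0) (hf0 : 0 < f 0)
    (hpos : ∀ t, 0 < t → 0 < e t * e t - e (-t) * e (-t))
    (hef : ∀ t s, e t * e s - e (-t) * e (-s) = f t * f s - f (-t) * f (-s))
    (hel : Tendsto (fun t => e (-t) / e t) atTop (𝓝 0))
    (hfl : Tendsto (fun t => f (-t) / f t) atTop (𝓝 0)) : e = f := by
  set lam := e 0 / f 0 with hlam
  have hl0 : 0 < lam := div_pos he0 hf0
  have hlam' : e 0 = lam * f 0 := by rw [hlam, div_mul_cancel₀ _ hf0.ne']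
  have hodd : ∀ t, f t - f (-t) = lam * (e t - e (-t)) := fun t => by
    have := hef t 0
    rw [neg_zero] at this
    refine mul_right_cancel₀ hf0.ne' ?_
    linear_combination -this + (e t - e (-t)) * hlam'
  have heven : ∀ t, e t + e (-t) = lam * (f t + f (-t)) := by
    have hsum : ∀ t s, (e t + e (-t) - lam * (f t + f (-t))) * (e s - e (-s)) +
        (e t - e (-t)) * (e s + e (-s) - lam * (f s + f (-s))) = 0 := fun t s => by
      linear_combination 2 * hef t s + (f t + f (-t)) * hodd s + (f s + f (-s)) * hodd t
    have hne : ∀ t, 0 < t → e t - e (-t) ≠ 0 := fun t ht h => by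
      have := hpos t ht
      rw [sub_eq_zero] at h
      rw [← h] at this
      simp at this
    have h1 : e 1 + e (-1) - lam * (f 1 + f (-1)) = 0 := by
      have := hsum 1 1
      have h2 : (e 1 + e (-1) - lam * (f 1 + f (-1))) * (e 1 - e (-1)) = 0 := by linarith
      exact (mul_eq_zero.1 h2).resolve_right (hne 1 one_pos)
    intro t
    have := hsum t 1
    rw [h1, mul_zero, add_zero] at this
    exact sub_eq_zero.1 ((mul_eq_zero.1 this).resolve_right (hne 1 one_pos))
  have hlam1 : lam = 1 := by
    have h1 : Tendsto (fun t => ((1 + e (-t) / e t) - lam ^ 2 * (1 - e (-t) / e t)) /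
        ((1 + e (-t) / e t) + lam ^ 2 * (1 - e (-t) / e t))) atTop
        (𝓝 (((1 + 0) - lam ^ 2 * (1 - 0)) / ((1 + 0) + lam ^ 2 * (1 - 0)))) := by
      refine Tendsto.div ?_ ?_ (by positivity)
      · exact (hel.const_add 1).sub ((hel.const_sub 1).const_mul _)
      · exact (hel.const_add 1).add ((hel.const_sub 1).const_mul _)
    have h2 : Tendsto (fun t => f (-t) / f t) atTop
        (𝓝 (((1 + 0) - lam ^ 2 * (1 - 0)) / ((1 + 0) + lam ^ 2 * (1 - 0)))) := by
      refine h1.congr' ?_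
      filter_upwards [eventually_gt_atTop 0] with t ht
      have het : e t ≠ 0 := fun h => by
        have := hpos t ht
        rw [h] at this
        nlinarith [mul_self_nonneg (e (-t))]
      have hf1 : f t = (e t + e (-t) + lam ^ 2 * (e t - e (-t))) / (2 * lam) := by
        rw [eq_div_iff (by positivity)]
        linear_combination -heven t + lam * hodd t
      have hf2 : f (-t) = (e t + e (-t) - lam ^ 2 * (e t - e (-t))) / (2 * lam) := by
        rw [eq_div_iff (by positivity)]
        linear_combination -heven t - lam * hodd t
      rw [hf1, hf2, div_div_div_cancel_right₀ (by positivity)]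
      have e1 : (1 + e (-t) / e t) - lam ^ 2 * (1 - e (-t) / e t) =
          (e t + e (-t) - lam ^ 2 * (e t - e (-t))) / e t := by field_simp
      have e2 : (1 + e (-t) / e t) + lam ^ 2 * (1 - e (-t) / e t) =
          (e t + e (-t) + lam ^ 2 * (e t - e (-t))) / e t := by field_simp
      rw [e1, e2, div_div_div_cancel_right₀ het]
    have h3 := tendsto_nhds_unique h2 hfl
    rw [div_eq_zero_iff] at h3
    rcases h3 with h3 | h3
    · have : (lam - 1) * (lam + 1) = 0 := by linarith
      exact sub_eq_zero.1 ((mul_eq_zero.1 this).resolve_right (by positivity))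
    · have : 0 < 1 + 0 + lam ^ 2 * (1 - 0) := by positivity
      linarith
  funext t
  have h1 := hodd t
  have h2 := heven t
  rw [hlam1] at h1 h2
  linarith

theorem IsKernelGenerator.unique (hκ : Function.Injective κ) (hx : 0 < x)
    (hE : IsKernelGenerator x κ E) {E' : ℂ → ℂ} (hE' : IsKernelGenerator x κ E') : E = E' := by
  obtain ⟨K, hK⟩ := PaleyWienerMod.exists_evaluator hx.le (trivialZeros_injective hκ)
  have hlim : ∀ {E : ℂ → ℂ}, IsKernelGenerator x κ E → Tendsto (fun t : ℝ =>
      (E (Complex.I * (-t : ℝ))).re / (E (Complex.I * t)).re) atTop (𝓝 0) := fun {E} hE => by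
    have h := (Complex.continuous_re.tendsto 0).comp hE.tendsto_zero
    refine h.congr fun t => ?_
    rw [Function.comp_apply, ← hE.ofReal_re t]
    have : E (-(Complex.I * t)) = ((E (Complex.I * (-t : ℝ))).re : ℂ) := by
      rw [hE.ofReal_re]; push_cast; ring_nf
    rw [this, ← Complex.ofReal_div, Complex.ofReal_re, Complex.ofReal_re]
  have h := eq_of_skew_product_eq (e := fun t : ℝ => (E (Complex.I * t)).re)
    (f := fun t : ℝ => (E' (Complex.I * t)).re) (by simpa using hE.pos_zero)
    (by simpa using hE'.pos_zero)
    (fun t ht => by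
      rw [hE.sub_eq hK]
      have := evaluator_self_pos hx hK t
      positivity)
    (fun t s => by rw [hE.sub_eq hK, hE'.sub_eq hK]) (hlim hE) (hlim hE')
  have hdiff := PaleyWiener.eq_zero_of_real
    (f := fun w => E (Complex.I * w) - E' (Complex.I * w))
    ((hE.entire.comp (differentiable_id.const_mul _)).sub
      (hE'.entire.comp (differentiable_id.const_mul _))) fun t => by
      rw [← hE.ofReal_re, ← hE'.ofReal_re, congrFun h t, sub_self]
  funext w
  have := congrFun hdiff (-Complex.I * w)
  have e : Complex.I * (-Complex.I * w) = w := by linear_combination -w * Complex.I_mul_I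
  simp only [e, Pi.zero_apply] at this
  exact sub_eq_zero.1 this

end uniqueness

end

section

open Matrix

/-! ## Wronskians of hyperbolic functions -/

/-- By the recurrence the new last row r_n is -∑ g_k r_k, and modulo the other rows only -g_0 r_0
counts. Moving r_0 from last to first place is a cycle of sign (-1)^{n-1}. -/
theorem det_shift_rows {R : Type*} [CommRing R] {n : ℕ} (r : ℕ → Fin n → R) (g : ℕ → R)
    (hg : g n = 1) (h : ∀ j, ∑ k ∈ Finset.range (n + 1), g k * r k j = 0) :
    (Matrix.of fun i j : Fin n => r (i + 1) j).det =
      (-1) ^ n * g 0 * (Matrix.of fun i j : Fin n => r i j).det := by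
  cases n with
  | zero => simp [hg]
  | succ m =>
    set A : Matrix (Fin (m + 1)) (Fin (m + 1)) R := Matrix.of fun i j => r i j with hA
    set A' := A.submatrix (finRotate (m + 1)) id with hA'
    have hlast : A' (Fin.last m) = r 0 := by
      funext j
      simp [hA', hA]
    have hcast : ∀ k : Fin m, A' k.castSucc = r (k + 1) := fun k => by
      funext j
      simp [hA', hA]
    have hdet : A'.det = (-1) ^ m * A.det := by
      rw [hA', Matrix.det_permute, sign_finRotate]
      simp
    set c : Fin (m + 1) → R := Fin.snoc (fun k : Fin m => -g (k + 1)) (-g 0) with hc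
    have hB : (Matrix.of fun i j : Fin (m + 1) => r (i + 1) j) =
        A'.updateRow (Fin.last m) (∑ k, c k • A' k) := by
      ext i j
      refine Fin.lastCases ?_ (fun i => ?_) i
      · rw [Matrix.updateRow_self, Fin.sum_univ_castSucc]
        simp only [hc, Fin.snoc_castSucc, Fin.snoc_last, hlast, hcast, Pi.add_apply,
          Finset.sum_apply, Pi.smul_apply, smul_eq_mul, Matrix.of_apply, Fin.val_last]
        have h1 := h j
        rw [Finset.sum_range_succ, hg, Finset.sum_range_succ',
          ← Fin.sum_univ_eq_sum_range (fun k => g (k + 1) * r (k + 1) j)] at h1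
        have h2 : ∑ k : Fin m, -g (k + 1) * r (k + 1) j =
            -∑ k : Fin m, g (k + 1) * r (k + 1) j := by
          rw [← Finset.sum_neg_distrib]
          exact Finset.sum_congr rfl fun k _ => by ring
        rw [h2]
        linear_combination h1
      · rw [Matrix.updateRow_ne (Fin.castSucc_lt_last i).ne, hcast]
        rfl
    rw [hB, Matrix.det_updateRow_sum, hc, Fin.snoc_last, hdet, smul_eq_mul]
    ring

section wronskian

variable {n : ℕ} {κ : Fin n → ℝ} {x : ℝ}

theorem iteratedDeriv_cosh_mul (c : ℝ) (k : ℕ) :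
    iteratedDeriv k (fun x => Real.cosh (c * x)) =
      fun x => c ^ k * (Real.exp (x * c) + (-1) ^ k * Real.exp (-x * c)) / 2 := by
  induction k with
  | zero =>
    funext x
    rw [iteratedDeriv_zero, Real.cosh_eq]
    ring_nf
  | succ k ih =>
    rw [iteratedDeriv_succ, ih]
    funext x
    have h1 : HasDerivAt (fun x => Real.exp (x * c)) (Real.exp (x * c) * (1 * c)) x :=
      ((hasDerivAt_id x).mul_const c).exp
    have h2 : HasDerivAt (fun x => Real.exp (-x * c)) (Real.exp (-x * c) * (-1 * c)) x :=
      ((hasDerivAt_neg x).mul_const c).exp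
    have h := ((h1.add (h2.const_mul ((-1) ^ k))).const_mul (c ^ k)).div_const 2
    refine h.deriv.trans ?_
    ring

theorem iteratedDeriv_sinh_mul (c : ℝ) (k : ℕ) :
    iteratedDeriv k (fun x => Real.sinh (c * x)) =
      fun x => c ^ k * (Real.exp (x * c) - (-1) ^ k * Real.exp (-x * c)) / 2 := by
  induction k with
  | zero =>
    funext x
    rw [iteratedDeriv_zero, Real.sinh_eq]
    ring_nf
  | succ k ih =>
    rw [iteratedDeriv_succ, ih]
    funext x
    have h1 : HasDerivAt (fun x => Real.exp (x * c)) (Real.exp (x * c) * (1 * c)) x :=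
      ((hasDerivAt_id x).mul_const c).exp
    have h2 : HasDerivAt (fun x => Real.exp (-x * c)) (Real.exp (-x * c) * (-1 * c)) x :=
      ((hasDerivAt_neg x).mul_const c).exp
    have h := ((h1.sub (h2.const_mul ((-1) ^ k))).const_mul (c ^ k)).div_const 2
    refine h.deriv.trans ?_
    ring

open Polynomial in
/-- The polynomial `∑ j, a_j w_j ∏ i ≠ j, (X - κ_i)`. -/
noncomputable def nodalSum (κ a w : Fin n → ℝ) : ℝ[X] :=
  ∑ j, C (a j * w j) * Lagrange.nodal (Finset.univ.erase j) κ

theorem degree_nodalSum_lt (a w : Fin n → ℝ) : (nodalSum κ a w).degree < n := by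
  refine (Polynomial.degree_sum_le _ _).trans_lt ((Finset.sup_lt_iff ?_).2 fun j _ => ?_)
  · exact WithBot.bot_lt_coe n
  · refine ((Polynomial.degree_mul_le _ _).trans
      (add_le_of_nonpos_left Polynomial.degree_C_le)).trans_lt ?_
    rw [Lagrange.degree_nodal, Finset.card_erase_of_mem (Finset.mem_univ j), Finset.card_univ,
      Fintype.card_fin]
    exact_mod_cast Nat.sub_lt j.pos one_pos

theorem eval_nodalSum (a w : Fin n → ℝ) (t : ℝ) : (nodalSum κ a w).eval t =
    ∑ j, a j * w j * (Lagrange.nodal (Finset.univ.erase j) κ).eval t := by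
  simp [nodalSum, Polynomial.eval_finsetSum]

theorem eval_nodalSum_node (a w : Fin n → ℝ) (m : Fin n) : (nodalSum κ a w).eval (κ m) =
    a m * w m * (Lagrange.nodal (Finset.univ.erase m) κ).eval (κ m) := by
  rw [eval_nodalSum]
  refine Finset.sum_eq_single m (fun j _ hj => ?_) fun h => absurd (Finset.mem_univ m) h
  rw [Lagrange.eval_nodal_at_node (Finset.mem_erase.2 ⟨hj.symm, Finset.mem_univ m⟩), mul_zero]

theorem eval_nodal_eq_mul (j : Fin n) (t : ℝ) : (Lagrange.nodal Finset.univ κ).eval t =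
    (t - κ j) * (Lagrange.nodal (Finset.univ.erase j) κ).eval t := by
  rw [Lagrange.nodal_eq_mul_nodal_erase (Finset.mem_univ j)]
  simp

/-- At the reflected node -κ_m the nodal polynomial factors through -(κ_m + κ_j), and the
displacement equation turns u_mu_j - v_mv_j into -(κ_m + κ_j)G_mj. Evaluation at reflected nodes
thus becomes the action of G. -/
theorem nodalSum_pairing (a : Fin n → ℝ) (m : Fin n) :
    gramU κ x m * (nodalSum κ a (gramU κ x)).eval (-κ m) -
      gramV κ x m * (nodalSum κ a (gramV κ x)).eval (-κ m) =
      (Lagrange.nodal Finset.univ κ).eval (-κ m) * (expGram κ x *ᵥ a) m := by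
  simp only [eval_nodalSum, mulVec, dotProduct, Finset.mul_sum, ← Finset.sum_sub_distrib]
  refine Finset.sum_congr rfl fun j _ => ?_
  have h1 := add_mul_expGram (κ := κ) (x := x) m j
  have h2 := eval_nodal_eq_mul (κ := κ) j (-κ m)
  rw [h2]
  linear_combination a j * (Lagrange.nodal (Finset.univ.erase j) κ).eval (-κ m) * h1

theorem eval_nodal_erase_ne_zero (hκ : Function.Injective κ) (m : Fin n) :
    (Lagrange.nodal (Finset.univ.erase m) κ).eval (κ m) ≠ 0 := by
  rw [Lagrange.eval_nodal]
  exact Finset.prod_ne_zero_iff.2 fun j hj => sub_ne_zero.2 fun h =>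
    Finset.ne_of_mem_erase hj (hκ h).symm

theorem eval_nodal_neg_ne_zero (hs : ∀ i j, κ i + κ j ≠ 0) (m : Fin n) :
    (Lagrange.nodal Finset.univ κ).eval (-κ m) ≠ 0 := by
  rw [Lagrange.eval_nodal]
  exact Finset.prod_ne_zero_iff.2 fun j _ h => hs m j (by linarith)

open Polynomial in
-- The conditions at κ_m say, by Lagrange interpolation and u_mv_m = 1, that U and -V are nodal sums
-- with the same coefficients a and weights u and v. The conditions at -κ_m then say that Ga = 0.
theorem eq_zero_of_exp_mul_eval_eq_zero (hκ : Function.Injective κ) (hx : 0 < x)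
    (hs : ∀ i j, κ i + κ j ≠ 0) {U V : ℝ[X]} (hU : U.degree < n) (hV : V.degree < n)
    (h1 : ∀ m, gramV κ x m * U.eval (κ m) + gramU κ x m * V.eval (κ m) = 0)
    (h2 : ∀ m, gramU κ x m * U.eval (-κ m) + gramV κ x m * V.eval (-κ m) = 0) : U = 0 := by
  have huv : ∀ m, gramU κ x m * gramV κ x m = 1 := fun m => by
    rw [gramU, gramV, ← Real.exp_add, neg_mul, neg_add_cancel, Real.exp_zero]
  have hcard : (n : WithBot ℕ) = ((Finset.univ : Finset (Fin n)).card : WithBot ℕ) := by simp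
  set a : Fin n → ℝ := fun m =>
    gramV κ x m * U.eval (κ m) / (Lagrange.nodal (Finset.univ.erase m) κ).eval (κ m) with ha
  have hP := eval_nodal_erase_ne_zero hκ
  have hUa : U = nodalSum κ a (gramU κ x) := by
    refine Polynomial.eq_of_degrees_lt_of_eval_index_eq Finset.univ hκ.injOn
      (hcard ▸ hU) (hcard ▸ degree_nodalSum_lt _ _) fun m _ => ?_
    rw [eval_nodalSum_node, ha]
    field_simp [hP m]
    linear_combination -U.eval (κ m) * huv m
  have hVa : V = -nodalSum κ a (gramV κ x) := by
    refine Polynomial.eq_of_degrees_lt_of_eval_index_eq Finset.univ hκ.injOn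
      (hcard ▸ hV) (by rw [degree_neg]; exact hcard ▸ degree_nodalSum_lt _ _) fun m _ => ?_
    rw [eval_neg, eval_nodalSum_node, ha]
    field_simp [hP m]
    linear_combination gramV κ x m * h1 m - V.eval (κ m) * huv m
  have hG0 : expGram κ x *ᵥ a = expGram κ x *ᵥ 0 := by
    funext m
    rw [mulVec_zero, Pi.zero_apply]
    have h3 := nodalSum_pairing (κ := κ) (x := x) a m
    rw [← hUa, show nodalSum κ a (gramV κ x) = -V by rw [hVa, neg_neg], eval_neg] at h3
    refine (mul_eq_zero.1 (h3.symm.trans ?_)).resolve_left (eval_nodal_neg_ne_zero hs m)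
    linear_combination h2 m
  have ha0 := expGram_mulVec_injective (expGram_det_pos hκ hx).ne' hG0
  rw [hUa, ha0]
  simp [nodalSum]

theorem wronskianDet_cosh_eq (κ : Fin n → ℝ) (x : ℝ) :
    wronskianDet (fun j x => Real.cosh (κ j * x)) x = (Matrix.of fun i j : Fin n =>
      κ j ^ (i : ℕ) * (gramV κ x j + (-1) ^ (i : ℕ) * gramU κ x j) / 2).det := by
  simp only [wronskianDet, iteratedDeriv_cosh_mul, gramU, gramV]

/-- Since (cosh κx)' = κ sinh κx, multiplying column j by κ_j turns the rows for sinh into the rows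
for cosh moved on by one derivative. -/
theorem prod_mul_wronskianDet_sinh_eq (κ : Fin n → ℝ) (x : ℝ) :
    (∏ j, κ j) * wronskianDet (fun j x => Real.sinh (κ j * x)) x = (Matrix.of fun i j : Fin n =>
      κ j ^ ((i : ℕ) + 1) * (gramV κ x j + (-1) ^ ((i : ℕ) + 1) * gramU κ x j) / 2).det := by
  rw [wronskianDet, mul_comm, ← Matrix.det_diagonal, ← Matrix.det_mul]
  congr 1
  ext i j
  rw [Matrix.mul_diagonal, Matrix.of_apply, Matrix.of_apply, iteratedDeriv_sinh_mul, gramU, gramV]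
  ring

open Polynomial in
-- A vanishing combination of the rows is a polynomial U of degree below n with v_m U(κ_m) + u_m
-- U(-κ_m) = 0; the interpolation lemma applies with V(t) = U(-t).
theorem wronskianDet_cosh_ne_zero (hκ : Function.Injective κ) (hx : 0 < x)
    (hs : ∀ i j, κ i + κ j ≠ 0) :
    wronskianDet (fun j x => Real.cosh (κ j * x)) x ≠ 0 := by
  rw [wronskianDet_cosh_eq]
  intro h
  obtain ⟨g, hg, hg0⟩ := Matrix.exists_vecMul_eq_zero_iff.2 h
  set U : ℝ[X] := ∑ k : Fin n, C (g k) * X ^ (k : ℕ) with hU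
  set V : ℝ[X] := ∑ k : Fin n, C ((-1) ^ (k : ℕ) * g k) * X ^ (k : ℕ) with hV
  have hdeg : ∀ g : Fin n → ℝ,
      (∑ k : Fin n, C (g k) * X ^ (k : ℕ) : ℝ[X]).degree < (n : WithBot ℕ) := fun g => by
    refine (degree_sum_le _ _).trans_lt ((Finset.sup_lt_iff ?_).2 fun j _ => ?_)
    · exact WithBot.bot_lt_coe n
    · exact (degree_C_mul_X_pow_le _ _).trans_lt (by exact_mod_cast j.2)
  have hUe : ∀ t, U.eval t = ∑ k, g k * t ^ (k : ℕ) := fun t => by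
    simp [hU, eval_finsetSum]
  have hVe : ∀ t, V.eval t = ∑ k : Fin n, (-1) ^ (k : ℕ) * g k * t ^ (k : ℕ) := fun t => by
    simp [hV, eval_finsetSum]
  have hrow : ∀ m, gramV κ x m * U.eval (κ m) + gramU κ x m * V.eval (κ m) = 0 := fun m => by
    have h1 := congrFun hg0 m
    rw [Pi.zero_apply] at h1
    simp only [vecMul, dotProduct, Matrix.of_apply] at h1
    rw [hUe, hVe, Finset.mul_sum, Finset.mul_sum, ← Finset.sum_add_distrib,
      ← mul_zero (2 : ℝ), ← h1, Finset.mul_sum]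
    exact Finset.sum_congr rfl fun k _ => by ring
  have hVU : ∀ t, V.eval t = U.eval (-t) := fun t => by
    rw [hUe, hVe]
    refine Finset.sum_congr rfl fun k _ => ?_
    rw [neg_pow]; ring
  have hU0 : U = 0 := eq_zero_of_exp_mul_eval_eq_zero hκ hx hs (hdeg _) (hdeg _) hrow fun m => by
    have := hrow m
    rw [hVU] at this ⊢
    rw [neg_neg]
    linarith
  refine hg (funext fun k => ?_)
  have h2 : U.coeff k = g k := by
    rw [hU, finsetSum_coeff]
    simp only [coeff_C_mul, coeff_X_pow, Fin.val_inj, mul_ite, mul_one, mul_zero,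
      Finset.sum_ite_eq, Finset.mem_univ, if_true]
  rw [← h2, hU0, coeff_zero, Pi.zero_apply]

open Polynomial in
-- The two Wronskians have consecutive blocks of rows of one sequence, so `det_shift_rows` compares
-- them as soon as a monic recurrence of order n is known. That recurrence comes from the zeros of
-- the numerator of `projMinus`.
theorem wronskianDet_sinh_eq_mul (hκ : Function.Injective κ) (hx : 0 < x)
    (hs : ∀ i j, κ i + κ j ≠ 0) :
    wronskianDet (fun j x => Real.sinh (κ j * x)) x =
      (∏ j, κ j) * (kernelGen κ x 0).re * wronskianDet (fun j x => Real.cosh (κ j * x)) x := by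
  have hG := (expGram_det_pos hκ hx).ne'
  have hκ0 : ∀ j, κ j ≠ 0 := fun j h => hs j j (by rw [h, add_zero])
  have hprod : ∏ j, κ j ≠ 0 := Finset.prod_ne_zero_iff.2 fun j _ => hκ0 j
  set P : ℝ[X] := Lagrange.nodal Finset.univ κ with hP
  -- Clearing denominators in `projMinus` gives P(t)A(it) = α(t)exp(xt) + β(t)exp(-xt). The left
  -- side vanishes at t = κ_m because P does, and at t = -κ_m because A(z_m) = 0.
  set α : ℝ[X] := P - nodalSum κ (gramC κ x) (gramU κ x) with hα
  set β : ℝ[X] := nodalSum κ (gramC κ x) (gramV κ x) with hβ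
  have hPdeg : P.natDegree = n := by rw [hP, Lagrange.natDegree_nodal]; simp
  have hβdeg : β.degree < n := degree_nodalSum_lt _ _
  have hαdeg : α.degree ≤ n := by
    refine (degree_sub_le _ _).trans (max_le ?_ (degree_nodalSum_lt _ _).le)
    exact hPdeg ▸ degree_le_natDegree
  have hα1 : α.coeff n = 1 := by
    rw [hα, coeff_sub, coeff_eq_zero_of_degree_lt (degree_nodalSum_lt _ _), sub_zero]
    conv_lhs => rw [← hPdeg]
    exact Lagrange.nodal_monic
  have hβ0 : β.coeff n = 0 := coeff_eq_zero_of_degree_lt hβdeg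
  have h1 : ∀ m, gramV κ x m * α.eval (κ m) + gramU κ x m * β.eval (κ m) = 0 := fun m => by
    rw [hα, hβ, eval_sub, eval_nodalSum_node, eval_nodalSum_node,
      Lagrange.eval_nodal_at_node (Finset.mem_univ m)]
    ring
  have h2 : ∀ m, gramU κ x m * α.eval (-κ m) + gramV κ x m * β.eval (-κ m) = 0 := fun m => by
    have h3 := nodalSum_pairing (κ := κ) (x := x) (gramC κ x) m
    rw [expGram_mulVec_gramC hG] at h3
    rw [hα, hβ, eval_sub]
    linear_combination -h3
  -- These are the coefficients of α(X) + β(-X): monic of degree n, with constant term α(0) + β(0) =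
  -- P(0)A(0).
  set g : ℕ → ℝ := fun k => α.coeff k + (-1) ^ k * β.coeff k with hg
  have hgn : g n = 1 := by simp [hg, hα1, hβ0]
  have hrel : ∀ j, ∑ k ∈ Finset.range (n + 1), g k *
      (κ j ^ k * (gramV κ x j + (-1) ^ k * gramU κ x j) / 2) = 0 := fun j => by
    have e : ∀ (Q : ℝ[X]), Q.degree ≤ n → ∀ t, Q.eval t =
        ∑ k ∈ Finset.range (n + 1), Q.coeff k * t ^ k := fun Q hQ t =>
      eval_eq_sum_range' (Nat.lt_succ_of_le (natDegree_le_of_degree_le hQ)) t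
    have h3 := h1 j
    have h4 := h2 j
    rw [e α hαdeg, e β hβdeg.le, Finset.mul_sum, Finset.mul_sum, ← Finset.sum_add_distrib] at h3 h4
    rw [← mul_zero (1 / 2 : ℝ), ← add_zero (0 : ℝ)]
    nth_rewrite 1 [← h3]
    rw [← h4, ← Finset.sum_add_distrib, Finset.mul_sum]
    refine Finset.sum_congr rfl fun k _ => ?_
    have hsq : ((-1 : ℝ) ^ k) * (-1) ^ k = 1 := by rw [← mul_pow]; simp
    rw [hg, neg_pow]
    linear_combination (β.coeff k * κ j ^ k * gramU κ x j / 2) * hsq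
  have hdet := det_shift_rows (fun k j => κ j ^ k * (gramV κ x j + (-1) ^ k * gramU κ x j) / 2)
    g hgn hrel
  rw [← prod_mul_wronskianDet_sinh_eq, ← wronskianDet_cosh_eq] at hdet
  have hP0 : P.eval 0 = (-1) ^ n * ∏ j, κ j := by
    rw [hP, Lagrange.eval_nodal]
    have : ∀ j, (0 : ℝ) - κ j = -1 * κ j := fun j => by ring
    simp only [this, Finset.prod_mul_distrib, Finset.prod_const, Finset.card_univ,
      Fintype.card_fin]
  have hA0 : (((∏ j, κ j) * (kernelGen κ x 0).re : ℝ) : ℂ) = projMinus κ x 0 := by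
    have h3 := prod_mul_kernelGen_imag hκ hx 0
    simp only [zero_add, Complex.ofReal_zero, mul_zero] at h3
    have h4 := kernelGen_imag_im hκ hx 0
    rw [Complex.ofReal_zero, mul_zero] at h4
    rw [← h3, Complex.ofReal_mul]
    congr 1
    exact Complex.ext rfl (by rw [h4]; simp)
  have hg0 : g 0 = P.eval 0 * ((∏ j, κ j) * (kernelGen κ x 0).re) := by
    have hk : ∀ j, (κ j : ℂ) * pwKernel x (trivialZeros κ j) 0 =
        ((gramV κ x j - gramU κ x j : ℝ) : ℂ) := fun j => by
      have := pwKernel_trivialZeros_mul κ x j 0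
      simpa using this
    have hg1 : g 0 = P.eval 0 - (nodalSum κ (gramC κ x) (gramU κ x)).eval 0 +
        (nodalSum κ (gramC κ x) (gramV κ x)).eval 0 := by
      simp only [hg, pow_zero, one_mul, coeff_zero_eq_eval_zero, hα, hβ, eval_sub]
    refine Complex.ofReal_injective ?_
    rw [Complex.ofReal_mul, hA0, projMinus, hg1, eval_nodalSum, eval_nodalSum]
    simp only [mul_zero, neg_zero, Complex.exp_zero, mul_sub, mul_one, Finset.mul_sum]
    push_cast
    rw [sub_add, ← Finset.sum_sub_distrib]
    congr 1
    refine Finset.sum_congr rfl fun j _ => ?_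
    have h5 := eval_nodal_eq_mul (κ := κ) j 0
    rw [Complex.real_smul, ← hP] at *
    rw [h5]
    have h6 := hk j
    push_cast at h6 ⊢
    linear_combination (gramC κ x j : ℂ) *
      ((Lagrange.nodal (Finset.univ.erase j) κ).eval 0 : ℝ) * h6
  rw [hg0, hP0] at hdet
  have hsq : ((-1 : ℝ) ^ n) * (-1) ^ n = 1 := by rw [← mul_pow]; simp
  refine mul_left_cancel₀ hprod (hdet.trans ?_)
  linear_combination (∏ j, κ j) * ((∏ j, κ j) * (kernelGen κ x 0).re) *
    wronskianDet (fun j x => Real.cosh (κ j * x)) x * hsq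

end wronskian

end

section

open Matrix

/-! ## The logarithmic variable -/

section logarithmic

variable {n : ℕ} {κ : Fin n → ℝ} {a : ℝ}

/-- The coefficient `μ` of the differential system, as a function of `a = exp (-x)`. -/
noncomputable def muCoeff {n : ℕ} (κ : Fin n → ℝ) (a : ℝ) : ℝ :=
  -2 * (-1) ^ n * gramS κ (-Real.log a)

theorem neg_log_pos (ha : a ∈ Set.Ioo (0 : ℝ) 1) : 0 < -Real.log a :=
  neg_pos.2 (Real.log_neg ha.1 ha.2)

theorem HasDerivAt.comp_neg_log {V : Type*} [NormedAddCommGroup V] [NormedSpace ℝ V] {f : ℝ → V}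
    {f' : V} (ha : a ∈ Set.Ioo (0 : ℝ) 1) (h : HasDerivAt f f' (-Real.log a)) :
    HasDerivAt (fun s => f (-Real.log s)) (-a⁻¹ • f') a :=
  HasDerivAt.scomp (g₁ := f) a h (Real.hasDerivAt_log ha.1.ne').neg

theorem det_borderedGram {x : ℝ} (hG : (expGram κ x).det ≠ 0) :
    (borderedGram κ x).det = -(expGram κ x).det * gramS κ x := by
  have : Invertible (expGram κ x) := Matrix.invertibleOfIsUnitDet _ (Ne.isUnit hG)
  rw [borderedGram, Matrix.det_fromBlocks₁₁, zero_sub, neg_mul, ← mul_neg]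
  congr 1
  rw [Matrix.det_unique, Matrix.neg_apply, neg_inj, Matrix.invOf_eq_nonsing_inv, Matrix.mul_assoc,
    gramS, dotProduct_comm, Matrix.mul_apply]
  rfl

theorem muCoeff_eq_det (hκ : Function.Injective κ) (ha : a ∈ Set.Ioo (0 : ℝ) 1) :
    muCoeff κ a = 2 * (-1) ^ n / gramFun κ a * (borderedGram κ (-Real.log a)).det := by
  have hG := (expGram_det_pos hκ (neg_log_pos ha)).ne'
  rw [det_borderedGram hG, muCoeff, gramFun]
  field_simp

theorem hasDerivAt_kernelGen_log (hκ : Function.Injective κ) (ha : a ∈ Set.Ioo (0 : ℝ) 1) (w : ℂ) :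
    HasDerivAt (fun s : ℝ => kernelGen κ (-Real.log s) w) (-a⁻¹ • (-(Complex.I * w) *
      kernelGen κ (-Real.log a) w + (muCoeff κ a : ℂ) * kernelGen κ (-Real.log a) (-w))) a := by
  refine (HasDerivAt.comp_neg_log ha
    (hasDerivAt_kernelGen_width hκ (neg_log_pos ha) w)).congr_deriv ?_
  rw [muCoeff]
  push_cast
  congr 1
  ring

theorem hasDerivAt_log_gramFun (hκ : Function.Injective κ) (ha : a ∈ Set.Ioo (0 : ℝ) 1) :
    HasDerivAt (fun s : ℝ => Real.log (gramFun κ s))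
      (-a⁻¹ • (gramC κ (-Real.log a) ⬝ᵥ gramU κ (-Real.log a) +
        gramD κ (-Real.log a) ⬝ᵥ gramV κ (-Real.log a))) a :=
  HasDerivAt.comp_neg_log ha (hasDerivAt_log_expGram_det hκ (neg_log_pos ha))

/-- In x the first derivative of log det G is uᵀG⁻¹u + vᵀG⁻¹v, and each summand has derivative -2s²;
together they give -4s² = -μ². -/
theorem hasDerivAt_eulerDeriv_log_gramFun (hκ : Function.Injective κ)
    (ha : a ∈ Set.Ioo (0 : ℝ) 1) :
    HasDerivAt (eulerDeriv fun s : ℝ => Real.log (gramFun κ s)) (-a⁻¹ * muCoeff κ a ^ 2) a := by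
  have h := HasDerivAt.comp_neg_log ha
    ((hasDerivAt_gramC_dotProduct_gramU hκ (neg_log_pos ha)).add
      (hasDerivAt_gramD_dotProduct_gramV hκ (neg_log_pos ha))).neg
  have e : (eulerDeriv fun s : ℝ => Real.log (gramFun κ s)) =ᶠ[𝓝 a] fun s =>
      (-((fun x => gramC κ x ⬝ᵥ gramU κ x) + fun x => gramD κ x ⬝ᵥ gramV κ x)) (-Real.log s) := by
    filter_upwards [isOpen_Ioo.mem_nhds ha] with s hs
    rw [eulerDeriv, (hasDerivAt_log_gramFun hκ hs).deriv, Pi.neg_apply, Pi.add_apply, smul_eq_mul,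
      neg_mul, mul_neg, mul_inv_cancel_left₀ hs.1.ne']
  refine (h.congr_of_eventuallyEq e).congr_deriv ?_
  have hsq : ((-1 : ℝ) ^ n) ^ 2 = 1 := by rw [← pow_mul, mul_comm, pow_mul]; simp
  rw [muCoeff, smul_eq_mul, mul_pow, mul_pow, hsq]
  ring

theorem muCoeff_sq (hκ : Function.Injective κ) (ha : a ∈ Set.Ioo (0 : ℝ) 1) :
    muCoeff κ a ^ 2 = -eulerDeriv (eulerDeriv fun s : ℝ => Real.log (gramFun κ s)) a := by
  rw [eulerDeriv, (hasDerivAt_eulerDeriv_log_gramFun hκ ha).deriv, neg_mul, mul_neg, neg_neg,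
    mul_inv_cancel_left₀ ha.1.ne']

theorem wronskianDet_sinh_ne_zero {x : ℝ} (hκ : Function.Injective κ) (hx : 0 < x)
    (hs : ∀ i j, κ i + κ j ≠ 0) :
    wronskianDet (fun j x => Real.sinh (κ j * x)) x ≠ 0 := by
  have hκ0 : ∀ j, κ j ≠ 0 := fun j h => hs j j (by rw [h, add_zero])
  rw [wronskianDet_sinh_eq_mul hκ hx hs]
  exact mul_ne_zero (mul_ne_zero (Finset.prod_ne_zero_iff.2 fun j _ => hκ0 j)
    (kernelGen_zero_pos hκ hx).ne') (wronskianDet_cosh_ne_zero hκ hx hs)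

/-- At w = 0 the system is a scalar equation with solution E(0), and the quotient of the Wronskians
is 1/(∏κ_j · E(0)). As `Real.log` is the logarithm of the absolute value, the sign of ∏κ_j plays no
part. -/
theorem hasDerivAt_log_wronskianDet_div (hκ : Function.Injective κ) (hs : ∀ i j, κ i + κ j ≠ 0)
    (ha : a ∈ Set.Ioo (0 : ℝ) 1) :
    HasDerivAt (fun s : ℝ => Real.log
      (wronskianDet (fun j x => Real.cosh (κ j * x)) (-Real.log s) /
        wronskianDet (fun j x => Real.sinh (κ j * x)) (-Real.log s))) (a⁻¹ * muCoeff κ a) a := by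
  have hκ0 : ∀ j, κ j ≠ 0 := fun j h => hs j j (by rw [h, add_zero])
  have hprod : ∏ j, κ j ≠ 0 := Finset.prod_ne_zero_iff.2 fun j _ => hκ0 j
  have hpos := (kernelGen_zero_pos hκ (neg_log_pos ha)).ne'
  have h0 := hasDerivAt_kernelGen_log hκ ha 0
  simp only [mul_zero, neg_zero, zero_mul, zero_add] at h0
  have h1 : HasDerivAt (fun s : ℝ => (kernelGen κ (-Real.log s) 0).re)
      (-a⁻¹ * (muCoeff κ a * (kernelGen κ (-Real.log a) 0).re)) a := by
    refine (Complex.reCLM.hasFDerivAt.comp_hasDerivAt a h0).congr_deriv ?_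
    simp
  have h2 := ((h1.log hpos).const_add (Real.log (∏ j, κ j))).neg
  have e : (fun s : ℝ => Real.log
      (wronskianDet (fun j x => Real.cosh (κ j * x)) (-Real.log s) /
        wronskianDet (fun j x => Real.sinh (κ j * x)) (-Real.log s))) =ᶠ[𝓝 a]
      -fun s => Real.log (∏ j, κ j) + Real.log (kernelGen κ (-Real.log s) 0).re := by
    filter_upwards [isOpen_Ioo.mem_nhds ha] with s hs'
    have hx := neg_log_pos hs'
    have hc := wronskianDet_cosh_ne_zero hκ hx hs
    rw [wronskianDet_sinh_eq_mul hκ hx hs, mul_comm, div_mul_cancel_left₀ hc, Real.log_inv,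
      Real.log_mul hprod (kernelGen_zero_pos hκ hx).ne', Pi.neg_apply]
  refine (h2.congr_of_eventuallyEq e).congr_deriv ?_
  field_simp

theorem muCoeff_eq_eulerDeriv_log_wronskianDet_div (hκ : Function.Injective κ)
    (hs : ∀ i j, κ i + κ j ≠ 0) (ha : a ∈ Set.Ioo (0 : ℝ) 1) :
    muCoeff κ a = eulerDeriv (fun s : ℝ => Real.log
      (wronskianDet (fun j x => Real.cosh (κ j * x)) (-Real.log s) /
        wronskianDet (fun j x => Real.sinh (κ j * x)) (-Real.log s))) a := by
  rw [eulerDeriv, (hasDerivAt_log_wronskianDet_div hκ hs ha).deriv, mul_inv_cancel_left₀ ha.1.ne']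

end logarithmic

end

section

open Matrix

/-! ## Multiple integrals as determinants -/

theorem sum_sign_mul_sign_mul_prod {R : Type*} [CommRing R] {m : ℕ}
    (A : Matrix (Fin m) (Fin m) R) :
    ∑ σ : Equiv.Perm (Fin m), ∑ τ : Equiv.Perm (Fin m), ((Equiv.Perm.sign σ : ℤ) : R) *
      ((Equiv.Perm.sign τ : ℤ) : R) * ∏ i, A (σ i) (τ i) = m.factorial * A.det := by
  rw [Finset.sum_comm]
  have h : ∀ τ : Equiv.Perm (Fin m), ∑ σ : Equiv.Perm (Fin m), ((Equiv.Perm.sign σ : ℤ) : R) *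
      ((Equiv.Perm.sign τ : ℤ) : R) * ∏ i, A (σ i) (τ i) = A.det := fun τ => by
    have h1 := Matrix.det_permute' τ A
    rw [Matrix.det_apply'] at h1
    have h2 : ((Equiv.Perm.sign τ : ℤ) : R) * ((Equiv.Perm.sign τ : ℤ) : R) = 1 := by
      rw [← Int.cast_mul, ← Units.val_mul, Int.units_mul_self]
      simp
    rw [← one_mul A.det, ← h2, mul_assoc, ← h1, Finset.mul_sum]
    refine Finset.sum_congr rfl fun σ _ => ?_
    simp only [Matrix.submatrix_apply, id]
    ring
  simp only [h, Finset.sum_const, Finset.card_univ, Fintype.card_perm, Fintype.card_fin,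
    nsmul_eq_mul]

theorem vandermondeSq_mul_prod {m : ℕ} (t : Fin m → ℝ) (w : ℝ → ℝ) :
    vandermondeSq t * ∏ i, w (t i) = ∑ σ : Equiv.Perm (Fin m), ∑ τ : Equiv.Perm (Fin m),
      ((Equiv.Perm.sign σ : ℤ) : ℝ) * ((Equiv.Perm.sign τ : ℤ) : ℝ) *
        ∏ i, (t i ^ ((σ i : ℕ) + (τ i : ℕ)) * w (t i)) := by
  have hdet : (Matrix.vandermonde t).det = ∑ σ : Equiv.Perm (Fin m),
      ((Equiv.Perm.sign σ : ℤ) : ℝ) * ∏ i, t i ^ (σ i : ℕ) := by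
    rw [← Matrix.det_transpose, Matrix.det_apply']
    rfl
  have hsq : vandermondeSq t = (Matrix.vandermonde t).det * (Matrix.vandermonde t).det := by
    rw [Matrix.det_vandermonde, vandermondeSq, ← Finset.prod_mul_distrib]
    refine Finset.prod_congr rfl fun i _ => ?_
    rw [← Finset.prod_mul_distrib]
    exact Finset.prod_congr rfl fun j _ => sq _
  rw [hsq, hdet, Finset.sum_mul_sum, Finset.sum_mul]
  refine Finset.sum_congr rfl fun σ _ => ?_
  rw [Finset.sum_mul]
  refine Finset.sum_congr rfl fun τ _ => ?_
  simp only [pow_add, Finset.prod_mul_distrib]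
  ring

/-- Andréief's identity: the square of the Vandermonde determinant is a double sum over
permutations, each term integrates as a product over the coordinates, and the double sum counts the
determinant of the moments m! times. -/
theorem cubeIntegral_eq_det (m : ℕ) {a : ℝ} {w : ℝ → ℝ} (hw : ContinuousOn w (Set.Icc a (1 / a))) :
    cubeIntegral m a w = m.factorial * (Matrix.of fun i j : Fin m =>
      ∫ t in Set.Icc a (1 / a), t ^ ((i : ℕ) + (j : ℕ)) * w t).det := by
  have hr : (volume : Measure (Fin m → ℝ)).restrict
      (Set.Icc (fun _ : Fin m => a) (fun _ : Fin m => 1 / a)) =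
      Measure.pi fun _ => volume.restrict (Set.Icc a (1 / a)) := by
    rw [← Set.pi_univ_Icc, volume_pi, Measure.restrict_pi_pi]
  have hint : ∀ σ τ : Equiv.Perm (Fin m), Integrable (fun t : Fin m → ℝ =>
      ((Equiv.Perm.sign σ : ℤ) : ℝ) * ((Equiv.Perm.sign τ : ℤ) : ℝ) *
        ∏ i, (t i ^ ((σ i : ℕ) + (τ i : ℕ)) * w (t i)))
      (Measure.pi fun _ => volume.restrict (Set.Icc a (1 / a))) := fun σ τ => by
    refine (Integrable.fintype_prod (f := fun i s => s ^ ((σ i : ℕ) + (τ i : ℕ)) * w s)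
      fun i => ?_).const_mul _
    exact ContinuousOn.integrableOn_Icc (((continuous_id.pow _).continuousOn).mul hw)
  rw [cubeIntegral, hr]
  simp only [vandermondeSq_mul_prod]
  rw [integral_finsetSum _ fun σ _ => integrable_finsetSum _ fun τ _ => hint σ τ,
    ← sum_sign_mul_sign_mul_prod]
  refine Finset.sum_congr rfl fun σ _ => ?_
  rw [integral_finsetSum _ fun τ _ => hint σ τ]
  refine Finset.sum_congr rfl fun τ _ => ?_
  rw [integral_const_mul, integral_fintype_prod_eq_prod
    (f := fun i s => s ^ ((σ i : ℕ) + (τ i : ℕ)) * w s)]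
  rfl

/-! ## Hankel matrices -/

/-- The Hankel matrix of order `n` of the sequence `h`. -/
def hankel (h : ℕ → ℝ) (n : ℕ) : Matrix (Fin n) (Fin n) ℝ :=
  Matrix.of fun i j => h ((i : ℕ) + (j : ℕ))

/-- The vector of the powers of `α`. -/
def powVec (n : ℕ) (α : ℝ) (i : Fin n) : ℝ := α ^ (i : ℕ)

/-- The bidiagonal matrix which maps `w` to `(w 0, w 1 - α * w 0, …)`. -/
def bidiag (m : ℕ) (α : ℝ) : Matrix (Fin (m + 1)) (Fin (m + 1)) ℝ :=
  Matrix.of fun i => Fin.cases (Pi.single 0 1)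
    (fun k => Pi.single k.succ 1 - α • Pi.single k.castSucc 1) i

theorem bidiag_zero (m : ℕ) (α : ℝ) : bidiag m α 0 = Pi.single 0 1 := rfl

theorem bidiag_succ {m : ℕ} (α : ℝ) (k : Fin m) :
    bidiag m α k.succ = Pi.single k.succ 1 - α • Pi.single k.castSucc 1 := rfl

theorem det_bidiag (m : ℕ) (α : ℝ) : (bidiag m α).det = 1 := by
  rw [Matrix.det_of_isLowerTriangular]
  · refine Finset.prod_eq_one fun i _ => ?_
    refine Fin.cases ?_ (fun k => ?_) i
    · simp [bidiag]
    · simp [bidiag, Fin.ext_iff]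
  · intro i j hij
    have hij' : i < j := hij
    revert hij'
    refine Fin.cases (fun h => ?_) (fun k h => ?_) i
    · simp [bidiag, h.ne']
    · have h1 : j ≠ k.succ := h.ne'
      have h2 : j ≠ k.castSucc := fun e => by
        rw [e] at h
        exact absurd h (by simp [Fin.lt_def])
      simp [bidiag, h1, h2]

theorem bidiag_mulVec_powVec (m : ℕ) (α : ℝ) :
    bidiag m α *ᵥ powVec (m + 1) α = Pi.single 0 1 := by
  funext i
  refine Fin.cases ?_ (fun k => ?_) i
  · rw [mulVec, bidiag_zero]
    simp [powVec]
  · rw [mulVec, bidiag_succ, sub_dotProduct, smul_dotProduct, single_one_dotProduct,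
      single_one_dotProduct]
    simp [powVec, pow_succ, mul_comm]

theorem bidiag_mul_apply_succ {m : ℕ} {ι : Type*} (α : ℝ) (A : Matrix (Fin (m + 1)) ι ℝ)
    (i : Fin m) (j : ι) :
    (bidiag m α * A) i.succ j = A i.succ j - α * A i.castSucc j := by
  rw [Matrix.mul_apply', bidiag_succ, sub_dotProduct, smul_dotProduct, single_one_dotProduct,
    single_one_dotProduct, smul_eq_mul]

theorem mul_bidiag_transpose_apply_succ {m : ℕ} {ι : Type*} (α : ℝ)
    (A : Matrix ι (Fin (m + 1)) ℝ) (i : ι) (j : Fin m) :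
    (A * (bidiag m α)ᵀ) i j.succ = A i j.succ - α * A i j.castSucc := by
  have := bidiag_mul_apply_succ α Aᵀ j i
  rw [← Matrix.transpose_apply (A * (bidiag m α)ᵀ), Matrix.transpose_mul,
    Matrix.transpose_transpose, this]
  rfl

/-- The bidiagonal matrices send the vectors of powers of α and β to the first basis vector, so the
bilinear form is the (0,0) entry of the inverse of H' = B_β H B_αᵀ. Times the determinant it is a
minor of H', and second differences make that minor the Hankel determinant for the moments
multiplied by (t - α)(t - β). -/
theorem powVec_dotProduct_inv_hankel (h : ℕ → ℝ) (m : ℕ) (hH : (hankel h (m + 1)).det ≠ 0)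
    (α β : ℝ) :
    (hankel h (m + 1)).det * (powVec (m + 1) α ⬝ᵥ
      ((hankel h (m + 1))⁻¹ *ᵥ powVec (m + 1) β)) =
      (hankel (fun k => h (k + 2) - (α + β) * h (k + 1) + α * β * h k) m).det := by
  set H := hankel h (m + 1) with hHdef
  set H' := bidiag m β * H * (bidiag m α)ᵀ with hH'
  have hdet : H'.det = H.det := by
    rw [hH', Matrix.det_mul, Matrix.det_mul, Matrix.det_transpose, det_bidiag, det_bidiag, one_mul,
      mul_one]
  have huβ : IsUnit (bidiag m β).det := by rw [det_bidiag]; exact isUnit_one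
  have huα : IsUnit (bidiag m α)ᵀ.det := by
    rw [Matrix.det_transpose, det_bidiag]; exact isUnit_one
  have hinv : H⁻¹ = (bidiag m α)ᵀ * H'⁻¹ * bidiag m β := by
    rw [hH', Matrix.mul_inv_rev, Matrix.mul_inv_rev, ← Matrix.mul_assoc,
      Matrix.mul_nonsing_inv _ huα, Matrix.one_mul, Matrix.mul_assoc,
      Matrix.nonsing_inv_mul _ huβ, Matrix.mul_one]
  rw [hinv, ← Matrix.mulVec_mulVec, bidiag_mulVec_powVec, ← Matrix.mulVec_mulVec,
    Matrix.dotProduct_mulVec, Matrix.vecMul_transpose, bidiag_mulVec_powVec, ← hdet,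
    single_one_dotProduct, Matrix.mulVec_single_one, Matrix.col_apply]
  have hadj : H'.det * H'⁻¹ 0 0 = H'.adjugate 0 0 := by
    rw [Matrix.inv_def, Ring.inverse_eq_inv', Matrix.smul_apply, smul_eq_mul,
      mul_inv_cancel_left₀ (hdet ▸ hH)]
  rw [hadj, Matrix.adjugate_fin_succ_eq_det_submatrix]
  simp only [Fin.val_zero, add_zero, pow_zero, one_mul]
  congr 1
  ext i j
  rw [Matrix.submatrix_apply]
  change H' i.succ j.succ = _
  rw [hH',
    mul_bidiag_transpose_apply_succ, bidiag_mul_apply_succ, bidiag_mul_apply_succ, hHdef]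
  simp only [hankel, Matrix.of_apply, Fin.val_succ, Fin.val_castSucc]
  rw [show (i : ℕ) + 1 + (j + 1) = i + j + 2 by ring, show (i : ℕ) + (j + 1) = i + j + 1 by ring,
    show (i : ℕ) + 1 + j = i + j + 1 by ring]
  ring

/-! ## Exponential moments -/

/-- The moments `∫ T ^ (ν + k) ω(T) dT` over `[exp (-x), exp x]`, where `T = exp y`. -/
noncomputable def expMoment (ν x : ℝ) (ω : ℝ → ℝ) (k : ℕ) : ℝ :=
  ∫ y in (-x)..x, Real.exp ((ν + 1 + k) * y) * ω (Real.exp y)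

/-- Distributing ν + 1 evenly between the two indices exhibits the Hankel matrix as a weighted Gram
matrix of exponentials. -/
theorem hankel_expMoment_posDef (ν : ℝ) {x : ℝ} (hx : 0 < x) {ω : ℝ → ℝ} (hω : Continuous ω)
    (hpos : ∀ y ∈ Set.Ioo (-x) x, 0 < ω (Real.exp y)) (n : ℕ) :
    (hankel (expMoment ν x ω) n).PosDef := by
  have e : hankel (expMoment ν x ω) n = weightedGram
      (fun (i : Fin n) y => Real.exp (((ν + 1) / 2 + i) * y)) (fun y => ω (Real.exp y)) (-x) x := by
    ext i j
    simp only [hankel, expMoment, weightedGram, Matrix.of_apply, ← Real.exp_add]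
    congr 1
    ext y
    congr 2
    push_cast
    ring
  rw [e]
  refine weightedGram_posDef (by linarith) (fun i => ?_) ?_ hpos (fun c hc =>
    exp_linearIndependent_on (fun i j h => ?_) (by linarith) c hc)
  · fun_prop
  · fun_prop
  · simpa [Fin.val_inj] using h

theorem hankel_expMoment_det_ne_zero (ν : ℝ) {x : ℝ} (hx : 0 < x) {ω : ℝ → ℝ} (hω : Continuous ω)
    (h : (∀ y ∈ Set.Ioo (-x) x, 0 < ω (Real.exp y)) ∨ ∀ y ∈ Set.Ioo (-x) x, ω (Real.exp y) < 0)
    (n : ℕ) : (hankel (expMoment ν x ω) n).det ≠ 0 := by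
  rcases h with h | h
  · exact (hankel_expMoment_posDef ν hx hω h n).det_pos.ne'
  · have h1 := (hankel_expMoment_posDef ν hx hω.neg
      (fun y hy => neg_pos.2 (h y hy)) n).det_pos.ne'
    have e : hankel (expMoment ν x (-ω)) n = -hankel (expMoment ν x ω) n := by
      ext i j
      simp [hankel, expMoment]
    rw [e, Matrix.det_neg] at h1
    exact right_ne_zero_of_mul h1

theorem expGram_arithProg (ν : ℝ) (n : ℕ) (x : ℝ) :
    expGram (arithProg ν n) x = hankel (expMoment ν x fun _ => 1) n := by
  ext i j
  simp only [expGram, hankel, expMoment, Matrix.of_apply, arithProg, mul_one]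
  congr 1
  ext y
  congr 2
  push_cast
  ring

theorem expMoment_mul_sub (ν x α : ℝ) {ω : ℝ → ℝ} (hω : Continuous ω) (k : ℕ) :
    expMoment ν x (fun t => (t - α) * ω t) k =
      expMoment ν x ω (k + 1) - α * expMoment ν x ω k := by
  rw [expMoment, expMoment, expMoment, ← intervalIntegral.integral_const_mul,
    ← intervalIntegral.integral_sub]
  · congr 1
    ext y
    have : Real.exp ((ν + 1 + (k + 1 : ℕ)) * y) = Real.exp ((ν + 1 + k) * y) * Real.exp y := by
      rw [← Real.exp_add]; congr 1; push_cast; ring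
    rw [this]
    ring
  · exact Continuous.intervalIntegrable (by fun_prop) _ _
  · exact Continuous.intervalIntegrable (by fun_prop) _ _

/-- Substitution t = exp(y); the Jacobian is the 1 in the exponent ν + 1 + k. -/
theorem integral_Icc_eq_expMoment (ν : ℝ) {a : ℝ} (ha : a ∈ Set.Ioo (0 : ℝ) 1) {ω : ℝ → ℝ}
    (hω : Continuous ω) (k : ℕ) :
    ∫ t in Set.Icc a (1 / a), t ^ k * (t ^ ν * ω t) = expMoment ν (-Real.log a) ω k := by
  have hle : a ≤ 1 / a := by
    rw [le_div_iff₀ ha.1]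
    nlinarith [ha.1, ha.2]
  rw [integral_Icc_eq_integral_Ioc, ← intervalIntegral.integral_of_le hle, expMoment]
  have h := intervalIntegral.integral_comp_mul_deriv'' (a := - -Real.log a) (b := -Real.log a)
    (f := Real.exp) (f' := Real.exp) (g := fun t => t ^ k * (t ^ ν * ω t))
    Real.continuous_exp.continuousOn (fun y _ => (Real.hasDerivAt_exp y).hasDerivWithinAt)
    Real.continuous_exp.continuousOn (by
      intro t ht
      obtain ⟨y, -, rfl⟩ := ht
      refine ContinuousAt.continuousWithinAt ?_
      exact (continuousAt_id.pow k).mul ((Real.continuousAt_rpow_const _ _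
        (Or.inl (Real.exp_pos y).ne')).mul hω.continuousAt))
  rw [neg_neg, Real.exp_log ha.1, Real.exp_neg, Real.exp_log ha.1, ← one_div] at h
  rw [← h, neg_neg]
  congr 1
  ext y
  have e : Real.exp ((ν + 1 + k) * y) = Real.exp y ^ k * Real.exp y ^ ν * Real.exp y := by
    rw [← Real.exp_nat_mul, ← Real.exp_mul, ← Real.exp_add, ← Real.exp_add]
    congr 1
    ring
  rw [e, Function.comp_apply]
  ring

theorem cubeIntegral_eq_det_hankel (ν : ℝ) {a : ℝ} (ha : a ∈ Set.Ioo (0 : ℝ) 1) {ω : ℝ → ℝ}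
    (hω : Continuous ω) (m : ℕ) :
    cubeIntegral m a (fun t => t ^ ν * ω t) =
      m.factorial * (hankel (expMoment ν (-Real.log a) ω) m).det := by
  rw [cubeIntegral_eq_det]
  · congr 2
    ext i j
    exact integral_Icc_eq_expMoment ν ha hω _
  · intro t ht
    refine ContinuousAt.continuousWithinAt ?_
    exact (Real.continuousAt_rpow_const _ _ (Or.inl (ha.1.trans_le ht.1).ne')).mul
      hω.continuousAt

end

section

open Matrix

/-! ## Trivial zeros in arithmetic progression -/

theorem arithProg_injective (ν : ℝ) (n : ℕ) : Function.Injective (arithProg ν n) := by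
  intro i j h
  simpa [arithProg, Fin.val_inj] using h

section arithmetic

variable {ν x : ℝ} {m : ℕ}

theorem gramU_arithProg (ν x : ℝ) (m : ℕ) : gramU (arithProg ν (m + 1)) x =
    Real.exp (-x * ((ν + 1) / 2)) • powVec (m + 1) (Real.exp (-x)) := by
  funext j
  rw [Pi.smul_apply, smul_eq_mul, gramU, arithProg, powVec, ← Real.exp_nat_mul, ← Real.exp_add]
  congr 1
  ring

theorem gramV_arithProg (ν x : ℝ) (m : ℕ) : gramV (arithProg ν (m + 1)) x =
    Real.exp (x * ((ν + 1) / 2)) • powVec (m + 1) (Real.exp x) := by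
  funext j
  rw [Pi.smul_apply, smul_eq_mul, gramV, arithProg, powVec, ← Real.exp_nat_mul, ← Real.exp_add]
  congr 1
  ring

theorem det_expGram_arithProg_ne_zero (hx : 0 < x) (n : ℕ) :
    (expGram (arithProg ν n) x).det ≠ 0 :=
  (expGram_det_pos (arithProg_injective ν n) hx).ne'

theorem det_mul_powVec_dotProduct (hx : 0 < x) (α β : ℝ) :
    (expGram (arithProg ν (m + 1)) x).det *
      (powVec (m + 1) α ⬝ᵥ ((expGram (arithProg ν (m + 1)) x)⁻¹ *ᵥ powVec (m + 1) β)) =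
      (hankel (expMoment ν x fun t => (t - α) * ((t - β) * 1)) m).det := by
  have hG := det_expGram_arithProg_ne_zero (ν := ν) hx (m + 1)
  rw [expGram_arithProg] at hG ⊢
  rw [powVec_dotProduct_inv_hankel _ _ hG]
  congr 2
  funext k
  rw [expMoment_mul_sub ν x α (by fun_prop), expMoment_mul_sub ν x β (by fun_prop),
    expMoment_mul_sub ν x β (by fun_prop)]
  ring

theorem exp_mem_Ioo {y : ℝ} (hy : y ∈ Set.Ioo (-x) x) :
    0 < Real.exp y ∧ Real.exp (-x) < Real.exp y ∧ Real.exp y < Real.exp x :=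
  ⟨Real.exp_pos y, Real.exp_lt_exp.2 hy.1, Real.exp_lt_exp.2 hy.2⟩

/-- The vectors u and v are power vectors of exp(-x) and exp(x), up to scalars whose product is 1,
so the Hankel formula applies with α and β at the two ends of the interval. -/
theorem det_mul_gramS (hx : 0 < x) : (expGram (arithProg ν (m + 1)) x).det *
    gramS (arithProg ν (m + 1)) x = (hankel (expMoment ν x fun t =>
      (t - Real.exp (-x)) * ((t - Real.exp x) * 1)) m).det := by
  rw [← det_mul_powVec_dotProduct hx, ← gramD_dotProduct_gramU, gramD, dotProduct_comm,
    gramU_arithProg, gramV_arithProg, Matrix.mulVec_smul, smul_dotProduct, dotProduct_smul,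
    smul_smul, ← Real.exp_add, neg_mul, neg_add_cancel, Real.exp_zero, one_smul]

theorem gramS_arithProg_ne_zero (hx : 0 < x) : gramS (arithProg ν (m + 1)) x ≠ 0 := by
  have h := det_mul_gramS (ν := ν) (m := m) hx
  refine right_ne_zero_of_mul (h.trans_ne ?_)
  refine hankel_expMoment_det_ne_zero ν hx (by fun_prop) (Or.inr fun y hy => ?_) m
  have := exp_mem_Ioo hy
  exact mul_neg_of_pos_of_neg (by linarith) (by linarith)

theorem powVec_zero (m : ℕ) : powVec (m + 1) 0 = Pi.single 0 1 := by
  funext i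
  refine Fin.cases ?_ (fun k => ?_) i
  · simp [powVec]
  · simp [powVec]

theorem gramC_arithProg_zero_eq : gramC (arithProg ν (m + 1)) x 0 =
    Real.exp (-x * ((ν + 1) / 2)) * (powVec (m + 1) 0 ⬝ᵥ
      ((expGram (arithProg ν (m + 1)) x)⁻¹ *ᵥ powVec (m + 1) (Real.exp (-x)))) := by
  rw [gramC, gramU_arithProg, Matrix.mulVec_smul, powVec_zero, single_one_dotProduct]
  rfl

theorem gramD_arithProg_zero_eq : gramD (arithProg ν (m + 1)) x 0 =
    Real.exp (x * ((ν + 1) / 2)) * (powVec (m + 1) 0 ⬝ᵥ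
      ((expGram (arithProg ν (m + 1)) x)⁻¹ *ᵥ powVec (m + 1) (Real.exp x))) := by
  rw [gramD, gramV_arithProg, Matrix.mulVec_smul, powVec_zero, single_one_dotProduct]
  rfl

/-- An entry with index 0 is a pairing with the power vector of 0, so the weight is t(t - exp(-x)),
positive inside the interval. For `gramD` it is t(t - exp x), which is negative there. -/
theorem gramC_arithProg_zero_ne_zero (hx : 0 < x) : gramC (arithProg ν (m + 1)) x 0 ≠ 0 := by
  rw [gramC_arithProg_zero_eq]
  refine mul_ne_zero (Real.exp_pos _).ne' (right_ne_zero_of_mul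
    ((det_mul_powVec_dotProduct hx _ _).trans_ne ?_))
  refine hankel_expMoment_det_ne_zero ν hx (by fun_prop) (Or.inl fun y hy => ?_) m
  have := exp_mem_Ioo hy
  exact mul_pos (by linarith) (by linarith)

theorem gramD_arithProg_zero_ne_zero (hx : 0 < x) : gramD (arithProg ν (m + 1)) x 0 ≠ 0 := by
  rw [gramD_arithProg_zero_eq]
  refine mul_ne_zero (Real.exp_pos _).ne' (right_ne_zero_of_mul
    ((det_mul_powVec_dotProduct hx _ _).trans_ne ?_))
  refine hankel_expMoment_det_ne_zero ν hx (by fun_prop) (Or.inr fun y hy => ?_) m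
  have := exp_mem_Ioo hy
  exact mul_neg_of_pos_of_neg (by linarith) (by linarith)

/-! ### The integral formula for the coefficient -/

theorem cubeIntegral_rpow_eq (ν : ℝ) {a : ℝ} (ha : a ∈ Set.Ioo (0 : ℝ) 1) (n : ℕ) :
    cubeIntegral n a (fun t => t ^ ν) =
      n.factorial * (expGram (arithProg ν n) (-Real.log a)).det := by
  have h := cubeIntegral_eq_det_hankel ν ha (ω := fun _ => 1) continuous_const n
  simp only [mul_one] at h
  rw [h, expGram_arithProg]

theorem cubeIntegral_rpow_pos (ν : ℝ) {a : ℝ} (ha : a ∈ Set.Ioo (0 : ℝ) 1) (n : ℕ) :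
    0 < cubeIntegral n a (fun t => t ^ ν) := by
  rw [cubeIntegral_rpow_eq ν ha]
  have := expGram_det_pos (arithProg_injective ν n) (neg_log_pos ha)
  positivity

theorem cubeIntegral_rpow_mul_eq (ν : ℝ) {a : ℝ} (ha : a ∈ Set.Ioo (0 : ℝ) 1) (m : ℕ) :
    cubeIntegral m a (fun t => t ^ ν * (t - a) * (1 / a - t)) =
      m.factorial * ((-1) ^ m * ((expGram (arithProg ν (m + 1)) (-Real.log a)).det *
        gramS (arithProg ν (m + 1)) (-Real.log a))) := by
  have h := cubeIntegral_eq_det_hankel ν ha (ω := fun t => (t - a) * (1 / a - t)) (by fun_prop) m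
  simp only [← mul_assoc] at h
  rw [h, det_mul_gramS (neg_log_pos ha), neg_neg, Real.exp_neg, Real.exp_log ha.1]
  have e : hankel (expMoment ν (-Real.log a) fun t => (t - a) * (1 / a - t)) m =
      -hankel (expMoment ν (-Real.log a) fun t => (t - a) * ((t - a⁻¹) * 1)) m := by
    ext i j
    simp only [hankel, expMoment, Matrix.of_apply, Matrix.neg_apply,
      ← intervalIntegral.integral_neg]
    congr 1
    ext y
    ring
  rw [e, Matrix.det_neg, Fintype.card_fin]

/-- The sign (-1)^m from reversing t - 1/a to 1/a - t in m variables cancels that of μ = 2(-1)^m s,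
and the ratio of the factorials m! and (m + 1)! accounts for the factor n = m + 1. -/
theorem muCoeff_arithProg_eq (ν : ℝ) {a : ℝ} (ha : a ∈ Set.Ioo (0 : ℝ) 1) (m : ℕ) :
    muCoeff (arithProg ν (m + 1)) a = 2 * (m + 1 : ℕ) *
      (cubeIntegral m a (fun t => t ^ ν * (t - a) * (1 / a - t)) /
        cubeIntegral (m + 1) a (fun t => t ^ ν)) := by
  have hG := det_expGram_arithProg_ne_zero (ν := ν) (neg_log_pos ha) (m + 1)
  have hf : (m.factorial : ℝ) ≠ 0 := by exact_mod_cast m.factorial_ne_zero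
  rw [cubeIntegral_rpow_mul_eq ν ha, cubeIntegral_rpow_eq ν ha, muCoeff, Nat.factorial_succ]
  have hm : ((m + 1 : ℕ) : ℝ) ≠ 0 := by positivity
  push_cast at hm ⊢
  field_simp
  ring

theorem muCoeff_arithProg_ne_zero (ν : ℝ) {a : ℝ} (ha : a ∈ Set.Ioo (0 : ℝ) 1) (m : ℕ) :
    muCoeff (arithProg ν (m + 1)) a ≠ 0 := by
  rw [muCoeff]
  exact mul_ne_zero (mul_ne_zero (by norm_num) (pow_ne_zero _ (by norm_num)))
    (gramS_arithProg_ne_zero (neg_log_pos ha))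

/-! ### Residuals -/

/-- The moments which border the Gram matrix of the arithmetic progression. -/
noncomputable def tailGram (ν : ℝ) (m : ℕ) (x : ℝ) (j : Fin (m + 1)) : ℝ :=
  expGram (arithProg ν (m + 2)) x j.castSucc (Fin.last _)

/-- The next term of the arithmetic progression. -/
noncomputable def arithNext (ν : ℝ) (m : ℕ) : ℝ := (ν + 1) / 2 + (m + 1)

/-- The value at `exp (-x)` of the orthogonal polynomial, normalized. -/
noncomputable def resMinus (ν : ℝ) (m : ℕ) (x : ℝ) : ℝ :=
  Real.exp (-x * arithNext ν m) - ∑ j, gramC (arithProg ν (m + 1)) x j • tailGram ν m x j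

/-- The value at `exp x` of the orthogonal polynomial, normalized. -/
noncomputable def resPlus (ν : ℝ) (m : ℕ) (x : ℝ) : ℝ :=
  Real.exp (x * arithNext ν m) - ∑ j, gramD (arithProg ν (m + 1)) x j • tailGram ν m x j

/-- The value at `0` of the orthogonal polynomial. -/
noncomputable def resZero (ν : ℝ) (m : ℕ) (x : ℝ) : ℝ :=
  -(((expGram (arithProg ν (m + 1)) x)⁻¹ *ᵥ powVec (m + 1) 0) ⬝ᵥ tailGram ν m x)

theorem arithProg_last (ν : ℝ) (m : ℕ) : arithProg ν (m + 2) (Fin.last _) = arithNext ν m := by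
  simp [arithProg, arithNext]

theorem gramU_last : gramU (arithProg ν (m + 2)) x (Fin.last _) =
    Real.exp (-x * arithNext ν m) := by
  rw [gramU, arithProg_last]

theorem gramV_last : gramV (arithProg ν (m + 2)) x (Fin.last _) =
    Real.exp (x * arithNext ν m) := by
  rw [gramV, arithProg_last]

/-- The bordering column obeys the same displacement relation and endpoint derivative as the
evaluators, with the next exponent in the place of iw; hence the equations for `resMinus` and
`resPlus` follow from the abstract lemmas. -/
theorem add_mul_tailGram (j : Fin (m + 1)) :
    (arithProg ν (m + 1) j + arithNext ν m) * tailGram ν m x j =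
      gramV (arithProg ν (m + 1)) x j * Real.exp (x * arithNext ν m) -
        gramU (arithProg ν (m + 1)) x j * Real.exp (-x * arithNext ν m) := by
  have h := add_mul_expGram (κ := arithProg ν (m + 2)) (x := x) j.castSucc (Fin.last _)
  rwa [arithProg_last, gramU_last, gramV_last] at h

theorem hasDerivAt_tailGram (x : ℝ) (j : Fin (m + 1)) : HasDerivAt (fun x => tailGram ν m x j)
    (gramU (arithProg ν (m + 1)) x j • Real.exp (-x * arithNext ν m) +
      gramV (arithProg ν (m + 1)) x j • Real.exp (x * arithNext ν m)) x := by
  have h := hasDerivAt_expGram (κ := arithProg ν (m + 2)) (x := x) j.castSucc (Fin.last _)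
  rwa [gramU_last, gramV_last] at h

theorem hasDerivAt_resMinus (hx : 0 < x) : HasDerivAt (resMinus ν m)
    (-arithNext ν m * resMinus ν m x -
      2 * gramS (arithProg ν (m + 1)) x * resPlus ν m x) x := by
  have he : HasDerivAt (fun x => Real.exp (-x * arithNext ν m))
      (Real.exp (-x * arithNext ν m) * (-1 * arithNext ν m)) x :=
    ((hasDerivAt_neg x).mul_const _).exp
  refine (hasDerivAt_sub_sum_gramC (arithProg_injective ν (m + 1)) hx
    (k := fun x j => tailGram ν m x j) (m := fun j => arithNext ν m * tailGram ν m x j)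
    (e₁ := fun x => Real.exp (-x * arithNext ν m)) (e₂ := fun x => Real.exp (x * arithNext ν m))
    (fun j => hasDerivAt_tailGram x j) (fun j => ?_) he).congr_deriv ?_
  · simp only [smul_eq_mul]
    linear_combination add_mul_tailGram (ν := ν) (x := x) j
  · rw [resMinus, resPlus]
    simp only [smul_eq_mul]
    have e : ∑ j, gramC (arithProg ν (m + 1)) x j * (arithNext ν m * tailGram ν m x j) =
        arithNext ν m * ∑ j, gramC (arithProg ν (m + 1)) x j * tailGram ν m x j := by
      rw [Finset.mul_sum]
      exact Finset.sum_congr rfl fun j _ => by ring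
    rw [e]
    ring

theorem hasDerivAt_resPlus (hx : 0 < x) : HasDerivAt (resPlus ν m)
    (arithNext ν m * resPlus ν m x -
      2 * gramS (arithProg ν (m + 1)) x * resMinus ν m x) x := by
  have he : HasDerivAt (fun x => Real.exp (x * arithNext ν m))
      (Real.exp (x * arithNext ν m) * (1 * arithNext ν m)) x :=
    ((hasDerivAt_id x).mul_const _).exp
  refine (hasDerivAt_sub_sum_gramD (arithProg_injective ν (m + 1)) hx
    (k := fun x j => tailGram ν m x j) (m := fun j => arithNext ν m * tailGram ν m x j)
    (e₁ := fun x => Real.exp (-x * arithNext ν m)) (e₂ := fun x => Real.exp (x * arithNext ν m))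
    (fun j => hasDerivAt_tailGram x j) (fun j => ?_) he).congr_deriv ?_
  · simp only [smul_eq_mul]
    linear_combination add_mul_tailGram (ν := ν) (x := x) j
  · rw [resMinus, resPlus]
    simp only [smul_eq_mul]
    have e : ∑ j, gramD (arithProg ν (m + 1)) x j * (arithNext ν m * tailGram ν m x j) =
        arithNext ν m * ∑ j, gramD (arithProg ν (m + 1)) x j * tailGram ν m x j := by
      rw [Finset.mul_sum]
      exact Finset.sum_congr rfl fun j _ => by ring
    rw [e]
    ring

/-- Column 0 of `inv_expGram_commutator` is paired with the bordering column; its displacement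
relation leaves the factor κ_0 - τ = -(m + 1), where τ is the next exponent. -/
theorem resPlus_mul_sub (hx : 0 < x) :
    resPlus ν m x * gramD (arithProg ν (m + 1)) x 0 -
      resMinus ν m x * gramC (arithProg ν (m + 1)) x 0 = -((m : ℝ) + 1) * resZero ν m x := by
  have hG := det_expGram_arithProg_ne_zero (ν := ν) hx (m + 1)
  set κ := arithProg ν (m + 1) with hκ
  set τ := arithNext ν m with hτ
  set R := (expGram κ x)⁻¹ with hR
  have hdiff : κ 0 - τ = -((m : ℝ) + 1) := by
    simp [hκ, hτ, arithProg, arithNext]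
  have hrow : ∀ w : Fin (m + 1) → ℝ, ∑ j, R j 0 * w j = (R *ᵥ w) 0 := fun w => by
    rw [mulVec, dotProduct]
    refine Finset.sum_congr rfl fun j _ => ?_
    have hs : R j 0 = R 0 j := congrFun (congrFun inv_expGram_transpose 0) j
    rw [hs]
  have h0 : resZero ν m x = -∑ j, R j 0 * tailGram ν m x j := by
    rw [resZero, powVec_zero, Matrix.mulVec_single_one]
    rfl
  have h1 : ∑ j, (κ j + κ 0) * R j 0 * tailGram ν m x j =
      (∑ j, gramD κ x j * tailGram ν m x j) * gramD κ x 0 -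
        (∑ j, gramC κ x j * tailGram ν m x j) * gramC κ x 0 := by
    rw [Finset.sum_mul, Finset.sum_mul, ← Finset.sum_sub_distrib]
    refine Finset.sum_congr rfl fun j _ => ?_
    rw [inv_expGram_commutator hG]
    ring
  have h2 : ∑ j, (κ j + κ 0) * R j 0 * tailGram ν m x j =
      Real.exp (x * τ) * ∑ j, R j 0 * gramV κ x j - Real.exp (-x * τ) * ∑ j, R j 0 * gramU κ x j
        + (κ 0 - τ) * ∑ j, R j 0 * tailGram ν m x j := by
    rw [Finset.mul_sum, Finset.mul_sum, Finset.mul_sum, ← Finset.sum_sub_distrib,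
      ← Finset.sum_add_distrib]
    refine Finset.sum_congr rfl fun j _ => ?_
    linear_combination R j 0 * add_mul_tailGram (ν := ν) (x := x) j
  rw [hrow, hrow] at h2
  rw [h0, ← hdiff, resPlus, resMinus]
  simp only [smul_eq_mul]
  change _ = Real.exp (x * τ) * gramD κ x 0 - Real.exp (-x * τ) * gramC κ x 0 + _ at h2
  linear_combination h1 - h2

/-! ### The shifted progression -/

theorem hankel_succ_mulVec_castSucc (h : ℕ → ℝ) (y : Fin (m + 1) → ℝ) (k : Fin m) :
    (hankel (fun k => h (k + 1)) (m + 1) *ᵥ y) k.castSucc = (hankel h (m + 1) *ᵥ y) k.succ := by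
  simp only [hankel, mulVec, dotProduct, Matrix.of_apply, Fin.val_succ, Fin.val_castSucc]
  refine Finset.sum_congr rfl fun j _ => ?_
  rw [add_right_comm]

theorem expMoment_add_one (ν x : ℝ) (ω : ℝ → ℝ) :
    expMoment (ν + 1) x ω = fun k => expMoment ν x ω (k + 1) := by
  funext k
  simp only [expMoment]
  congr 1
  ext y
  congr 3
  push_cast
  ring

/-- Passing from ν to ν + 1 shifts the moments by one, so the two matrices share all rows but one;
the new last row is `tailGram`. -/
theorem expGram_succ_mulVec_castSucc (y : Fin (m + 1) → ℝ) (k : Fin m) :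
    (expGram (arithProg (ν + 1) (m + 1)) x *ᵥ y) k.castSucc =
      (expGram (arithProg ν (m + 1)) x *ᵥ y) k.succ := by
  rw [expGram_arithProg, expGram_arithProg, expMoment_add_one, hankel_succ_mulVec_castSucc]

theorem expGram_succ_mulVec_last (y : Fin (m + 1) → ℝ) :
    (expGram (arithProg (ν + 1) (m + 1)) x *ᵥ y) (Fin.last m) = y ⬝ᵥ tailGram ν m x := by
  rw [expGram_arithProg, expMoment_add_one, dotProduct_comm]
  simp only [mulVec]
  congr 1
  funext j
  rw [tailGram, expGram_arithProg]
  simp only [hankel, Matrix.of_apply, Fin.val_last, Fin.val_castSucc]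
  congr 1
  ring

/-- The weight t - α gives the matrix for ν + 1 minus α times that for ν. On the solution for the
power vector of α all entries telescope except the last, which is minus the monic orthogonal
polynomial at α. -/
theorem sub_mul_expGram_mulVec (α : ℝ) (hx : 0 < x) :
    hankel (expMoment ν x fun t => (t - α) * 1) (m + 1) *ᵥ
        ((expGram (arithProg ν (m + 1)) x)⁻¹ *ᵥ powVec (m + 1) α) =
      (((expGram (arithProg ν (m + 1)) x)⁻¹ *ᵥ powVec (m + 1) α) ⬝ᵥ tailGram ν m x -
        α ^ (m + 1)) • Pi.single (Fin.last m) 1 := by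
  have hG := det_expGram_arithProg_ne_zero (ν := ν) hx (m + 1)
  set y := (expGram (arithProg ν (m + 1)) x)⁻¹ *ᵥ powVec (m + 1) α with hy
  have hGy : expGram (arithProg ν (m + 1)) x *ᵥ y = powVec (m + 1) α :=
    expGram_mulVec_inv_mulVec hG _
  have e : hankel (expMoment ν x fun t => (t - α) * 1) (m + 1) =
      expGram (arithProg (ν + 1) (m + 1)) x - α • expGram (arithProg ν (m + 1)) x := by
    rw [expGram_arithProg, expGram_arithProg, expMoment_add_one]
    ext i j
    simp only [hankel, Matrix.of_apply, Matrix.sub_apply, Matrix.smul_apply, smul_eq_mul]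
    rw [expMoment_mul_sub ν x α continuous_const]
  rw [e, Matrix.sub_mulVec, Matrix.smul_mulVec, hGy]
  funext i
  refine Fin.lastCases ?_ (fun k => ?_) i
  · rw [Pi.sub_apply, expGram_succ_mulVec_last]
    simp [powVec, pow_succ, mul_comm]
  · rw [Pi.sub_apply, expGram_succ_mulVec_castSucc, hGy]
    simp [powVec, pow_succ, mul_comm]

/-- The orthogonal polynomial has no zero outside the open interval: otherwise the solution for the
power vector of α would lie in the kernel of the Hankel matrix for t - α, a weight of constant sign,
and so vanish, whereas its image has first entry 1. -/
theorem powVec_residual_ne_zero (hx : 0 < x) {α : ℝ}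
    (h : (∀ y ∈ Set.Ioo (-x) x, α < Real.exp y) ∨ ∀ y ∈ Set.Ioo (-x) x, Real.exp y < α) :
    α ^ (m + 1) - ((expGram (arithProg ν (m + 1)) x)⁻¹ *ᵥ powVec (m + 1) α) ⬝ᵥ
      tailGram ν m x ≠ 0 := by
  intro h0
  have hG := det_expGram_arithProg_ne_zero (ν := ν) hx (m + 1)
  have h1 := sub_mul_expGram_mulVec (ν := ν) (m := m) α hx
  rw [← neg_sub, h0, neg_zero, zero_smul] at h1
  have hdet : (hankel (expMoment ν x fun t => (t - α) * 1) (m + 1)).det ≠ 0 := by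
    refine hankel_expMoment_det_ne_zero ν hx (by fun_prop) ?_ _
    exact h.imp (fun h y hy => by linarith [h y hy]) (fun h y hy => by linarith [h y hy])
  have h2 := Matrix.eq_zero_of_mulVec_eq_zero hdet h1
  have h3 := congrFun (expGram_mulVec_inv_mulVec hG (powVec (m + 1) α)) 0
  rw [h2, Matrix.mulVec_zero] at h3
  simp [powVec] at h3

theorem resZero_ne_zero (hx : 0 < x) : resZero ν m x ≠ 0 := by
  have h := powVec_residual_ne_zero (ν := ν) (m := m) hx (α := 0)
    (Or.inl fun y _ => Real.exp_pos y)
  rwa [zero_pow (Nat.succ_ne_zero m), zero_sub] at h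

theorem resMinus_ne_zero (hx : 0 < x) : resMinus ν m x ≠ 0 := by
  have h := powVec_residual_ne_zero (ν := ν) (m := m) hx (α := Real.exp (-x))
    (Or.inl fun y hy => (exp_mem_Ioo hy).2.1)
  have e : resMinus ν m x = Real.exp (-x * ((ν + 1) / 2)) * (Real.exp (-x) ^ (m + 1) -
      ((expGram (arithProg ν (m + 1)) x)⁻¹ *ᵥ powVec (m + 1) (Real.exp (-x))) ⬝ᵥ
      tailGram ν m x) := by
    have h1 : ∑ j, gramC (arithProg ν (m + 1)) x j • tailGram ν m x j =
        gramC (arithProg ν (m + 1)) x ⬝ᵥ tailGram ν m x := rfl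
    rw [resMinus, h1, gramC, gramU_arithProg, Matrix.mulVec_smul, smul_dotProduct, smul_eq_mul,
      mul_sub, ← Real.exp_nat_mul, ← Real.exp_add, arithNext]
    congr 2
    push_cast
    ring
  rw [e]
  exact mul_ne_zero (Real.exp_pos _).ne' h

theorem resPlus_ne_zero (hx : 0 < x) : resPlus ν m x ≠ 0 := by
  have h := powVec_residual_ne_zero (ν := ν) (m := m) hx (α := Real.exp x)
    (Or.inr fun y hy => (exp_mem_Ioo hy).2.2)
  have e : resPlus ν m x = Real.exp (x * ((ν + 1) / 2)) * (Real.exp x ^ (m + 1) -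
      ((expGram (arithProg ν (m + 1)) x)⁻¹ *ᵥ powVec (m + 1) (Real.exp x)) ⬝ᵥ
      tailGram ν m x) := by
    have h1 : ∑ j, gramD (arithProg ν (m + 1)) x j • tailGram ν m x j =
        gramD (arithProg ν (m + 1)) x ⬝ᵥ tailGram ν m x := rfl
    rw [resPlus, h1, gramD, gramV_arithProg, Matrix.mulVec_smul, smul_dotProduct, smul_eq_mul,
      mul_sub, ← Real.exp_nat_mul, ← Real.exp_add, arithNext]
    congr 2
    push_cast
    ring
  rw [e]
  exact mul_ne_zero (Real.exp_pos _).ne' h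

theorem gramU_add_one : gramU (arithProg (ν + 1) (m + 1)) x =
    Real.exp (-x / 2) • gramU (arithProg ν (m + 1)) x := by
  funext j
  rw [Pi.smul_apply, smul_eq_mul, gramU, gramU, arithProg, arithProg, ← Real.exp_add]
  congr 1
  ring

theorem gramV_add_one : gramV (arithProg (ν + 1) (m + 1)) x =
    Real.exp (x / 2) • gramV (arithProg ν (m + 1)) x := by
  funext j
  rw [Pi.smul_apply, smul_eq_mul, gramV, gramV, arithProg, arithProg, ← Real.exp_add]
  congr 1
  ring

/-- Applied to y, the shifted matrix gives αw except for a defect ρ in the last entry. Applied to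
the solution for the power vector of 0, it gives zero except for -`resZero` in the last entry, so
the combination removes the defect. -/
theorem expGram_succ_mulVec_residual (hx : 0 < x) {w y : Fin (m + 1) → ℝ} {α ρ : ℝ}
    (hy : expGram (arithProg ν (m + 1)) x *ᵥ y = w)
    (hw : ∀ k : Fin m, w k.succ = α * w k.castSucc)
    (hρ : ρ = α * w (Fin.last m) - y ⬝ᵥ tailGram ν m x) :
    expGram (arithProg (ν + 1) (m + 1)) x *ᵥ (resZero ν m x • y -
      ρ • ((expGram (arithProg ν (m + 1)) x)⁻¹ *ᵥ powVec (m + 1) 0)) =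
      (resZero ν m x * α) • w := by
  have hG := det_expGram_arithProg_ne_zero (ν := ν) hx (m + 1)
  funext i
  rw [Matrix.mulVec_sub, Matrix.mulVec_smul, Matrix.mulVec_smul]
  simp only [Pi.sub_apply, Pi.smul_apply, smul_eq_mul]
  refine Fin.lastCases ?_ (fun k => ?_) i
  · rw [expGram_succ_mulVec_last, expGram_succ_mulVec_last, hρ, resZero]
    ring
  · rw [expGram_succ_mulVec_castSucc, expGram_succ_mulVec_castSucc, hy,
      expGram_mulVec_inv_mulVec hG, hw, powVec_zero, Pi.single_eq_of_ne (Fin.succ_ne_zero k)]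
    ring

/-- The preceding lemma with w = v and α = exp x expresses the shifted d through the original one;
pairing with the shifted u gives s for ν + 1, the half powers exp(±x/2) cancelling. The companion
with exp(-x) starts from c. -/
theorem resZero_mul_exp_mul_gramS (hx : 0 < x) :
    resZero ν m x * Real.exp x * gramS (arithProg (ν + 1) (m + 1)) x =
      resZero ν m x * gramS (arithProg ν (m + 1)) x -
        resPlus ν m x * gramC (arithProg ν (m + 1)) x 0 := by
  have hG := det_expGram_arithProg_ne_zero (ν := ν) hx (m + 1)
  have hG' := det_expGram_arithProg_ne_zero (ν := ν + 1) hx (m + 1)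
  have h := expGram_succ_mulVec_residual hx (expGram_mulVec_gramD hG) (α := Real.exp x)
    (ρ := resPlus ν m x) (fun k => by
      rw [gramV_arithProg]; simp [powVec, pow_succ]; ring) (by
      have e : Real.exp (x * arithNext ν m) =
          Real.exp x * gramV (arithProg ν (m + 1)) x (Fin.last m) := by
        rw [gramV, arithProg, arithNext, ← Real.exp_add, Fin.val_last]
        congr 1
        ring
      rw [resPlus, e]
      rfl)
  have h1 : (resZero ν m x * Real.exp x) • gramD (arithProg (ν + 1) (m + 1)) x =
      Real.exp (x / 2) • (resZero ν m x • gramD (arithProg ν (m + 1)) x - resPlus ν m x •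
        ((expGram (arithProg ν (m + 1)) x)⁻¹ *ᵥ powVec (m + 1) 0)) := by
    refine expGram_mulVec_injective hG' ?_
    rw [Matrix.mulVec_smul, expGram_mulVec_gramD hG', Matrix.mulVec_smul, h, gramV_add_one,
      smul_comm]
  have h2 := congrArg (fun y => y ⬝ᵥ gramU (arithProg (ν + 1) (m + 1)) x) h1
  simp only [smul_dotProduct, gramD_dotProduct_gramU] at h2
  rw [gramU_add_one, dotProduct_smul, sub_dotProduct, smul_dotProduct, smul_dotProduct,
    gramD_dotProduct_gramU, dotProduct_comm, dotProduct_inv_expGram_mulVec, powVec_zero,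
    single_one_dotProduct] at h2
  simp only [smul_eq_mul] at h2
  have e : Real.exp (x / 2) * Real.exp (-x / 2) = 1 := by
    rw [← Real.exp_add]; ring_nf; exact Real.exp_zero
  rw [h2, ← mul_assoc, e, one_mul]
  rfl

theorem resZero_mul_exp_neg_mul_gramS (hx : 0 < x) :
    resZero ν m x * Real.exp (-x) * gramS (arithProg (ν + 1) (m + 1)) x =
      resZero ν m x * gramS (arithProg ν (m + 1)) x -
        resMinus ν m x * gramD (arithProg ν (m + 1)) x 0 := by
  have hG := det_expGram_arithProg_ne_zero (ν := ν) hx (m + 1)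
  have hG' := det_expGram_arithProg_ne_zero (ν := ν + 1) hx (m + 1)
  have h := expGram_succ_mulVec_residual hx (expGram_mulVec_gramC hG) (α := Real.exp (-x))
    (ρ := resMinus ν m x) (fun k => by
      rw [gramU_arithProg]; simp [powVec, pow_succ]; ring) (by
      have e : Real.exp (-x * arithNext ν m) =
          Real.exp (-x) * gramU (arithProg ν (m + 1)) x (Fin.last m) := by
        rw [gramU, arithProg, arithNext, ← Real.exp_add, Fin.val_last]
        congr 1
        ring
      rw [resMinus, e]
      rfl)
  have h1 : (resZero ν m x * Real.exp (-x)) • gramC (arithProg (ν + 1) (m + 1)) x =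
      Real.exp (-x / 2) • (resZero ν m x • gramC (arithProg ν (m + 1)) x - resMinus ν m x •
        ((expGram (arithProg ν (m + 1)) x)⁻¹ *ᵥ powVec (m + 1) 0)) := by
    refine expGram_mulVec_injective hG' ?_
    rw [Matrix.mulVec_smul, expGram_mulVec_gramC hG', Matrix.mulVec_smul, h, gramU_add_one,
      smul_comm]
  have h2 := congrArg (fun y => y ⬝ᵥ gramV (arithProg (ν + 1) (m + 1)) x) h1
  simp only [smul_dotProduct] at h2
  rw [← gramS, gramV_add_one, dotProduct_smul, sub_dotProduct, smul_dotProduct, smul_dotProduct,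
    ← gramS, dotProduct_comm _ (gramV _ _), dotProduct_inv_expGram_mulVec, powVec_zero,
    single_one_dotProduct] at h2
  simp only [smul_eq_mul] at h2
  have e : Real.exp (-x / 2) * Real.exp (x / 2) = 1 := by
    rw [← Real.exp_add]; ring_nf; exact Real.exp_zero
  rw [h2, ← mul_assoc, e, one_mul]
  rfl

end arithmetic

end

/-! ## The sixth Painlevé equation -/

/-- The left side is the quotient rule applied to q', with the derivatives of y = M and l = L
already replaced by the right sides of the system. With q, q - 1, q - b and q' written as fractions
over powers of p, the equation is a rational identity in b, y, l, N, K. -/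
theorem painleveVI_identity {N K b y l p : ℝ} (hp : p = b * y - 1) (hp0 : p ≠ 0) (hb0 : b ≠ 0)
    (hb1 : b - 1 ≠ 0) (hy0 : y ≠ 0) (hy1 : y - 1 ≠ 0) :
    (-(-(K * y + N * p * (y - 1) * l / (b - 1)) / b +
            (K * y + (b - 1) * (K * (-(K * y + N * p * (y - 1) * l / (b - 1)) / b))) +
          N * ((y + b * (-(K * y + N * p * (y - 1) * l / (b - 1)) / b)) * ((y - 1) * l) +
            p * (-(K * y + N * p * (y - 1) * l / (b - 1)) / b * l +
              (y - 1) * (N / 2 * (l ^ 2 - 1) * (b * y - 1 / y) / (b - 1) / b)))) * p ^ 2 -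
        -(y - 1 + (b - 1) * (K * y) + N * (p * ((y - 1) * l))) *
          (2 * p * (y + b * (-(K * y + N * p * (y - 1) * l / (b - 1)) / b)))) / (p ^ 2) ^ 2 =
      1 / 2 * (1 / (b * (y - 1) / p) + 1 / (-(b - 1) / p) + 1 / (-(b * y * (b - 1)) / p)) *
          (-(y - 1 + (b - 1) * (K * y) + N * (p * ((y - 1) * l))) / p ^ 2) ^ 2
        - (1 / b + 1 / (b - 1) + 1 / (-(b * y * (b - 1)) / p)) *
          (-(y - 1 + (b - 1) * (K * y) + N * (p * ((y - 1) * l))) / p ^ 2)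
        + b * (y - 1) / p * (-(b - 1) / p) * (-(b * y * (b - 1)) / p) / (b ^ 2 * (b - 1) ^ 2)
          * ((K - 1) ^ 2 / 2 + -K ^ 2 / 2 * b / (b * (y - 1) / p) ^ 2
            + N ^ 2 / 2 * (b - 1) / (-(b - 1) / p) ^ 2
            + (1 - N ^ 2) / 2 * b * (b - 1) / (-(b * y * (b - 1)) / p) ^ 2) := by
  field_simp
  rw [hp]
  ring

/-- Since q - 1 = (1 - b)/(bM - 1) and q - b = b(1 - b)M/(bM - 1), the conditions M ≠ 1, M ≠ 0 and
bM ≠ 1 say that q avoids 0, b and infinity; q ≠ 1 is then automatic. The derivative q' is linear in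
L, so M and L encode q and q'. -/
theorem solvesPainleveVI_of_system {N K : ℝ} {M L q : ℝ → ℝ}
    (hM : ∀ b ∈ Set.Ioo (0 : ℝ) 1, HasDerivAt M
      (-(K * M b + N * (b * M b - 1) * (M b - 1) * L b / (b - 1)) / b) b)
    (hL : ∀ b ∈ Set.Ioo (0 : ℝ) 1, HasDerivAt L
      (N / 2 * (L b ^ 2 - 1) * (b * M b - 1 / M b) / (b - 1) / b) b)
    (h0 : ∀ b ∈ Set.Ioo (0 : ℝ) 1, M b ≠ 0) (h1 : ∀ b ∈ Set.Ioo (0 : ℝ) 1, M b ≠ 1)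
    (hb : ∀ b ∈ Set.Ioo (0 : ℝ) 1, b * M b ≠ 1)
    (hq : ∀ b ∈ Set.Ioo (0 : ℝ) 1, q b = b * (M b - 1) / (b * M b - 1)) :
    SolvesPainleveVI ((K - 1) ^ 2 / 2) (-K ^ 2 / 2) (N ^ 2 / 2) ((1 - N ^ 2) / 2) q
      (Set.Ioo 0 1) := by
  have hq' : ∀ b ∈ Set.Ioo (0 : ℝ) 1, HasDerivAt q (-((M b - 1) + (b - 1) * (K * M b) +
      N * ((b * M b - 1) * ((M b - 1) * L b))) / (b * M b - 1) ^ 2) b := by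
    intro b hb01
    have hden : b * M b - 1 ≠ 0 := sub_ne_zero.2 (hb b hb01)
    have hb0 : b ≠ 0 := hb01.1.ne'
    have hb1 : b - 1 ≠ 0 := (sub_neg.2 hb01.2).ne
    have h := ((hasDerivAt_id b).mul ((hM b hb01).sub_const 1)).div
      (((hasDerivAt_id b).mul (hM b hb01)).sub_const 1) hden
    have e : q =ᶠ[𝓝 b] fun b => b * (M b - 1) / (b * M b - 1) := by
      filter_upwards [isOpen_Ioo.mem_nhds hb01] with s hs using hq s hs
    refine (h.congr_of_eventuallyEq e).congr_deriv ?_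
    simp only [Pi.mul_apply, id]
    field_simp
    ring
  intro b hb01
  have hden : b * M b - 1 ≠ 0 := sub_ne_zero.2 (hb b hb01)
  have hb0 : b ≠ 0 := hb01.1.ne'
  have hb1 : b - 1 ≠ 0 := (sub_neg.2 hb01.2).ne
  have hM0 := h0 b hb01
  have hM1 : M b - 1 ≠ 0 := sub_ne_zero.2 (h1 b hb01)
  have hqb := hq b hb01
  have hqb1 : q b - 1 = -(b - 1) / (b * M b - 1) := by
    rw [hqb]; field_simp; ring
  have hqbb : q b - b = -(b * M b * (b - 1)) / (b * M b - 1) := by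
    rw [hqb]; field_simp; ring
  have hnum := (((hM b hb01).sub_const 1).add
    (((hasDerivAt_id b).sub_const 1).mul ((hM b hb01).const_mul K))).add
    (((((hasDerivAt_id b).mul (hM b hb01)).sub_const 1).mul
      (((hM b hb01).sub_const 1).mul (hL b hb01))).const_mul N)
  have h2 := hnum.neg.div ((((hasDerivAt_id b).mul (hM b hb01)).sub_const 1).pow 2)
    (pow_ne_zero 2 hden)
  have e2 : deriv q =ᶠ[𝓝 b] fun b => -((M b - 1) + (b - 1) * (K * M b) +
      N * ((b * M b - 1) * ((M b - 1) * L b))) / (b * M b - 1) ^ 2 := by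
    filter_upwards [isOpen_Ioo.mem_nhds hb01] with s hs using (hq' s hs).deriv
  have h3 := h2.congr_of_eventuallyEq e2
  refine ⟨hb0, hb01.2.ne, ?_, ?_, ?_, (hq' b hb01).differentiableAt, h3.differentiableAt, ?_⟩
  · rw [hqb]
    exact div_ne_zero (mul_ne_zero hb0 hM1) hden
  · rw [← sub_ne_zero, hqb1]
    exact div_ne_zero (neg_ne_zero.2 hb1) hden
  · rw [← sub_ne_zero, hqbb]
    exact div_ne_zero (neg_ne_zero.2 (mul_ne_zero (mul_ne_zero hb0 hM0) hb1)) hden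
  · rw [h3.deriv, (hq' b hb01).deriv, hqb1, hqbb, hqb]
    refine Eq.trans ?_ (painleveVI_identity (K := K) (N := N) (l := L b) rfl hden hb0 hb1 hM0 hM1)
    simp only [Pi.mul_apply, Pi.add_apply, Pi.neg_apply, Pi.pow_apply, id]
    norm_num

/-! ### The closed system for the two quotients -/

section arithmetic

variable {ν x : ℝ} {m : ℕ}

theorem crossDiff_ne_zero (hx : 0 < x) :
    gramC (arithProg ν (m + 1)) x 0 * resMinus ν m x -
      gramD (arithProg ν (m + 1)) x 0 * resPlus ν m x ≠ 0 := by
  have h := resPlus_mul_sub (ν := ν) (m := m) hx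
  have h0 := resZero_ne_zero (ν := ν) (m := m) hx
  have : gramC (arithProg ν (m + 1)) x 0 * resMinus ν m x -
      gramD (arithProg ν (m + 1)) x 0 * resPlus ν m x = ((m : ℝ) + 1) * resZero ν m x := by
    linear_combination -h
  rw [this]
  positivity

theorem one_sub_exp_pos (hx : 0 < x) : 0 < 1 - Real.exp (-(2 * x)) :=
  sub_pos.2 (Real.exp_lt_one_iff.2 (by linarith))

/-- Eliminates the shifted s from the two contiguity relations and `resZero` through
`resPlus_mul_sub`. Thus s is a rational function of c₀, d₀, ρ₋, ρ₊ and exp(-2x), which closes the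
system. The next lemma eliminates s and keeps the shifted one. -/
theorem crossDiff_mul_gramS (hx : 0 < x) :
    (gramC (arithProg ν (m + 1)) x 0 * resMinus ν m x -
      gramD (arithProg ν (m + 1)) x 0 * resPlus ν m x) *
        (gramS (arithProg ν (m + 1)) x * (1 - Real.exp (-(2 * x)))) =
      ((m : ℝ) + 1) * (resMinus ν m x * gramD (arithProg ν (m + 1)) x 0 -
        Real.exp (-(2 * x)) * (resPlus ν m x * gramC (arithProg ν (m + 1)) x 0)) := by
  have e1 : Real.exp (-(2 * x)) * Real.exp x = Real.exp (-x) := by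
    rw [← Real.exp_add]; congr 1; ring
  linear_combination -gramS (arithProg ν (m + 1)) x * (1 - Real.exp (-(2 * x))) *
    resPlus_mul_sub (ν := ν) (m := m) hx +
    ((m : ℝ) + 1) * (Real.exp (-(2 * x)) * resZero_mul_exp_mul_gramS (ν := ν) (m := m) hx -
      resZero_mul_exp_neg_mul_gramS (ν := ν) (m := m) hx) -
    ((m : ℝ) + 1) * resZero ν m x * gramS (arithProg (ν + 1) (m + 1)) x * e1

theorem crossDiff_mul_gramS_succ (hx : 0 < x) :
    (gramC (arithProg ν (m + 1)) x 0 * resMinus ν m x -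
      gramD (arithProg ν (m + 1)) x 0 * resPlus ν m x) *
        (gramS (arithProg (ν + 1) (m + 1)) x * (1 - Real.exp (-(2 * x)))) =
      ((m : ℝ) + 1) * (Real.exp (-x) * (resMinus ν m x * gramD (arithProg ν (m + 1)) x 0 -
        resPlus ν m x * gramC (arithProg ν (m + 1)) x 0)) := by
  have e1 : Real.exp (-x) * Real.exp x = 1 := by
    rw [← Real.exp_add, neg_add_cancel, Real.exp_zero]
  have e2 : Real.exp (-(2 * x)) = Real.exp (-x) * Real.exp (-x) := by
    rw [← Real.exp_add]; congr 1; ring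
  rw [e2]
  linear_combination -gramS (arithProg (ν + 1) (m + 1)) x * (1 - Real.exp (-x) * Real.exp (-x)) *
    resPlus_mul_sub (ν := ν) (m := m) hx +
    ((m : ℝ) + 1) * Real.exp (-x) * (resZero_mul_exp_mul_gramS (ν := ν) (m := m) hx -
      resZero_mul_exp_neg_mul_gramS (ν := ν) (m := m) hx) -
    ((m : ℝ) + 1) * resZero ν m x * gramS (arithProg (ν + 1) (m + 1)) x * e1

/-- The quotient `c₀ ρ₊ / (d₀ ρ₋)`. -/
noncomputable def crossQuot (ν : ℝ) (m : ℕ) (x : ℝ) : ℝ :=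
  gramC (arithProg ν (m + 1)) x 0 * resPlus ν m x /
    (gramD (arithProg ν (m + 1)) x 0 * resMinus ν m x)

/-- The quotient `(c₀ ρ₋ + d₀ ρ₊) / (c₀ ρ₋ - d₀ ρ₊)`. -/
noncomputable def crossRatio (ν : ℝ) (m : ℕ) (x : ℝ) : ℝ :=
  (gramC (arithProg ν (m + 1)) x 0 * resMinus ν m x +
      gramD (arithProg ν (m + 1)) x 0 * resPlus ν m x) /
    (gramC (arithProg ν (m + 1)) x 0 * resMinus ν m x -
      gramD (arithProg ν (m + 1)) x 0 * resPlus ν m x)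

theorem crossQuot_ne_zero (hx : 0 < x) : crossQuot ν m x ≠ 0 :=
  div_ne_zero (mul_ne_zero (gramC_arithProg_zero_ne_zero hx) (resPlus_ne_zero hx))
    (mul_ne_zero (gramD_arithProg_zero_ne_zero hx) (resMinus_ne_zero hx))

theorem exp_mul_crossQuot_sub_one (hx : 0 < x) :
    (Real.exp (-(2 * x)) * crossQuot ν m x - 1) * (((m : ℝ) + 1) *
      (gramD (arithProg ν (m + 1)) x 0 * resMinus ν m x)) =
    -((gramC (arithProg ν (m + 1)) x 0 * resMinus ν m x -
      gramD (arithProg ν (m + 1)) x 0 * resPlus ν m x) *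
        (gramS (arithProg ν (m + 1)) x * (1 - Real.exp (-(2 * x))))) := by
  have hd := gramD_arithProg_zero_ne_zero (ν := ν) (m := m) hx
  have hp := resMinus_ne_zero (ν := ν) (m := m) hx
  rw [crossDiff_mul_gramS hx, crossQuot]
  field_simp
  ring

theorem crossQuot_sub_one (hx : 0 < x) :
    (crossQuot ν m x - 1) * (((m : ℝ) + 1) * Real.exp (-x) *
      (gramD (arithProg ν (m + 1)) x 0 * resMinus ν m x)) =
    -((gramC (arithProg ν (m + 1)) x 0 * resMinus ν m x -
      gramD (arithProg ν (m + 1)) x 0 * resPlus ν m x) *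
        (gramS (arithProg (ν + 1) (m + 1)) x * (1 - Real.exp (-(2 * x))))) := by
  have hd := gramD_arithProg_zero_ne_zero (ν := ν) (m := m) hx
  have hp := resMinus_ne_zero (ν := ν) (m := m) hx
  rw [crossDiff_mul_gramS_succ hx, crossQuot]
  field_simp
  ring

theorem exp_mul_crossQuot_ne_one (hx : 0 < x) :
    Real.exp (-(2 * x)) * crossQuot ν m x ≠ 1 := by
  rw [← sub_ne_zero]
  exact left_ne_zero_of_mul ((exp_mul_crossQuot_sub_one hx).trans_ne (neg_ne_zero.2
    (mul_ne_zero (crossDiff_ne_zero hx)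
      (mul_ne_zero (gramS_arithProg_ne_zero hx) (one_sub_exp_pos hx).ne'))))

theorem crossQuot_ne_one (hx : 0 < x) : crossQuot ν m x ≠ 1 := by
  rw [← sub_ne_zero]
  exact left_ne_zero_of_mul ((crossQuot_sub_one hx).trans_ne (neg_ne_zero.2
    (mul_ne_zero (crossDiff_ne_zero hx)
      (mul_ne_zero (gramS_arithProg_ne_zero hx) (one_sub_exp_pos hx).ne'))))

/-- Both s and its shift have the same factors in front, so their quotient depends on `crossQuot`
alone; this is the formula q = b(M - 1)/(bM - 1). -/
theorem exp_neg_mul_gramS_succ_div (hx : 0 < x) :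
    Real.exp (-x) * gramS (arithProg (ν + 1) (m + 1)) x / gramS (arithProg ν (m + 1)) x =
      Real.exp (-(2 * x)) * (crossQuot ν m x - 1) /
        (Real.exp (-(2 * x)) * crossQuot ν m x - 1) := by
  have hs := gramS_arithProg_ne_zero (ν := ν) (m := m) hx
  have hq := sub_ne_zero.2 (exp_mul_crossQuot_ne_one (ν := ν) (m := m) hx)
  have h1 := exp_mul_crossQuot_sub_one (ν := ν) (m := m) hx
  have h2 := crossQuot_sub_one (ν := ν) (m := m) hx
  have hn : ((m : ℝ) + 1) * (gramD (arithProg ν (m + 1)) x 0 * resMinus ν m x) ≠ 0 :=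
    mul_ne_zero (by positivity)
      (mul_ne_zero (gramD_arithProg_zero_ne_zero hx) (resMinus_ne_zero hx))
  have e2 : Real.exp (-(2 * x)) = Real.exp (-x) * Real.exp (-x) := by
    rw [← Real.exp_add]; congr 1; ring
  rw [div_eq_div_iff hs hq]
  refine mul_left_cancel₀ hn ?_
  linear_combination Real.exp (-x) * gramS (arithProg (ν + 1) (m + 1)) x * h1 -
    Real.exp (-x) * gramS (arithProg ν (m + 1)) x * h2 -
    ((m : ℝ) + 1) * (gramD (arithProg ν (m + 1)) x 0 * resMinus ν m x) *
      gramS (arithProg ν (m + 1)) x * (crossQuot ν m x - 1) * e2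

theorem gramS_arithProg_eq (hx : 0 < x) : gramS (arithProg ν (m + 1)) x =
    ((m : ℝ) + 1) * (resMinus ν m x * gramD (arithProg ν (m + 1)) x 0 -
        Real.exp (-(2 * x)) * (resPlus ν m x * gramC (arithProg ν (m + 1)) x 0)) /
      ((gramC (arithProg ν (m + 1)) x 0 * resMinus ν m x -
        gramD (arithProg ν (m + 1)) x 0 * resPlus ν m x) * (1 - Real.exp (-(2 * x)))) := by
  rw [eq_div_iff (mul_ne_zero (crossDiff_ne_zero hx) (one_sub_exp_pos hx).ne'),
    ← crossDiff_mul_gramS hx]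
  ring

/-- In the logarithmic derivative the linear terms add up to 2(κ_0 + τ) = 2(ν + m + 2), τ being the
next exponent; the terms with s become rational by `gramS_arithProg_eq` and involve the four
functions only through the two quotients. -/
theorem hasDerivAt_crossQuot (hx : 0 < x) : HasDerivAt (crossQuot ν m)
    (2 * ((ν + (m + 1) + 1) * crossQuot ν m x + (m + 1) * (Real.exp (-(2 * x)) *
      crossQuot ν m x - 1) * (crossQuot ν m x - 1) * crossRatio ν m x /
        (Real.exp (-(2 * x)) - 1))) x := by
  have hκ := arithProg_injective ν (m + 1)
  have hc := hasDerivAt_gramC hκ hx 0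
  have hd := hasDerivAt_gramD hκ hx 0
  have hd0 := gramD_arithProg_zero_ne_zero (ν := ν) (m := m) hx
  have hp0 := resMinus_ne_zero (ν := ν) (m := m) hx
  have hD := crossDiff_ne_zero (ν := ν) (m := m) hx
  have hb := (one_sub_exp_pos hx).ne'
  have hb' : Real.exp (-(2 * x)) - 1 ≠ 0 := by rw [← neg_sub]; exact neg_ne_zero.2 hb
  have h := (hc.mul (hasDerivAt_resPlus (ν := ν) (m := m) hx)).div
    (hd.mul (hasDerivAt_resMinus hx)) (mul_ne_zero hd0 hp0)
  refine h.congr_deriv ?_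
  simp only [Pi.mul_apply, crossQuot, crossRatio]
  rw [gramS_arithProg_eq hx]
  have e0 : arithProg ν (m + 1) 0 = (ν + 1) / 2 := by simp [arithProg]
  rw [e0, arithNext]
  generalize Real.exp (-(2 * x)) = β at *
  generalize gramC (arithProg ν (m + 1)) x 0 = c at *
  generalize gramD (arithProg ν (m + 1)) x 0 = d at *
  generalize resMinus ν m x = p at *
  generalize resPlus ν m x = r at *
  rw [← neg_sub 1 β]
  field_simp
  ring

/-- The products c₀ρ₋ and d₀ρ₊ have the same term in s, namely -2s(c₀ρ₊ + d₀ρ₋), and opposite linear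
coefficients ∓(m + 1). The term in s therefore cancels in the derivative of the denominator. -/
theorem hasDerivAt_crossRatio (hx : 0 < x) : HasDerivAt (crossRatio ν m)
    ((m + 1) * (crossRatio ν m x ^ 2 - 1) * (Real.exp (-(2 * x)) * crossQuot ν m x -
      1 / crossQuot ν m x) / (1 - Real.exp (-(2 * x)))) x := by
  have hκ := arithProg_injective ν (m + 1)
  have hc := hasDerivAt_gramC hκ hx 0
  have hd := hasDerivAt_gramD hκ hx 0
  have hp := hasDerivAt_resMinus (ν := ν) (m := m) hx
  have hr := hasDerivAt_resPlus (ν := ν) (m := m) hx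
  have hc0 := gramC_arithProg_zero_ne_zero (ν := ν) (m := m) hx
  have hr0 := resPlus_ne_zero (ν := ν) (m := m) hx
  have hd0 := gramD_arithProg_zero_ne_zero (ν := ν) (m := m) hx
  have hp0 := resMinus_ne_zero (ν := ν) (m := m) hx
  have hD := crossDiff_ne_zero (ν := ν) (m := m) hx
  have hb := (one_sub_exp_pos hx).ne'
  have h := ((hc.mul hp).add (hd.mul hr)).div ((hc.mul hp).sub (hd.mul hr)) hD
  refine h.congr_deriv ?_
  simp only [Pi.mul_apply, Pi.add_apply, Pi.sub_apply, crossQuot, crossRatio]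
  rw [gramS_arithProg_eq hx]
  have e0 : arithProg ν (m + 1) 0 = (ν + 1) / 2 := by simp [arithProg]
  rw [e0, arithNext]
  generalize Real.exp (-(2 * x)) = β at *
  generalize gramC (arithProg ν (m + 1)) x 0 = c at *
  generalize gramD (arithProg ν (m + 1)) x 0 = d at *
  generalize resMinus ν m x = p at *
  generalize resPlus ν m x = r at *
  field_simp
  ring

end arithmetic

/-! ### Passage from x to b = exp(-2x) -/

theorem sqrt_mem_Ioo {b : ℝ} (hb : b ∈ Set.Ioo (0 : ℝ) 1) : √b ∈ Set.Ioo (0 : ℝ) 1 :=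
  ⟨Real.sqrt_pos.2 hb.1, by rw [Real.sqrt_lt' one_pos]; simpa using hb.2⟩

theorem exp_neg_two_mul_neg_log_sqrt {b : ℝ} (hb : 0 < b) :
    Real.exp (-(2 * -Real.log (√b))) = b := by
  rw [Real.log_sqrt hb.le]
  ring_nf
  exact Real.exp_log hb

theorem HasDerivAt.comp_neg_log_sqrt {f : ℝ → ℝ} {f' b : ℝ} (hb : 0 < b)
    (h : HasDerivAt f f' (-Real.log (√b))) :
    HasDerivAt (fun s => f (-Real.log (√s))) (-f' / (2 * b)) b := by
  have hs := (Real.sqrt_pos.2 hb).ne'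
  have h1 := h.comp b ((Real.hasDerivAt_sqrt hb.ne').log hs).neg
  refine h1.congr_deriv ?_
  have e := Real.mul_self_sqrt hb.le
  have hb0 := hb.ne'
  field_simp
  rw [Real.sq_sqrt hb.le]

/-- With x = -log √b one has d/dx = -2b d/db, which puts the two equations in the required form with
N = n and K = ν + n + 1. The common factor -2(-1)ⁿ of the two coefficients cancels in q. -/
theorem solvesPainleveVI_muCoeff_arithProg (ν : ℝ) (m : ℕ) :
    SolvesPainleveVI ((ν + ((m + 1 : ℕ) : ℝ)) ^ 2 / 2) (-(ν + ((m + 1 : ℕ) : ℝ) + 1) ^ 2 / 2)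
      (((m + 1 : ℕ) : ℝ) ^ 2 / 2) ((1 - ((m + 1 : ℕ) : ℝ) ^ 2) / 2)
      (fun b => √b * muCoeff (arithProg (ν + 1) (m + 1)) (√b) /
        muCoeff (arithProg ν (m + 1)) (√b)) (Set.Ioo 0 1) := by
  have hpos : ∀ b ∈ Set.Ioo (0 : ℝ) 1, 0 < -Real.log (√b) := fun b hb =>
    neg_log_pos (sqrt_mem_Ioo hb)
  have key := solvesPainleveVI_of_system (N := ((m + 1 : ℕ) : ℝ))
    (K := ν + ((m + 1 : ℕ) : ℝ) + 1) (M := fun b => crossQuot ν m (-Real.log (√b)))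
    (L := fun b => crossRatio ν m (-Real.log (√b)))
    (q := fun b => √b * muCoeff (arithProg (ν + 1) (m + 1)) (√b) /
        muCoeff (arithProg ν (m + 1)) (√b)) ?_ ?_ ?_ ?_ ?_ ?_
  · rwa [add_sub_cancel_right] at key
  · intro b hb
    refine ((hasDerivAt_crossQuot (hpos b hb)).comp_neg_log_sqrt hb.1).congr_deriv ?_
    rw [exp_neg_two_mul_neg_log_sqrt hb.1]
    push_cast
    have hb0 := hb.1.ne'
    field_simp
  · intro b hb
    refine ((hasDerivAt_crossRatio (hpos b hb)).comp_neg_log_sqrt hb.1).congr_deriv ?_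
    rw [exp_neg_two_mul_neg_log_sqrt hb.1]
    push_cast
    have hb0 := hb.1.ne'
    have hb1 : 1 - b ≠ 0 := (sub_pos.2 hb.2).ne'
    rw [← neg_sub 1 b]
    field_simp
  · exact fun b hb => crossQuot_ne_zero (hpos b hb)
  · exact fun b hb => crossQuot_ne_one (hpos b hb)
  · intro b hb
    have := exp_mul_crossQuot_ne_one (ν := ν) (m := m) (hpos b hb)
    rwa [exp_neg_two_mul_neg_log_sqrt hb.1] at this
  · intro b hb
    have h := exp_neg_mul_gramS_succ_div (ν := ν) (m := m) (hpos b hb)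
    rw [exp_neg_two_mul_neg_log_sqrt hb.1, neg_neg, Real.exp_log (sqrt_mem_Ioo hb).1] at h
    rw [← h, muCoeff, muCoeff, mul_left_comm, mul_div_mul_left]
    exact mul_ne_zero (by norm_num) (pow_ne_zero _ (by norm_num))

/-! ### The theorem -/

theorem mainTheorem1 :
    ∃ (E : (n : ℕ) → (Fin n → ℝ) → ℝ → ℂ → ℂ) (μ : (n : ℕ) → (Fin n → ℝ) → ℝ → ℝ),
      -- arbitrary distinct purely imaginary trivial zeros `z_j = -i κ_j`
      (∀ (n : ℕ) (κ : Fin n → ℝ), Function.Injective κ →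
        -- for every `x > 0`: the Hilbert space, and the unique function `E n κ x`
        (∀ x : ℝ, 0 < x →
          IsClosed {f : PaleyWiener x | ∀ j, f (trivialZeros κ j) = 0} ∧
          Set.range (PaleyWienerMod.incomplete (x := x) (z := trivialZeros κ)) =
            {f : PaleyWiener x | ∀ j, f (trivialZeros κ j) = 0} ∧
          CompleteSpace (PaleyWienerMod x (trivialZeros κ)) ∧
          IsKernelGenerator x κ (E n κ x) ∧
          (∀ E' : ℂ → ℂ, IsKernelGenerator x κ E' → E' = E n κ x) ∧
          ∀ w : ℂ, conj (E n κ x (conj w)) = E n κ x (-w)) ∧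
        -- the differential system in `a = exp (-x)` and the formulas for its coefficient
        (∀ a : ℝ, a ∈ Set.Ioo 0 1 →
          (∀ w : ℂ,
            DifferentiableAt ℝ (fun s : ℝ => E n κ (-Real.log s) w) a ∧
            -(a : ℂ) * deriv (fun s : ℝ => E n κ (-Real.log s) w) a =
              -Complex.I * w * E n κ (-Real.log a) w
                + (μ n κ a : ℂ) * conj (E n κ (-Real.log a) (conj w))) ∧
          ((∀ i j, κ i + κ j ≠ 0) →
            wronskianDet (fun j x => Real.cosh (κ j * x)) (-Real.log a) ≠ 0 ∧
            wronskianDet (fun j x => Real.sinh (κ j * x)) (-Real.log a) ≠ 0 ∧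
            DifferentiableAt ℝ (fun s : ℝ => Real.log
              (wronskianDet (fun j x => Real.cosh (κ j * x)) (-Real.log s) /
                wronskianDet (fun j x => Real.sinh (κ j * x)) (-Real.log s))) a ∧
            μ n κ a = eulerDeriv (fun s : ℝ => Real.log
              (wronskianDet (fun j x => Real.cosh (κ j * x)) (-Real.log s) /
                wronskianDet (fun j x => Real.sinh (κ j * x)) (-Real.log s))) a) ∧
          0 < gramFun κ a ∧
          μ n κ a = 2 * (-1) ^ n / gramFun κ a * (borderedGram κ (-Real.log a)).det ∧
          DifferentiableAt ℝ (fun s : ℝ => Real.log (gramFun κ s)) a ∧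
          DifferentiableAt ℝ (eulerDeriv fun s : ℝ => Real.log (gramFun κ s)) a ∧
          μ n κ a ^ 2 = -eulerDeriv (eulerDeriv fun s : ℝ => Real.log (gramFun κ s)) a)) ∧
      -- trivial zeros in arithmetic progression
      (∀ (n : ℕ) (ν : ℝ), 1 ≤ n →
        (∀ a : ℝ, a ∈ Set.Ioo 0 1 →
          0 < cubeIntegral n a (fun t => t ^ ν) ∧
          μ n (arithProg ν n) a =
            2 * n * (cubeIntegral (n - 1) a (fun t => t ^ ν * (t - a) * (1 / a - t)) /
              cubeIntegral n a (fun t => t ^ ν)) ∧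
          μ n (arithProg ν n) a ≠ 0) ∧
        SolvesPainleveVI ((ν + n) ^ 2 / 2) (-(ν + n + 1) ^ 2 / 2) ((n : ℝ) ^ 2 / 2)
          ((1 - (n : ℝ) ^ 2) / 2)
          (fun b : ℝ =>
            Real.sqrt b * μ n (arithProg (ν + 1) n) (Real.sqrt b) /
              μ n (arithProg ν n) (Real.sqrt b))
          (Set.Ioo 0 1)) := by
  refine ⟨fun n κ x => kernelGen κ x, fun n κ a => muCoeff κ a, ?_, ?_⟩
  · intro n κ hκ
    refine ⟨fun x hx => ⟨?_, ?_, ?_, isKernelGenerator_kernelGen hκ hx, ?_, ?_⟩,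
      fun a ha => ⟨fun w => ⟨?_, ?_⟩, fun hs => ⟨?_, ?_, ?_, ?_⟩, ?_, ?_, ?_, ?_, ?_⟩⟩
    · exact PaleyWiener.isClosed_vanishing hx.le _
    · exact PaleyWienerMod.range_incomplete (trivialZeros_injective hκ)
    · exact PaleyWienerMod.completeSpace hx.le (trivialZeros_injective hκ)
    · exact fun E' hE' => IsKernelGenerator.unique hκ hx hE' (isKernelGenerator_kernelGen hκ hx)
    · exact conj_kernelGen_conj hκ hx
    · exact (hasDerivAt_kernelGen_log hκ ha w).differentiableAt
    · rw [(hasDerivAt_kernelGen_log hκ ha w).deriv, conj_kernelGen_conj hκ (neg_log_pos ha),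
        Complex.real_smul]
      have h0 : (a : ℂ) ≠ 0 := Complex.ofReal_ne_zero.2 ha.1.ne'
      push_cast
      field_simp
    · exact wronskianDet_cosh_ne_zero hκ (neg_log_pos ha) hs
    · exact wronskianDet_sinh_ne_zero hκ (neg_log_pos ha) hs
    · exact (hasDerivAt_log_wronskianDet_div hκ hs ha).differentiableAt
    · exact muCoeff_eq_eulerDeriv_log_wronskianDet_div hκ hs ha
    · exact expGram_det_pos hκ (neg_log_pos ha)
    · exact muCoeff_eq_det hκ ha
    · exact (hasDerivAt_log_gramFun hκ ha).differentiableAt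
    · exact (hasDerivAt_eulerDeriv_log_gramFun hκ ha).differentiableAt
    · exact muCoeff_sq hκ ha
  · rintro (_ | m) ν hn
    · exact absurd hn (by norm_num)
    · exact ⟨fun a ha => ⟨cubeIntegral_rpow_pos ν ha _, muCoeff_arithProg_eq ν ha m,
        muCoeff_arithProg_ne_zero ν ha m⟩, solvesPainleveVI_muCoeff_arithProg ν m⟩
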